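/- **Setting.** Let $d\ge 1$ be an integer, $\mathbb T^d=\mathbb R^d/2\pi\mathbb Z^d$, and let $s>d/2$ be an integer. For $\sigma\ge 0$ let $H^\sigma=H^\sigma(\mathbb T^d)$ be the Sobolev space of real functions $v\in L^2(\mathbb T^d)$ with $\|v\|_\sigma^2=\sum_{k\in\mathbb Z^d}(1+|k|^2)^\sigma|\hat v(k)|^2<\infty$, where $\hat v(k)=(2\pi)^{-d}\int_{\mathbb T^d}v(x)e^{-i\langle k,x\rangle}\,dx$. Let $\nu>0$, $T>0$, $J_\tau=[0,\tau]$, and let $f=P+g$, where $P$ is a real polynomial of degree $p\ge 2$ with leading coefficient $1$ and $g:\mathbb R\to\mathbb R$ is $C^\infty$, bounded, with all derivatives bounded. For $\tau>0$, $u_0\in H^s$, $\zeta\in C(J_\tau,H^{s+1})$ and $\varphi\in L^2(J_\tau,H^{s-1})$, a solution on $J_\tau$ of $$\partial_t u-\nu\Delta(u+\zeta)+f(u+\zeta)=\varphi,\qquad u(0)=u_0,\tag{1}$$ is a function $u\in C(J_\tau,H^s)\cap L^2(J_\tau,H^{s+1})$ with $u(0)=u_0$ which satisfies the equation, integrated over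 $[0,t]$ for every $t\in J_\tau$, in the sense of distributions on $\mathbb T^d$. Let $\hat\Theta(u_0,h,\tau)$ be the set of pairs $(\eta,\zeta)\in L^2(J_\tau,H^{s-1})\times C(J_\tau,H^{s+1})$ for which (1) with $\varphi=h+\eta$ has a solution on $J_\tau$; when this solution is unique, $\mathcal R_t(u_0,\zeta,h+\eta)$ denotes its value at time $t$. **Proposition 2.4.** Assume that either (a) $g=0$, or (b) $p>s$. Let $u_0,\eta\in H^{s+1}$, $\zeta\in H^{s+2}$ (not depending on time) and $h\in L^2(J_T,H^{s-1})$. Then there is $\delta_0\in(0,T]$ such that for every $\delta\in(0,\delta_0)$ we have $(\delta^{-1}\eta,\delta^{-1/p}\zeta)\in\hat\Theta(u_0,h,\delta)$, the corresponding solution on $[0,\delta]$ is unique, and $$\mathcal R_\delta(u_0,\delta^{-1/p}\zeta,h+\delta^{-1}\eta)\to u_0+\eta-\zeta^p\quad\text{in }H^s\text{ as }\delta\to0^+,$$ where $\zeta^p$ is the pointwise power, which belongs to $H^s$. -/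

import Mathlib

open MeasureTheory Filter Topology Set
open scoped ENNReal NNReal ContDiff

noncomputable section

namespace TorusParabolic

/-- The torus `ℝ^d / 2πℤ^d`. -/
abbrev Torus (d : ℕ) : Type := Fin d → AddCircle (2 * Real.pi)

instance factTwoPiPos : Fact (0 < 2 * Real.pi) := ⟨Real.two_pi_pos⟩

/-- Real square integrable functions on the torus, modulo equality almost everywhere. -/
abbrev L2 (d : ℕ) : Type := Lp ℝ 2 (volume : Measure (Torus d))

/-- `|k|²` for a frequency `k ∈ ℤ^d`. -/
def freqSq {d : ℕ} (k : Fin d → ℤ) : ℝ := ∑ i, (k i : ℝ) ^ 2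

/-- The Fourier coefficient `(2π)^{-d} ∫ v(x) e^{-i⟨k,x⟩} dx`. -/
def coeff {d : ℕ} (v : Torus d → ℝ) (k : Fin d → ℤ) : ℂ :=
  (((2 * Real.pi) ^ d)⁻¹ : ℝ) * ∫ x, (∏ i, fourier (-(k i)) (x i)) * (v x : ℂ)

/-- The norm of the Sobolev space `H^σ(𝕋^d)`, `σ ≥ 0`, with value `∞` outside `H^σ`:
the square root of `∑_k (1 + |k|²)^σ |v̂(k)|²`. -/
def sobNorm {d : ℕ} (σ : ℝ) (v : L2 d) : ℝ≥0∞ :=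
  (∑' k : Fin d → ℤ, ENNReal.ofReal ((1 + freqSq k) ^ σ * ‖coeff v k‖ ^ 2)) ^ (1 / 2 : ℝ)

/-- `v ∈ H^σ(𝕋^d)`, for `σ ≥ 0`. -/
def MemH {d : ℕ} (σ : ℝ) (v : L2 d) : Prop := sobNorm σ v < ⊤

/-- `u ∈ C([0,T], H^σ)`. -/
def MemCH {d : ℕ} (σ T : ℝ) (u : ℝ → L2 d) : Prop :=
  (∀ t ∈ Icc 0 T, MemH σ (u t)) ∧
    ∀ t ∈ Icc 0 T, Tendsto (fun r => sobNorm σ (u r - u t)) (𝓝[Icc 0 T] t) (𝓝 0)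

/-- `u ∈ L²([0,T], H^σ)`. As `H^σ` is separable and continuously embedded in `L²(𝕋^d)`,
a function with values in `H^σ` is strongly measurable for `H^σ` if and only if it is so
for `L²(𝕋^d)`. The finite integral forces `u(t) ∈ H^σ` for almost every `t ∈ [0,T]`. -/
def MemL2H {d : ℕ} (σ T : ℝ) (u : ℝ → L2 d) : Prop :=
  AEStronglyMeasurable u (volume.restrict (Icc 0 T)) ∧
    (∫⁻ t in Icc 0 T, sobNorm σ (u t) ^ 2) < ⊤

/-- `u` is a solution on `[0,T]`, in the class `C([0,T],H^s) ∩ L²([0,T],H^{s+1})`, of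
`∂ₜu - νΔ(u + ζ) + f(u + ζ) = φ`, `u(0) = u₀`.
The equation is integrated in time and is understood in the sense of distributions on the torus,
i.e. tested against each exponential `e^{-i⟨k,x⟩}`; the Laplacian multiplies the `k`-th Fourier
coefficient by `-|k|²`. -/
structure IsSolution {d : ℕ} (ν : ℝ) (f : ℝ → ℝ) (s T : ℝ) (u₀ : L2 d) (ζ φ u : ℝ → L2 d) :
    Prop where
  memCH : MemCH s T u
  memL2H : MemL2H (s + 1) T u
  initial : u 0 = u₀
  equation : ∀ t ∈ Icc 0 T, ∀ k : Fin d → ℤ,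
    coeff (u t) k = coeff u₀ k +
      ∫ r in (0 : ℝ)..t,
        (-((ν * freqSq k : ℝ) : ℂ) * (coeff (u r) k + coeff (ζ r) k)
          - coeff (fun x => f (u r x + ζ r x)) k + coeff (φ r) k)

/-- The set of control pairs `(η, ζ) ∈ L²([0,T],H^{s-1}) × C([0,T],H^{s+1})` for which
the problem with right-hand side `φ = h + η` has a solution on `[0,T]`. -/
def ThetaHat {d : ℕ} (ν : ℝ) (f : ℝ → ℝ) (s : ℝ) (u₀ : L2 d) (h : ℝ → L2 d) (T : ℝ) :
    Set ((ℝ → L2 d) × (ℝ → L2 d)) :=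
  {q | MemL2H (s - 1) T q.1 ∧ MemCH (s + 1) T q.2 ∧
    ∃ u, IsSolution ν f s T u₀ q.2 (fun t => h t + q.1 t) u}

end TorusParabolic

end

/-!
The controls are so large that on the time interval `[0, δ]` they dominate diffusion, drift and
source. Put `κ = δ^{1/p}`. The control `δ⁻¹ • η`, integrated over `[0, δ]`, moves the solution by
`η`. The control `κ⁻¹ • ζ` enters through the nonlinearity, and
`f(u + κ⁻¹ ζ) = κ⁻ᵖ (ζᵖ + O(κ))` in `H^s`, uniformly for `u` in a ball of `H^s`; integrated over
`[0, δ]`, this moves the solution by `-ζᵖ`. So the equation is the heat equation with the forcing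
`δ⁻¹ • (η - ζᵖ) + O(δ⁻¹ κ) + h`, and its solution at time `δ` is `u₀ + η - ζᵖ + o(1)`.

The expansion of `f` is `exists_wNorm_nonlinearity_sub_le`. For the polynomial it only uses that
`H^s` is an algebra for `s > d/2`. The part `g` is not small in `H^s`, since `g(ζ/κ)` oscillates:
its norm grows like `κ⁻ˢ` (`exists_wNorm_comp_le`, by differentiating `s` times with the product
estimate `wNorm_conv_le`), and `κᵖ⁻ˢ ≤ κ` if `s < p`. The diffusion of the control, `νκ⁻¹ Δζ`, is
`O(δ⁻¹ κ)` because `p ≥ 2` (`exists_wNorm_remainder_le`).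

Everything linear is done on Fourier coefficients, where the heat equation decouples into the
scalar equations `y' = -ν|k|² y + n`. The integrated form of each is equivalent to Duhamel's formula
(`integral_equation_iff`), and summing over `k` gives the smoothing estimates: the Duhamel
integral of a forcing in `L²(H^σ)` is continuous in `H^{σ+1}` and square integrable in `H^{σ+2}`.
The contribution of `h` at time `δ` is bounded by the `L²([0,δ], H^{s-1})` norm of `h`, which tends
to zero. The free evolution and the response to `δ⁻¹ • q` differ from `u₀` and `q` by
`O(√(νδ))` in `H^s` if `u₀, q ∈ H^{s+1}`.

For existence and uniqueness the nonlinearity is truncated to a globally Lipschitz function, at a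
height above the `L^∞` norm of the solutions considered (`equation_iff_mild`). Existence is then a
contraction argument in `C([0,δ], L²)`, restricted to curves in a ball of `H^s` that the above
bounds show to be invariant (`exists_mild`, `exists_isSolution`). At height `O(κ⁻¹)` the Lipschitz constant
is `O(κ^{1-p}) = O(δ⁻¹ κ)`, so the map contracts on an interval of length `δ`. Uniqueness is
Grönwall's inequality in `L²`, with a truncation height that depends on the two solutions
(`IsSolution.unique`).
-/

noncomputable section

namespace TorusParabolic

open scoped ComplexConjugate

variable {d : ℕ}

/-! ### Fourier series on the torus -/

/-- The exponential `x ↦ e^{i⟨k,x⟩}` on the torus. -/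
def mono (k : Fin d → ℤ) : C(Torus d, ℂ) where
  toFun x := ∏ i, fourier (k i) (x i)
  continuous_toFun := by fun_prop

lemma mono_apply (k : Fin d → ℤ) (x : Torus d) : mono k x = ∏ i, fourier (k i) (x i) := rfl

lemma mono_neg (k : Fin d → ℤ) (x : Torus d) : mono (-k) x = conj (mono k x) := by
  simp only [mono_apply, Pi.neg_apply, fourier_neg, map_prod]

lemma mono_add (k l : Fin d → ℤ) (x : Torus d) : mono (k + l) x = mono k x * mono l x := by
  simp only [mono_apply, Pi.add_apply, fourier_add, ← Finset.prod_mul_distrib]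

lemma mono_zero (x : Torus d) : mono (0 : Fin d → ℤ) x = 1 := by
  simp [mono_apply]

lemma norm_mono (k : Fin d → ℤ) (x : Torus d) : ‖mono k x‖ = 1 := by
  simp only [mono_apply, fourier_apply, norm_prod, Circle.norm_coe, Finset.prod_const_one]

lemma mono_single (z : Torus d) (i : Fin d) :
    mono (Pi.single i 1) z = fourier 1 (z i) := by
  rw [mono_apply, Finset.prod_eq_single i]
  · simp
  · intro j _ hj
    rw [Pi.single_eq_of_ne hj, fourier_zero]
  · simp

/-- The star subalgebra of `C(𝕋^d, ℂ)` generated by the exponentials. -/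
def monoSubalgebra (d : ℕ) : StarSubalgebra ℂ C(Torus d, ℂ) where
  toSubalgebra := Algebra.adjoin ℂ (range mono)
  star_mem' := by
    change Algebra.adjoin ℂ (range mono) ≤ star (Algebra.adjoin ℂ (range mono))
    refine Algebra.adjoin_le ?_
    rintro _ ⟨n, rfl⟩
    refine Algebra.subset_adjoin ⟨-n, ?_⟩
    ext1 x
    simp only [mono_neg, starRingEnd_apply, ContinuousMap.star_apply]

lemma monoSubalgebra_coe :
    Subalgebra.toSubmodule (monoSubalgebra d).toSubalgebra = Submodule.span ℂ (range mono) := by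
  apply Algebra.adjoin_eq_span_of_subset
  refine .trans (fun x ↦ Submonoid.closure_induction (fun _ ↦ id) ⟨0, ?_⟩ ?_)
    Submodule.subset_span
  · ext z
    simp [mono_zero]
  · rintro _ _ _ _ ⟨m, rfl⟩ ⟨n, rfl⟩
    refine ⟨m + n, ?_⟩
    ext z
    simp [mono_add]

lemma monoSubalgebra_separatesPoints : (monoSubalgebra d).SeparatesPoints := by
  intro x y hxy
  rw [Ne, funext_iff, not_forall] at hxy
  obtain ⟨i, hi⟩ := hxy
  refine ⟨_, ⟨mono (Pi.single i 1), Algebra.subset_adjoin ⟨Pi.single i 1, rfl⟩, rfl⟩, ?_⟩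
  dsimp only
  rw [mono_single, mono_single, fourier_one, fourier_one]
  exact fun h => hi (AddCircle.injective_toCircle Real.two_pi_pos.ne' (Circle.ext h))

lemma span_mono_closure_eq_top :
    (Submodule.span ℂ (range (mono (d := d)))).topologicalClosure = ⊤ := by
  rw [← monoSubalgebra_coe]
  exact congr_arg (Subalgebra.toSubmodule <| StarSubalgebra.toSubalgebra ·)
    (ContinuousMap.starSubalgebra_topologicalClosure_eq_top_of_separatesPoints _
      monoSubalgebra_separatesPoints)

lemma integral_fourier (n : ℤ) :
    ∫ x : AddCircle (2 * Real.pi), (fourier n x : ℂ) = if n = 0 then (2 * Real.pi : ℂ) else 0 := by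
  have h1 := orthonormal_iff_ite.mp (orthonormal_fourier (T := 2 * Real.pi)) 0 n
  simp only [ContinuousMap.inner_toLp, ← fourier_neg, ← fourier_add, neg_zero] at h1
  rw [AddCircle.integral_haarAddCircle] at h1
  simp only [add_zero] at h1
  have h2 : (2 * Real.pi : ℝ) ≠ 0 := Real.two_pi_pos.ne'
  rw [inv_smul_eq_iff₀ h2] at h1
  rw [h1]
  by_cases hn : n = 0
  · simp [hn]
  · simp [hn, Ne.symm hn]

lemma integral_mono (k : Fin d → ℤ) :
    ∫ x : Torus d, mono k x = if k = 0 then ((2 * Real.pi) ^ d : ℂ) else 0 := by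
  simp only [mono_apply]
  rw [MeasureTheory.integral_fintype_prod_volume_eq_prod]
  simp only [integral_fourier]
  split_ifs with h
  · simp [h]
  · obtain ⟨i, hi⟩ := Function.ne_iff.mp h
    exact Finset.prod_eq_zero (Finset.mem_univ i) (by simpa using hi)

/-- The square root of the volume of the torus. -/
def volSqrt (d : ℕ) : ℝ := Real.sqrt ((2 * Real.pi) ^ d)

lemma volSqrt_pos : 0 < volSqrt d := Real.sqrt_pos.2 (pow_pos Real.two_pi_pos d)

lemma volSqrt_sq : volSqrt d ^ 2 = (2 * Real.pi) ^ d :=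
  Real.sq_sqrt (pow_pos Real.two_pi_pos d).le

/-- The `L²`-normalized exponentials. -/
def monoLp (k : Fin d → ℤ) : Lp ℂ 2 (volume : Measure (Torus d)) :=
  ((volSqrt d)⁻¹ : ℂ) • ContinuousMap.toLp (E := ℂ) 2 volume ℂ (mono k)

lemma orthonormal_monoLp : Orthonormal ℂ (monoLp (d := d)) := by
  rw [orthonormal_iff_ite]
  intro m n
  have hv : ((volSqrt d : ℝ) : ℂ) ≠ 0 := by exact_mod_cast volSqrt_pos.ne'
  have hv2 : ((volSqrt d : ℝ) : ℂ) ^ 2 = (2 * Real.pi : ℂ) ^ d := by exact_mod_cast volSqrt_sq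
  simp only [monoLp, inner_smul_left, inner_smul_right, ContinuousMap.inner_toLp, ← mono_neg,
    ← mono_add, integral_mono]
  by_cases h : m = n
  · subst h
    simp only [map_inv₀, Complex.conj_ofReal, add_neg_cancel, if_true, ← hv2]
    field_simp
  · have : ¬ (n + -m = 0) := by
      rw [add_neg_eq_zero]; exact fun h' => h h'.symm
    simp [h, this]

lemma span_monoLp_closure_eq_top :
    (Submodule.span ℂ (range (monoLp (d := d)))).topologicalClosure = ⊤ := by
  have h1 : (Submodule.span ℂ (range (fun k : Fin d → ℤ =>
      ContinuousMap.toLp (E := ℂ) 2 (volume : Measure (Torus d)) ℂ (mono k)))).topologicalClosure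
      = ⊤ := by
    simpa only [Submodule.map_span, ContinuousLinearMap.coe_coe, ← range_comp,
      Function.comp_def] using
      (ContinuousMap.toLp_denseRange ℂ (volume : Measure (Torus d)) ℂ
        (by simp : (2 : ℝ≥0∞) ≠ ⊤)).topologicalClosure_map_submodule
        (span_mono_closure_eq_top (d := d))
  have hv : ((volSqrt d : ℝ) : ℂ) ≠ 0 := by exact_mod_cast volSqrt_pos.ne'
  rw [eq_top_iff, ← h1]
  refine Submodule.topologicalClosure_mono (Submodule.span_le.2 ?_)
  rintro _ ⟨k, rfl⟩
  have : ContinuousMap.toLp (E := ℂ) 2 (volume : Measure (Torus d)) ℂ (mono k)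
      = (volSqrt d : ℂ) • monoLp k := by
    rw [monoLp, smul_inv_smul₀ hv]
  simp only [this]
  exact Submodule.smul_mem _ _ (Submodule.subset_span ⟨k, rfl⟩)

/-- The orthonormal basis of `L²(𝕋^d, ℂ)` formed by the normalized exponentials. -/
def monoBasis (d : ℕ) : HilbertBasis (Fin d → ℤ) ℂ (Lp ℂ 2 (volume : Measure (Torus d))) :=
  HilbertBasis.mk orthonormal_monoLp span_monoLp_closure_eq_top.ge

/-- Fourier coefficient of a complex valued function. -/
def ccoeff (F : Torus d → ℂ) (k : Fin d → ℤ) : ℂ :=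
  (((2 * Real.pi) ^ d)⁻¹ : ℝ) * ∫ x, mono (-k) x * F x

lemma coeff_eq_ccoeff (v : Torus d → ℝ) (k : Fin d → ℤ) :
    coeff v k = ccoeff (fun x => (v x : ℂ)) k := rfl

lemma ccoeff_congr {F G : Torus d → ℂ} (h : F =ᵐ[volume] G) : ccoeff F = ccoeff G := by
  ext k
  unfold ccoeff
  congr 1
  refine integral_congr_ae ?_
  filter_upwards [h] with x hx
  rw [hx]

lemma coeff_congr {v w : Torus d → ℝ} (h : v =ᵐ[volume] w) : coeff v = coeff w := by
  ext k
  rw [coeff_eq_ccoeff, coeff_eq_ccoeff, ccoeff_congr]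
  filter_upwards [h] with x hx
  rw [hx]

lemma integrable_mono_mul {F : Torus d → ℂ} (hF : Integrable F) (k : Fin d → ℤ) :
    Integrable (fun x => mono k x * F x) := by
  refine hF.bdd_mul (c := 1) (mono k).continuous.aestronglyMeasurable ?_
  exact .of_forall fun x => (norm_mono k x).le

lemma ccoeff_add {F G : Torus d → ℂ} (hF : Integrable F) (hG : Integrable G) (k : Fin d → ℤ) :
    ccoeff (fun x => F x + G x) k = ccoeff F k + ccoeff G k := by
  simp only [ccoeff, mul_add]
  rw [integral_add (integrable_mono_mul hF _) (integrable_mono_mul hG _)]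
  ring

lemma ccoeff_const_mul (c : ℂ) (F : Torus d → ℂ) (k : Fin d → ℤ) :
    ccoeff (fun x => c * F x) k = c * ccoeff F k := by
  simp only [ccoeff, mul_left_comm _ c]
  rw [integral_const_mul]
  ring

lemma ccoeff_conj (F : Torus d → ℂ) (k : Fin d → ℤ) :
    ccoeff (fun x => conj (F x)) k = conj (ccoeff F (-k)) := by
  unfold ccoeff
  rw [map_mul, Complex.conj_ofReal, ← integral_conj]
  simp only [map_mul, mono_neg, neg_neg]

lemma coeff_neg_freq (v : Torus d → ℝ) (k : Fin d → ℤ) : coeff v (-k) = conj (coeff v k) := by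
  have := ccoeff_conj (fun x => (v x : ℂ)) (-k)
  rw [neg_neg] at this
  rw [coeff_eq_ccoeff, coeff_eq_ccoeff, ← this]
  simp only [Complex.conj_ofReal]

lemma coeff_add {v w : Torus d → ℝ} (hv : Integrable v) (hw : Integrable w) (k : Fin d → ℤ) :
    coeff (fun x => v x + w x) k = coeff v k + coeff w k := by
  simp only [coeff_eq_ccoeff, Complex.ofReal_add]
  exact ccoeff_add hv.ofReal hw.ofReal k

lemma coeff_const_mul (c : ℝ) (v : Torus d → ℝ) (k : Fin d → ℤ) :
    coeff (fun x => c * v x) k = c * coeff v k := by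
  simp only [coeff_eq_ccoeff, Complex.ofReal_mul]
  exact ccoeff_const_mul _ _ k

lemma coeff_sub {v w : Torus d → ℝ} (hv : Integrable v) (hw : Integrable w) (k : Fin d → ℤ) :
    coeff (fun x => v x - w x) k = coeff v k - coeff w k := by
  have h1 : coeff (fun x => v x - w x) k = coeff (fun x => v x + (-1) * w x) k := by
    congr 1; ext x; ring
  rw [h1, coeff_add hv (hw.const_mul _), coeff_const_mul]
  push_cast; ring

/-- The Fourier coefficients of the real part. -/
lemma coeff_re {F : Torus d → ℂ} (hF : Integrable F) (k : Fin d → ℤ) :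
    coeff (fun x => (F x).re) k = (ccoeff F k + conj (ccoeff F (-k))) / 2 := by
  have h1 : (fun x => (((F x).re : ℝ) : ℂ)) = fun x => (1 / 2 : ℂ) * (F x + conj (F x)) := by
    ext x
    rw [Complex.re_eq_add_conj]; ring
  have hF' : Integrable (fun x => conj (F x)) :=
    (Complex.conjLIE.toContinuousLinearEquiv.toContinuousLinearMap).integrable_comp hF
  rw [coeff_eq_ccoeff, h1, ccoeff_const_mul, ccoeff_add hF hF', ccoeff_conj]
  ring

lemma monoBasis_repr (F : Lp ℂ 2 (volume : Measure (Torus d))) (k : Fin d → ℤ) :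
    (monoBasis d).repr F k = volSqrt d * ccoeff F k := by
  have hv : ((volSqrt d : ℝ) : ℂ) ≠ 0 := by exact_mod_cast volSqrt_pos.ne'
  have hv2 : ((volSqrt d : ℝ) : ℂ) ^ 2 = (2 * Real.pi : ℂ) ^ d := by exact_mod_cast volSqrt_sq
  have h1 : inner ℂ (ContinuousMap.toLp (E := ℂ) 2 (volume : Measure (Torus d)) ℂ (mono k)) F
      = ∫ x, mono (-k) x * F x := by
    rw [MeasureTheory.L2.inner_def]
    apply integral_congr_ae
    filter_upwards [ContinuousMap.coeFn_toLp (p := 2) (𝕜 := ℂ) volume (mono k)] with x hx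
    rw [hx, mono_neg]
    simp [RCLike.inner_apply, mul_comm]
  rw [(monoBasis d).repr_apply_apply F k, monoBasis, HilbertBasis.coe_mk, monoLp,
    inner_smul_left, h1, ccoeff]
  push_cast
  rw [← hv2]
  simp only [map_inv₀, Complex.conj_ofReal]
  field_simp

/-- **Parseval's identity**, polarized. -/
lemma hasSum_conj_ccoeff_mul {F G : Torus d → ℂ} (hF : MemLp F 2) (hG : MemLp G 2) :
    HasSum (fun k => conj (ccoeff F k) * ccoeff G k)
      ((((2 * Real.pi) ^ d)⁻¹ : ℝ) * ∫ x, conj (F x) * G x) := by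
  have hv : ((volSqrt d : ℝ) : ℂ) ≠ 0 := by exact_mod_cast volSqrt_pos.ne'
  have hv2 : ((volSqrt d : ℝ) : ℂ) ^ 2 = (2 * Real.pi : ℂ) ^ d := by exact_mod_cast volSqrt_sq
  have h1 := ((monoBasis d).hasSum_inner_mul_inner (hF.toLp F) (hG.toLp G)).mul_left
    ((((2 * Real.pi) ^ d)⁻¹ : ℝ) : ℂ)
  have h2 : inner ℂ (hF.toLp F) (hG.toLp G) = ∫ x, conj (F x) * G x := by
    rw [MeasureTheory.L2.inner_def]
    apply integral_congr_ae
    filter_upwards [hF.coeFn_toLp, hG.coeFn_toLp] with x hx hy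
    rw [hx, hy]
    simp [RCLike.inner_apply, mul_comm]
  rw [h2] at h1
  refine h1.congr_fun fun k => ?_
  rw [← inner_conj_symm (hF.toLp F), ← HilbertBasis.repr_apply_apply,
    ← HilbertBasis.repr_apply_apply, monoBasis_repr, monoBasis_repr,
    ccoeff_congr hF.coeFn_toLp, ccoeff_congr hG.coeFn_toLp]
  push_cast
  rw [← hv2, map_mul, Complex.conj_ofReal]
  field_simp

/-! ### Square summable sequences with values in `[0, ∞]` -/

/-- A weighted Cauchy–Schwarz inequality. -/
lemma lintegral_mul_sq_le {α : Type*} [MeasurableSpace α] {μ : Measure α} {a b : α → ℝ≥0∞}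
    (ha : AEMeasurable a μ) (hb : AEMeasurable b μ) :
    (∫⁻ x, a x * b x ∂μ) ^ 2 ≤ (∫⁻ x, a x ∂μ) * ∫⁻ x, a x * b x ^ 2 ∂μ := by
  have hc : Real.HolderConjugate 2 2 := by
    rw [Real.holderConjugate_iff]; norm_num
  have h1 := ENNReal.lintegral_mul_le_Lp_mul_Lq μ hc
    (ha.pow_const (1 / 2 : ℝ)) ((ha.pow_const (1 / 2 : ℝ)).mul hb)
  have e1 : ∀ x, a x ^ (1 / 2 : ℝ) * (a x ^ (1 / 2 : ℝ) * b x) = a x * b x := fun x => by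
    rw [← mul_assoc, ← ENNReal.rpow_add_of_nonneg _ _ (by norm_num) (by norm_num)]
    norm_num
  have e2 : ∀ x, (a x ^ (1 / 2 : ℝ)) ^ (2 : ℝ) = a x := fun x => by
    rw [← ENNReal.rpow_mul]; norm_num
  have e3 : ∀ x, (a x ^ (1 / 2 : ℝ) * b x) ^ (2 : ℝ) = a x * b x ^ 2 := fun x => by
    rw [ENNReal.mul_rpow_of_nonneg _ _ (by norm_num), e2, ENNReal.rpow_two]
  simp only [Pi.mul_apply, e1, e2, e3] at h1
  calc (∫⁻ x, a x * b x ∂μ) ^ 2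
      ≤ ((∫⁻ x, a x ∂μ) ^ (1 / 2 : ℝ) * (∫⁻ x, a x * b x ^ 2 ∂μ) ^ (1 / 2 : ℝ)) ^ 2 := by gcongr
    _ = _ := by
        rw [mul_pow, ← ENNReal.rpow_two, ← ENNReal.rpow_two, ← ENNReal.rpow_mul,
          ← ENNReal.rpow_mul]
        norm_num

/-- The `ℓ²` norm of a family in `[0, ∞]`. -/
def l2 {ι : Type*} (a : ι → ℝ≥0∞) : ℝ≥0∞ := (∑' k, a k ^ 2) ^ (1 / 2 : ℝ)

section l2

variable {ι : Type*}

lemma l2_sq (a : ι → ℝ≥0∞) : l2 a ^ 2 = ∑' k, a k ^ 2 := by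
  rw [l2, ← ENNReal.rpow_two, ← ENNReal.rpow_mul]; norm_num

lemma le_of_sq_le_sq {x y : ℝ≥0∞} (h : x ^ 2 ≤ y ^ 2) : x ≤ y :=
  (ENNReal.pow_le_pow_left_iff two_ne_zero).1 h

lemma l2_mono {a b : ι → ℝ≥0∞} (h : ∀ k, a k ≤ b k) : l2 a ≤ l2 b := by
  unfold l2
  gcongr with k
  exact h k

lemma l2_const_mul (c : ℝ≥0∞) (a : ι → ℝ≥0∞) : l2 (fun k => c * a k) = c * l2 a := by
  unfold l2
  simp only [mul_pow]
  rw [ENNReal.tsum_mul_left, ENNReal.mul_rpow_of_nonneg _ _ (by norm_num), ← ENNReal.rpow_two,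
    ← ENNReal.rpow_mul]
  norm_num

lemma l2_add_le [Countable ι] (a b : ι → ℝ≥0∞) :
    l2 (fun k => a k + b k) ≤ l2 a + l2 b := by
  let _ : MeasurableSpace ι := ⊤
  have h := ENNReal.lintegral_Lp_add_le (μ := Measure.count) (f := a) (g := b)
    (measurable_of_countable a).aemeasurable (measurable_of_countable b).aemeasurable
    (p := 2) (by norm_num)
  simp only [lintegral_count, Pi.add_apply, ENNReal.rpow_two] at h
  exact h

lemma l2_zero : l2 (fun _ : ι => (0 : ℝ≥0∞)) = 0 := by
  simp [l2]

lemma l2_sum_le [Countable ι] {κ : Type*} (t : Finset κ) (a : κ → ι → ℝ≥0∞) :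
    l2 (fun k => ∑ j ∈ t, a j k) ≤ ∑ j ∈ t, l2 (a j) := by
  classical
  induction t using Finset.induction_on with
  | empty => simp [l2_zero]
  | insert j t hj ih =>
    simp only [Finset.sum_insert hj]
    exact (l2_add_le _ _).trans (by gcongr)

lemma tsum_mul_le_l2 [Countable ι] (a b : ι → ℝ≥0∞) : ∑' k, a k * b k ≤ l2 a * l2 b := by
  let _ : MeasurableSpace ι := ⊤
  have hc : Real.HolderConjugate 2 2 := by
    rw [Real.holderConjugate_iff]; norm_num
  have h := ENNReal.lintegral_mul_le_Lp_mul_Lq Measure.count hc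
    (f := a) (g := b)
    (measurable_of_countable a).aemeasurable (measurable_of_countable b).aemeasurable
  simp only [lintegral_count, Pi.mul_apply, ENNReal.rpow_two] at h
  exact h

/-- Young's inequality `ℓ¹ * ℓ² ⊆ ℓ²`. -/
lemma l2_conv_le [Countable ι] [AddCommGroup ι] (a b : ι → ℝ≥0∞) :
    l2 (fun k => ∑' l, a l * b (k - l)) ≤ (∑' l, a l) * l2 b := by
  let _ : MeasurableSpace ι := ⊤
  refine le_of_sq_le_sq ?_
  rw [l2_sq, mul_pow, l2_sq]
  have h1 : ∀ k, (∑' l, a l * b (k - l)) ^ 2 ≤ (∑' l, a l) * ∑' l, a l * b (k - l) ^ 2 := by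
    intro k
    have := lintegral_mul_sq_le (μ := Measure.count) (a := a) (b := fun l => b (k - l))
      (measurable_of_countable _).aemeasurable (measurable_of_countable _).aemeasurable
    simpa only [lintegral_count] using this
  calc ∑' k, (∑' l, a l * b (k - l)) ^ 2
      ≤ ∑' k, (∑' l, a l) * ∑' l, a l * b (k - l) ^ 2 := ENNReal.tsum_le_tsum h1
    _ = (∑' l, a l) * ∑' l, ∑' k, a l * b (k - l) ^ 2 := by
        rw [ENNReal.tsum_mul_left, ENNReal.tsum_comm]
    _ = (∑' l, a l) * ∑' l, a l * ∑' k, b k ^ 2 := by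
        congr 2; ext l
        rw [ENNReal.tsum_mul_left]
        congr 1
        exact (Equiv.subRight l).tsum_eq (fun k => b k ^ 2)
    _ = (∑' l, a l) ^ 2 * ∑' k, b k ^ 2 := by
        rw [ENNReal.tsum_mul_right, ← mul_assoc, sq]

/-- Fatou's lemma for the `ℓ²` norm. -/
lemma l2_le_of_tendsto {κ : Type*} {F : Filter κ} [F.NeBot] {a : κ → ι → ℝ≥0∞} {b : ι → ℝ≥0∞}
    {B : ℝ≥0∞} (h : ∀ k, Tendsto (fun n => a n k) F (𝓝 (b k))) (hB : ∀ᶠ n in F, l2 (a n) ≤ B) :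
    l2 b ≤ B := by
  refine le_of_sq_le_sq ?_
  rw [l2_sq, ENNReal.tsum_eq_iSup_sum]
  refine iSup_le fun t => ?_
  have h1 : Tendsto (fun n => ∑ k ∈ t, a n k ^ 2) F (𝓝 (∑ k ∈ t, b k ^ 2)) :=
    tendsto_finsetSum _ fun k _ => ((ENNReal.continuous_pow 2).tendsto _).comp (h k)
  refine le_of_tendsto h1 ?_
  filter_upwards [hB] with n hn
  calc ∑ k ∈ t, a n k ^ 2 ≤ ∑' k, a n k ^ 2 := ENNReal.sum_le_tsum t
    _ = l2 (a n) ^ 2 := (l2_sq _).symm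
    _ ≤ B ^ 2 := by gcongr

end l2

/-! ### Sobolev weights -/

/-- The Japanese bracket `⟨k⟩ = √(1 + |k|²)`. -/
def jap (k : Fin d → ℤ) : ℝ := Real.sqrt (1 + freqSq k)

lemma freqSq_nonneg (k : Fin d → ℤ) : 0 ≤ freqSq k := Finset.sum_nonneg fun _ _ => sq_nonneg _

lemma jap_sq (k : Fin d → ℤ) : jap k ^ 2 = 1 + freqSq k :=
  Real.sq_sqrt (by linarith [freqSq_nonneg k])

lemma one_le_jap (k : Fin d → ℤ) : 1 ≤ jap k := by
  unfold jap; rw [Real.one_le_sqrt]; linarith [freqSq_nonneg k]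

lemma jap_pos (k : Fin d → ℤ) : 0 < jap k := one_pos.trans_le (one_le_jap k)

lemma freqSq_neg (k : Fin d → ℤ) : freqSq (-k) = freqSq k := by
  simp [freqSq]

lemma jap_add_le (k l : Fin d → ℤ) : jap (k + l) ≤ jap k + jap l := by
  have hk := freqSq_nonneg k
  have hl := freqSq_nonneg l
  have h1 : (∑ i, (k i : ℝ) * l i) ≤ jap k * jap l := by
    have h2 : (∑ i, (k i : ℝ) * l i) ^ 2 ≤ (jap k * jap l) ^ 2 := by
      rw [mul_pow, jap_sq, jap_sq]
      calc (∑ i, (k i : ℝ) * l i) ^ 2 ≤ freqSq k * freqSq l :=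
            Finset.sum_mul_sq_le_sq_mul_sq _ _ _
        _ ≤ _ := by gcongr <;> linarith
    exact (abs_le_of_sq_le_sq' h2 (mul_pos (jap_pos k) (jap_pos l)).le).2
  have h3 : freqSq (k + l) = freqSq k + freqSq l + 2 * ∑ i, (k i : ℝ) * l i := by
    simp only [freqSq, Pi.add_apply, Int.cast_add, Finset.mul_sum, ← Finset.sum_add_distrib]
    exact Finset.sum_congr rfl fun i _ => by ring
  refine abs_le_of_sq_le_sq' ?_ (add_pos (jap_pos k) (jap_pos l)).le |>.2
  rw [jap_sq, h3]
  nlinarith [jap_sq k, jap_sq l]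

/-- The weight `⟨k⟩^σ` with values in `[0, ∞]`. -/
def wt (σ : ℝ) (k : Fin d → ℤ) : ℝ≥0∞ := ENNReal.ofReal (jap k ^ σ)

lemma wt_zero (k : Fin d → ℤ) : wt 0 k = 1 := by simp [wt]

lemma wt_add (σ τ : ℝ) (k : Fin d → ℤ) : wt (σ + τ) k = wt σ k * wt τ k := by
  rw [wt, Real.rpow_add (jap_pos k), ENNReal.ofReal_mul (Real.rpow_nonneg (jap_pos k).le _)]; rfl

lemma wt_ne_top (σ : ℝ) (k : Fin d → ℤ) : wt σ k ≠ ⊤ := ENNReal.ofReal_ne_top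

lemma wt_mono {σ τ : ℝ} (h : σ ≤ τ) (k : Fin d → ℤ) : wt σ k ≤ wt τ k :=
  ENNReal.ofReal_le_ofReal (Real.rpow_le_rpow_of_exponent_le (one_le_jap k) h)

lemma one_le_wt {σ : ℝ} (h : 0 ≤ σ) (k : Fin d → ℤ) : 1 ≤ wt σ k := by
  rw [← wt_zero k]; exact wt_mono h k

lemma wt_neg_le_of_jap_le {σ : ℝ} (h : 0 ≤ σ) {k l : Fin d → ℤ} (hkl : jap k ≤ jap l) :
    wt (-σ) l ≤ wt (-σ) k :=
  ENNReal.ofReal_le_ofReal (Real.rpow_le_rpow_of_nonpos (jap_pos k) hkl (neg_nonpos.2 h))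

lemma wt_sq (σ : ℝ) (k : Fin d → ℤ) : wt σ k ^ 2 = ENNReal.ofReal ((1 + freqSq k) ^ σ) := by
  rw [wt, ← ENNReal.ofReal_pow (Real.rpow_nonneg (jap_pos k).le _), ← jap_sq, ← Real.rpow_natCast,
    ← Real.rpow_natCast, ← Real.rpow_mul (jap_pos k).le, ← Real.rpow_mul (jap_pos k).le]
  congr 2
  ring

lemma wt_neg_mul (σ : ℝ) (k : Fin d → ℤ) : wt (-σ) k * wt σ k = 1 := by
  rw [← wt_add, neg_add_cancel, wt_zero]

lemma wt_neg_mul_wt_neg_le {σ τ : ℝ} (hσ : 0 ≤ σ) (hτ : 0 ≤ τ) (k l : Fin d → ℤ) :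
    wt (-σ) k * wt (-τ) l ≤ wt (-(σ + τ)) k + wt (-(σ + τ)) l := by
  have e : -(σ + τ) = -σ + -τ := by ring
  rw [e, wt_add, wt_add]
  rcases le_total (jap k) (jap l) with h | h
  · refine le_trans ?_ le_self_add
    gcongr
    exact wt_neg_le_of_jap_le hτ h
  · refine le_trans ?_ le_add_self
    gcongr
    exact wt_neg_le_of_jap_le hσ h

lemma wt_add_freq_le {σ : ℝ} (hσ : 0 ≤ σ) (k l : Fin d → ℤ) :
    wt σ (k + l) ≤ ENNReal.ofReal (2 ^ σ) * (wt σ k + wt σ l) := by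
  have hk := Real.rpow_nonneg (jap_pos k).le σ
  have hl := Real.rpow_nonneg (jap_pos l).le σ
  rw [wt, wt, wt, ← ENNReal.ofReal_add hk hl, ← ENNReal.ofReal_mul (by positivity)]
  refine ENNReal.ofReal_le_ofReal ?_
  have h1 : jap (k + l) ≤ 2 * max (jap k) (jap l) :=
    (jap_add_le k l).trans (by linarith [le_max_left (jap k) (jap l), le_max_right (jap k) (jap l)])
  have h2 : jap (k + l) ^ σ ≤ 2 ^ σ * (max (jap k) (jap l)) ^ σ := by
    rw [← Real.mul_rpow (by norm_num) ((jap_pos k).le.trans (le_max_left _ _))]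
    exact Real.rpow_le_rpow (jap_pos _).le h1 hσ
  refine h2.trans (mul_le_mul_of_nonneg_left ?_ (by positivity))
  rcases max_choice (jap k) (jap l) with h | h <;> rw [h] <;> linarith

/-- The weighted norm `(∑ ⟨k⟩^{2σ} |c_k|²)^{1/2}` of a sequence of Fourier coefficients. -/
def wNorm (σ : ℝ) (c : (Fin d → ℤ) → ℂ) : ℝ≥0∞ := l2 fun k => wt σ k * ‖c k‖ₑ

lemma sobNorm_eq_wNorm (σ : ℝ) (v : L2 d) : sobNorm σ v = wNorm σ (coeff v) := by
  unfold sobNorm wNorm l2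
  congr 2
  ext k
  rw [mul_pow, wt_sq, ENNReal.ofReal_mul (Real.rpow_nonneg (by linarith [freqSq_nonneg k]) _),
    ENNReal.ofReal_pow (norm_nonneg _), ofReal_norm]

lemma wNorm_sq (σ : ℝ) (c : (Fin d → ℤ) → ℂ) :
    wNorm σ c ^ 2 = ∑' k, wt σ k ^ 2 * ‖c k‖ₑ ^ 2 := by
  rw [wNorm, l2_sq]; simp only [mul_pow]

lemma wNorm_mono {σ τ : ℝ} (h : σ ≤ τ) (c : (Fin d → ℤ) → ℂ) : wNorm σ c ≤ wNorm τ c :=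
  l2_mono fun k => by gcongr; exact wt_mono h k

lemma wNorm_mono_coeff {σ : ℝ} {c e : (Fin d → ℤ) → ℂ} (h : ∀ k, ‖c k‖ₑ ≤ ‖e k‖ₑ) :
    wNorm σ c ≤ wNorm σ e :=
  l2_mono fun k => by gcongr; exact h k

lemma wNorm_add_le (σ : ℝ) (c e : (Fin d → ℤ) → ℂ) :
    wNorm σ (fun k => c k + e k) ≤ wNorm σ c + wNorm σ e := by
  refine le_trans (l2_mono fun k => ?_) (l2_add_le _ _)
  rw [← mul_add]; gcongr; exact enorm_add_le _ _

lemma wNorm_const_mul (σ : ℝ) (a : ℂ) (c : (Fin d → ℤ) → ℂ) :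
    wNorm σ (fun k => a * c k) = ‖a‖ₑ * wNorm σ c := by
  unfold wNorm
  rw [← l2_const_mul]
  congr 1; ext k
  rw [enorm_mul]; ring

lemma wNorm_zero (σ : ℝ) : wNorm σ (fun _ : Fin d → ℤ => 0) = 0 := by
  unfold wNorm; simp [l2_zero]

/-- The norm `(∑ ⟨k⟩^{-2s})^{1/2}`, the constant of the Sobolev embedding `H^s ⊆ L^∞`. -/
def embConst (d : ℕ) (s : ℝ) : ℝ≥0∞ := l2 fun k : Fin d → ℤ => wt (-s) k

lemma tsum_enorm_le (s : ℝ) (c : (Fin d → ℤ) → ℂ) :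
    ∑' k, ‖c k‖ₑ ≤ embConst d s * wNorm s c := by
  refine le_trans (le_of_eq ?_) (tsum_mul_le_l2 _ _)
  congr 1; ext k
  rw [← mul_assoc, wt_neg_mul, one_mul]

lemma norm_le_jap (k : Fin d → ℤ) : ‖fun i => (k i : ℝ)‖ ≤ jap k := by
  refine (pi_norm_le_iff_of_nonneg (jap_pos k).le).2 fun i => ?_
  rw [Real.norm_eq_abs]
  refine abs_le_of_sq_le_sq ?_ (jap_pos k).le
  rw [jap_sq]
  have : (k i : ℝ) ^ 2 ≤ freqSq k :=
    Finset.single_le_sum (f := fun i => (k i : ℝ) ^ 2) (fun _ _ => sq_nonneg _) (Finset.mem_univ i)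
  linarith

lemma embConst_lt_top {s : ℝ} (hs : (d : ℝ) / 2 < s) : embConst d s < ⊤ := by
  have hs0 : 0 < s := lt_of_le_of_lt (by positivity) hs
  let b := Pi.basisFun ℝ (Fin d)
  let Λ : Submodule ℤ (Fin d → ℝ) := Submodule.span ℤ (Set.range b)
  have hΛ : Module.finrank ℤ Λ = d := by
    rw [ZLattice.rank ℝ Λ]; simp
  have h1 : Summable fun z : Λ => ‖z‖ ^ (-(2 * s)) :=
    ZLattice.summable_norm_rpow Λ _ (by rw [hΛ]; linarith)
  let φ : (Fin d → ℤ) → Λ := fun k =>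
    ⟨fun i => (k i : ℝ), by
      have : (fun i => (k i : ℝ)) = ∑ i, k i • b i := by
        ext j; simp [b, Pi.single_apply]
      rw [this]
      exact Submodule.sum_mem _ fun i _ => Submodule.smul_mem _ _ (Submodule.subset_span ⟨i, rfl⟩)⟩
  have hφ : Function.Injective φ := fun k l h => by
    ext i
    have h' : (k i : ℝ) = l i := congr_fun (congr_arg Subtype.val h) i
    exact_mod_cast h'
  have h2 : Summable fun k : Fin d → ℤ => jap k ^ (-(2 * s)) := by
    refine Summable.of_norm_bounded_eventually (h1.comp_injective hφ) ?_
    refine (Set.finite_singleton (0 : Fin d → ℤ)).subset fun k hk => ?_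
    by_contra hk0
    refine hk ?_
    have h3 : 0 < ‖φ k‖ := by
      refine norm_pos_iff.2 fun h => hk0 ?_
      ext i
      have h4 : (k i : ℝ) = 0 := congr_fun (congr_arg Subtype.val h) i
      exact_mod_cast h4
    change ‖jap k ^ (-(2 * s))‖ ≤ ‖φ k‖ ^ (-(2 * s))
    rw [Real.norm_of_nonneg (Real.rpow_nonneg (jap_pos k).le _)]
    exact Real.rpow_le_rpow_of_nonpos h3 (norm_le_jap k) (by linarith)
  refine ENNReal.rpow_lt_top_of_nonneg (by norm_num) (ne_of_lt ?_)
  calc ∑' k : Fin d → ℤ, wt (-s) k ^ 2 = ∑' k : Fin d → ℤ, ENNReal.ofReal (jap k ^ (-(2 * s))) := by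
        congr 1; ext k
        rw [wt, ← ENNReal.ofReal_pow (Real.rpow_nonneg (jap_pos k).le _), ← Real.rpow_natCast,
          ← Real.rpow_mul (jap_pos k).le]
        congr 2; push_cast; ring
    _ < ⊤ := h2.tsum_ofReal_lt_top

/-- The bilinear estimate behind all product estimates: if `s > d/2` and `i + j ≤ s`, the product
of `H^{s-i}` and `H^{s-j}` lies in `H^{s-i-j}`. On the Fourier side a product is a convolution, and
the weights are distributed so that each term is the convolution of an `ℓ¹` with an `ℓ²`
sequence. -/
lemma wNorm_conv_le {s i j : ℝ} (hi : 0 ≤ i) (hj : 0 ≤ j) (hij : i + j ≤ s)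
    {a b c : (Fin d → ℤ) → ℂ} (hc : ∀ k, ‖c k‖ₑ ≤ ∑' l, ‖a l‖ₑ * ‖b (k - l)‖ₑ) :
    wNorm (s - i - j) c ≤
      ENNReal.ofReal (2 ^ s) * 4 * embConst d s * wNorm (s - i) a * wNorm (s - j) b := by
  set σ := s - i - j with hσ
  set A : (Fin d → ℤ) → ℝ≥0∞ := fun l => wt (s - i) l * ‖a l‖ₑ with hA
  set B : (Fin d → ℤ) → ℝ≥0∞ := fun l => wt (s - j) l * ‖b l‖ₑ with hB
  set A' : (Fin d → ℤ) → ℝ≥0∞ := fun l => wt (-s) l * A l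
  set B' : (Fin d → ℤ) → ℝ≥0∞ := fun l => wt (-s) l * B l
  have key : ∀ l m : Fin d → ℤ, wt σ (l + m) * (‖a l‖ₑ * ‖b m‖ₑ) ≤
      ENNReal.ofReal (2 ^ s) * 2 * (A' l * B m + A l * B' m) := by
    intro l m
    have h1 : wt σ l * (‖a l‖ₑ * ‖b m‖ₑ) ≤ A' l * B m + A l * B' m := by
      have e1 : ‖a l‖ₑ = wt (-(s - i)) l * A l := by
        rw [hA]; simp only; rw [← mul_assoc, wt_neg_mul, one_mul]
      have e2 : ‖b m‖ₑ = wt (-(s - j)) m * B m := by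
        rw [hB]; simp only; rw [← mul_assoc, wt_neg_mul, one_mul]
      have e3 : wt σ l * wt (-(s - i)) l = wt (-j) l := by
        rw [← wt_add]; congr 1; rw [hσ]; ring
      calc wt σ l * (‖a l‖ₑ * ‖b m‖ₑ)
          = (wt σ l * wt (-(s - i)) l) * wt (-(s - j)) m * (A l * B m) := by
            rw [e1, e2]; ring
        _ = wt (-j) l * wt (-(s - j)) m * (A l * B m) := by rw [e3]
        _ ≤ (wt (-s) l + wt (-s) m) * (A l * B m) := by
            gcongr
            have := wt_neg_mul_wt_neg_le (σ := j) (τ := s - j) hj (by linarith) l m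
            rwa [show j + (s - j) = s by ring] at this
        _ = _ := by simp only [A', B']; ring
    have h2 : wt σ m * (‖a l‖ₑ * ‖b m‖ₑ) ≤ A' l * B m + A l * B' m := by
      have e1 : ‖a l‖ₑ = wt (-(s - i)) l * A l := by
        rw [hA]; simp only; rw [← mul_assoc, wt_neg_mul, one_mul]
      have e2 : ‖b m‖ₑ = wt (-(s - j)) m * B m := by
        rw [hB]; simp only; rw [← mul_assoc, wt_neg_mul, one_mul]
      have e3 : wt σ m * wt (-(s - j)) m = wt (-i) m := by
        rw [← wt_add]; congr 1; rw [hσ]; ring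
      calc wt σ m * (‖a l‖ₑ * ‖b m‖ₑ)
          = wt (-(s - i)) l * (wt σ m * wt (-(s - j)) m) * (A l * B m) := by
            rw [e1, e2]; ring
        _ = wt (-(s - i)) l * wt (-i) m * (A l * B m) := by rw [e3]
        _ ≤ (wt (-s) l + wt (-s) m) * (A l * B m) := by
            gcongr
            have := wt_neg_mul_wt_neg_le (σ := s - i) (τ := i) (by linarith) hi l m
            rwa [show (s - i) + i = s by ring] at this
        _ = _ := by simp only [A', B']; ring
    calc wt σ (l + m) * (‖a l‖ₑ * ‖b m‖ₑ)
        ≤ ENNReal.ofReal (2 ^ σ) * (wt σ l + wt σ m) * (‖a l‖ₑ * ‖b m‖ₑ) := by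
          gcongr; exact wt_add_freq_le (by rw [hσ]; linarith) l m
      _ = ENNReal.ofReal (2 ^ σ) *
            (wt σ l * (‖a l‖ₑ * ‖b m‖ₑ) + wt σ m * (‖a l‖ₑ * ‖b m‖ₑ)) := by ring
      _ ≤ ENNReal.ofReal (2 ^ s) *
            ((A' l * B m + A l * B' m) + (A' l * B m + A l * B' m)) := by
          gcongr
          · norm_num
          · rw [hσ]; linarith
      _ = _ := by ring
  have hK : ∀ (f : (Fin d → ℤ) → ℝ≥0∞), ∑' l, wt (-s) l * f l ≤ embConst d s * l2 f :=
    fun f => tsum_mul_le_l2 _ _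
  calc wNorm σ c ≤ l2 (fun k => (ENNReal.ofReal (2 ^ s) * 2) *
        ((∑' l, A' l * B (k - l)) + ∑' l, B' l * A (k - l))) := by
        refine l2_mono fun k => ?_
        calc wt σ k * ‖c k‖ₑ ≤ wt σ k * ∑' l, ‖a l‖ₑ * ‖b (k - l)‖ₑ := by gcongr; exact hc k
          _ = ∑' l, wt σ (l + (k - l)) * (‖a l‖ₑ * ‖b (k - l)‖ₑ) := by
              rw [← ENNReal.tsum_mul_left]; simp only [add_sub_cancel]
          _ ≤ ∑' l, ENNReal.ofReal (2 ^ s) * 2 * (A' l * B (k - l) + A l * B' (k - l)) :=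
              ENNReal.tsum_le_tsum fun l => key l (k - l)
          _ = _ := by
              rw [ENNReal.tsum_mul_left, ENNReal.tsum_add]
              congr 2
              rw [← (Equiv.subLeft k).tsum_eq (fun l => A l * B' (k - l))]
              congr 1; ext l
              simp [mul_comm]
    _ ≤ (ENNReal.ofReal (2 ^ s) * 2) * ((∑' l, A' l) * l2 B + (∑' l, B' l) * l2 A) := by
        rw [l2_const_mul]
        gcongr
        exact (l2_add_le _ _).trans (add_le_add (l2_conv_le _ _) (l2_conv_le _ _))
    _ ≤ (ENNReal.ofReal (2 ^ s) * 2) *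
          ((embConst d s * l2 A) * l2 B + (embConst d s * l2 B) * l2 A) := by
        gcongr
        · exact hK A
        · exact hK B
    _ = ENNReal.ofReal (2 ^ s) * 4 * embConst d s * l2 A * l2 B := by ring

/-! ### Functions and their Fourier coefficients -/

lemma coeFn_memLp (v : L2 d) : MemLp v 2 := Lp.memLp v

lemma coeFn_integrable (v : L2 d) : Integrable v := (Lp.memLp v).integrable (by norm_num)

lemma memLp_complex {v : Torus d → ℝ} (hv : MemLp v 2) : MemLp (fun x => (v x : ℂ)) 2 :=
  hv.ofReal

lemma coeff_Lp_add (v w : L2 d) (k : Fin d → ℤ) :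
    coeff (v + w : L2 d) k = coeff v k + coeff w k := by
  rw [coeff_congr (Lp.coeFn_add v w)]
  exact coeff_add (coeFn_integrable v) (coeFn_integrable w) k

lemma coeff_Lp_sub (v w : L2 d) (k : Fin d → ℤ) :
    coeff (v - w : L2 d) k = coeff v k - coeff w k := by
  rw [coeff_congr (Lp.coeFn_sub v w)]
  exact coeff_sub (coeFn_integrable v) (coeFn_integrable w) k

lemma coeff_Lp_smul (a : ℝ) (v : L2 d) (k : Fin d → ℤ) :
    coeff (a • v : L2 d) k = a * coeff v k := by
  rw [coeff_congr (Lp.coeFn_smul a v)]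
  exact coeff_const_mul a v k

lemma hasSum_norm_ccoeff_sq {F : Torus d → ℂ} (hF : MemLp F 2) :
    HasSum (fun k => ‖ccoeff F k‖ ^ 2) (((2 * Real.pi) ^ d)⁻¹ * ∫ x, ‖F x‖ ^ 2) := by
  have h := hasSum_conj_ccoeff_mul hF hF
  have e : ∀ z : ℂ, conj z * z = ((‖z‖ ^ 2 : ℝ) : ℂ) := fun z => by
    rw [mul_comm, Complex.mul_conj, Complex.normSq_eq_norm_sq]
  simp only [e] at h
  rw [integral_complex_ofReal, ← Complex.ofReal_mul] at h
  exact Complex.hasSum_ofReal.1 h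

/-- **Parseval's identity**. -/
lemma enorm_eq_wNorm (v : L2 d) : ‖v‖ₑ = ENNReal.ofReal (volSqrt d) * wNorm 0 (coeff v) := by
  have h := hasSum_norm_ccoeff_sq (memLp_complex (coeFn_memLp v))
  simp only [← coeff_eq_ccoeff] at h
  have h1 : ∫ x, ‖((v x : ℝ) : ℂ)‖ ^ 2 = ‖v‖ ^ 2 := by
    rw [← real_inner_self_eq_norm_sq, MeasureTheory.L2.inner_def]
    refine integral_congr_ae (.of_forall fun x => ?_)
    simp [sq]
  have h2 : ‖v‖ ^ 2 = volSqrt d ^ 2 * ∑' k, ‖coeff v k‖ ^ 2 := by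
    rw [volSqrt_sq, h.tsum_eq]
    rw [h1, mul_inv_cancel_left₀ (pow_pos Real.two_pi_pos d).ne']
  have h4 : ∑' k, ‖coeff v k‖ₑ ^ 2 = ENNReal.ofReal (∑' k, ‖coeff v k‖ ^ 2) := by
    rw [ENNReal.ofReal_tsum_of_nonneg (fun k => by positivity) h.summable]
    refine tsum_congr fun k => ?_
    rw [ENNReal.ofReal_pow (norm_nonneg _), ofReal_norm]
  have h5 : ‖v‖ₑ ^ 2 = (ENNReal.ofReal (volSqrt d) * wNorm 0 (coeff v)) ^ 2 := by
    rw [mul_pow, wNorm_sq]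
    simp only [wt_zero, one_pow, one_mul]
    rw [h4, ← ENNReal.ofReal_pow volSqrt_pos.le, ← ENNReal.ofReal_mul (by positivity), ← h2,
      ENNReal.ofReal_pow (norm_nonneg _), ofReal_norm]
  exact le_antisymm (le_of_sq_le_sq h5.le) (le_of_sq_le_sq h5.ge)

lemma coeff_injective {v w : L2 d} (h : ∀ k, coeff v k = coeff w k) : v = w := by
  rw [← sub_eq_zero, ← enorm_eq_zero, enorm_eq_wNorm]
  have : coeff (v - w : L2 d) = fun _ => 0 := by
    ext k; rw [coeff_Lp_sub, h, sub_self]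
  rw [this, wNorm_zero, mul_zero]

/-- Every square summable sequence with the symmetry `c_{-k} = conj c_k` is the sequence of Fourier
coefficients of a real function. -/
lemma exists_coeff_eq {c : (Fin d → ℤ) → ℂ} (hc : wNorm 0 c < ⊤)
    (hsymm : ∀ k, c (-k) = conj (c k)) : ∃ v : L2 d, ∀ k, coeff v k = c k := by
  have hv : ((volSqrt d : ℝ) : ℂ) ≠ 0 := by exact_mod_cast volSqrt_pos.ne'
  have h1 : Memℓp (fun k => (volSqrt d : ℂ) * c k) 2 := by
    refine (memℓp_gen ?_ : Memℓp c 2).const_mul _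
    have h2 : ∑' k, ‖c k‖ₑ ^ 2 ≠ ⊤ := by
      have := wNorm_sq 0 c
      simp only [wt_zero, one_pow, one_mul] at this
      rw [← this]
      exact (ENNReal.pow_lt_top hc).ne
    refine (ENNReal.summable_toReal h2).congr fun k => ?_
    simp
  let F := (monoBasis d).repr.symm ⟨_, h1⟩
  have hF : ∀ k, ccoeff F k = c k := fun k => by
    have h2 : (monoBasis d).repr F k = volSqrt d * c k := by
      simp only [F, LinearIsometryEquiv.apply_symm_apply]
    rw [monoBasis_repr] at h2
    exact mul_left_cancel₀ hv h2
  have hFL : MemLp F 2 := Lp.memLp F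
  refine ⟨hFL.re.toLp _, fun k => ?_⟩
  rw [coeff_congr hFL.re.coeFn_toLp]
  have := coeff_re (hFL.integrable (by norm_num)) k
  refine this.trans ?_
  rw [hF, hF, hsymm, Complex.conj_conj]
  ring

/-- The Fourier series converges uniformly to the function if its coefficients are summable. -/
lemma ae_enorm_le_tsum (v : L2 d) : ∀ᵐ x, ‖v x‖ₑ ≤ ∑' k, ‖coeff v k‖ₑ := by
  by_cases hs : ∑' k, ‖coeff v k‖ₑ = ⊤
  · rw [hs]; exact .of_forall fun _ => le_top
  have hsum : Summable fun k => ‖coeff v k‖ := by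
    simpa using ENNReal.summable_toReal hs
  have hsumC : Summable fun k => coeff v k • mono k := by
    refine Summable.of_norm_bounded hsum fun k => ?_
    rw [norm_smul]
    refine mul_le_of_le_one_right (norm_nonneg _) ?_
    exact (ContinuousMap.norm_le _ zero_le_one).2 fun x => (norm_mono k x).le
  have h1 : HasSum (fun k => coeff v k •
      ContinuousMap.toLp (E := ℂ) 2 (volume : Measure (Torus d)) ℂ (mono k))
      (ContinuousMap.toLp (E := ℂ) 2 (volume : Measure (Torus d)) ℂ
        (∑' k, coeff v k • mono k)) := by
    have := (ContinuousMap.toLp (E := ℂ) 2 (volume : Measure (Torus d)) ℂ).hasSum hsumC.hasSum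
    simpa only [Function.comp_def, map_smul] using this
  have hvL := memLp_complex (coeFn_memLp v)
  have h2 : HasSum (fun k => coeff v k •
      ContinuousMap.toLp (E := ℂ) 2 (volume : Measure (Torus d)) ℂ (mono k)) (hvL.toLp _) := by
    have hv : ((volSqrt d : ℝ) : ℂ) ≠ 0 := by exact_mod_cast volSqrt_pos.ne'
    refine ((monoBasis d).hasSum_repr (hvL.toLp _)).congr_fun fun k => ?_
    rw [monoBasis_repr, ccoeff_congr hvL.coeFn_toLp, monoBasis, HilbertBasis.coe_mk, monoLp,
      smul_smul]
    rw [mul_right_comm, mul_inv_cancel₀ hv, one_mul, coeff_eq_ccoeff]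
  have h3 := h1.unique h2
  have h4 := hvL.coeFn_toLp
  rw [← h3] at h4
  filter_upwards [h4, ContinuousMap.coeFn_toLp (p := 2) (𝕜 := ℂ) volume
    (∑' k, coeff v k • mono k)] with x hx hx'
  have h5 : ((v x : ℝ) : ℂ) = ∑' k, coeff v k * mono k x := by
    have h6 := ((ContinuousMap.evalCLM ℂ x).hasSum hsumC.hasSum).tsum_eq
    rw [← hx, hx']
    exact h6.symm
  calc ‖v x‖ₑ = ‖((v x : ℝ) : ℂ)‖ₑ := by
        rw [← ofReal_norm, ← ofReal_norm, Complex.norm_real]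
    _ ≤ ∑' k, ‖coeff v k * mono k x‖ₑ := by rw [h5]; exact enorm_tsum_le_tsum_enorm
    _ = ∑' k, ‖coeff v k‖ₑ := by
        refine tsum_congr fun k => ?_
        rw [enorm_mul, ← ofReal_norm (mono k x), norm_mono, ENNReal.ofReal_one, mul_one]

/-- The norm of the embedding of `H^s` into `L^∞`. -/
lemma ae_enorm_le (s : ℝ) (v : L2 d) :
    ∀ᵐ x, ‖v x‖ₑ ≤ embConst d s * wNorm s (coeff v) := by
  filter_upwards [ae_enorm_le_tsum v] with x hx
  exact hx.trans (tsum_enorm_le s _)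

/-- The Fourier coefficients of a product are bounded by a convolution. -/
lemma enorm_coeff_mul_le {v w : Torus d → ℝ} (hv : MemLp v 2) (hw : MemLp w 2) (k : Fin d → ℤ) :
    ‖coeff (fun x => v x * w x) k‖ₑ ≤ ∑' l, ‖coeff v l‖ₑ * ‖coeff w (k - l)‖ₑ := by
  have hG : MemLp (fun x => mono (-k) x * (w x : ℂ)) 2 := by
    refine (memLp_complex hw).of_le (((mono (-k)).continuous.aestronglyMeasurable).mul
      (memLp_complex hw).1) (.of_forall fun x => ?_)
    rw [norm_mul, norm_mono, one_mul]
  have h := hasSum_conj_ccoeff_mul (memLp_complex hv) hG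
  have e1 : ∀ l, ccoeff (fun x => mono (-k) x * (w x : ℂ)) l = coeff w (l + k) := fun l => by
    unfold ccoeff coeff
    congr 2; ext x
    rw [← mul_assoc, ← mono_add, ← neg_add]
    rfl
  have e2 : coeff (fun x => v x * w x) k =
      ((((2 * Real.pi) ^ d)⁻¹ : ℝ) * ∫ x, conj ((v x : ℝ) : ℂ) * (mono (-k) x * (w x : ℂ))) := by
    unfold coeff
    congr 2; ext x
    rw [Complex.conj_ofReal, Complex.ofReal_mul, mul_left_comm]
    rfl
  rw [e2]
  refine (congr_arg _ h.tsum_eq.symm).trans_le (enorm_tsum_le_tsum_enorm.trans (le_of_eq ?_))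
  rw [← (Equiv.neg _).tsum_eq]
  refine tsum_congr fun l => ?_
  have e3 : conj (ccoeff (fun x => ((v x : ℝ) : ℂ)) (-l)) = coeff v l := by
    rw [← coeff_eq_ccoeff, ← coeff_neg_freq, neg_neg]
  have e4 := e1 (-l)
  rw [enorm_mul]
  congr 1
  · exact congr_arg _ e3
  · rw [Equiv.neg_apply, e4, neg_add_eq_sub]

/-- The constant in the product estimates. -/
def prodConst (d : ℕ) (s : ℝ) : ℝ≥0∞ := ENNReal.ofReal (2 ^ s) * 4 * embConst d s

lemma prodConst_lt_top {s : ℝ} (hs : (d : ℝ) / 2 < s) : prodConst d s < ⊤ :=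
  ENNReal.mul_lt_top (ENNReal.mul_lt_top ENNReal.ofReal_lt_top (by simp)) (embConst_lt_top hs)

lemma wNorm_coeff_mul_le {s i j : ℝ} (hi : 0 ≤ i) (hj : 0 ≤ j) (hij : i + j ≤ s)
    {v w : Torus d → ℝ} (hv : MemLp v 2) (hw : MemLp w 2) :
    wNorm (s - i - j) (coeff fun x => v x * w x) ≤
      prodConst d s * wNorm (s - i) (coeff v) * wNorm (s - j) (coeff w) :=
  wNorm_conv_le hi hj hij (enorm_coeff_mul_le hv hw)

/-! ### Smooth functions on the torus -/

/-- The quotient map `ℝ^d → 𝕋^d`. -/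
def proj (y : Fin d → ℝ) : Torus d := fun i => (y i : AddCircle (2 * Real.pi))

lemma proj_surjective : Function.Surjective (proj (d := d)) := fun x => by
  choose y hy using fun i => QuotientAddGroup.mk_surjective (x i)
  exact ⟨y, funext hy⟩

/-- The image in the torus of the point `t` of the `j`-th coordinate axis. -/
def axis (j : Fin d) (t : ℝ) : Torus d := proj (Pi.single j t)

/-- A smooth function on the torus: its periodic lift to `ℝ^d` is smooth. -/
def IsSmooth (F : Torus d → ℝ) : Prop := ContDiff ℝ ∞ fun y => F (proj y)

/-- The partial derivative of a function on the torus. -/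
def pderiv (j : Fin d) (F : Torus d → ℝ) (x : Torus d) : ℝ := deriv (fun t => F (x + axis j t)) 0

lemma isOpenQuotientMap_proj : IsOpenQuotientMap (proj (d := d)) :=
  IsOpenQuotientMap.piMap fun _ => QuotientAddGroup.isOpenQuotientMap_mk

namespace IsSmooth

variable {F G : Torus d → ℝ}

lemma continuous (hF : IsSmooth F) : Continuous F :=
  isOpenQuotientMap_proj.isQuotientMap.continuous_iff.2 (ContDiff.continuous hF)

lemma memLp (hF : IsSmooth F) : MemLp F 2 := by
  obtain ⟨C, hC⟩ := isCompact_univ.exists_bound_of_continuousOn hF.continuous.continuousOn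
  exact MemLp.of_bound hF.continuous.aestronglyMeasurable C (.of_forall fun x => hC x trivial)

lemma mul (hF : IsSmooth F) (hG : IsSmooth G) : IsSmooth fun x => F x * G x :=
  ContDiff.mul hF hG

lemma comp {g : ℝ → ℝ} (hg : ContDiff ℝ ∞ g) (hF : IsSmooth F) : IsSmooth fun x => g (F x) :=
  ContDiff.comp hg hF

lemma const (c : ℝ) : IsSmooth fun _ : Torus d => c := contDiff_const

lemma hasDerivAt_proj (hF : IsSmooth F) (j : Fin d) (y : Fin d → ℝ) (t : ℝ) :
    HasDerivAt (fun t => F (proj y + axis j t))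
      (fderiv ℝ (fun y => F (proj y)) (y + Pi.single j t) (Pi.single j 1)) t := by
  have h1 : HasFDerivAt (fun y => F (proj y)) (fderiv ℝ (fun y => F (proj y)) (y + Pi.single j t))
      (y + Pi.single j t) :=
    ((ContDiff.differentiable hF (by simp)) _).hasFDerivAt
  have h2 : HasDerivAt (fun t : ℝ => y + Pi.single j t) (Pi.single j 1) t := by
    have := (hasDerivAt_id t).smul_const (Pi.single j (1 : ℝ) : Fin d → ℝ)
    simp only [id, one_smul, ← Pi.single_smul, smul_eq_mul, mul_one] at this
    exact this.const_add y
  exact h1.comp_hasDerivAt t h2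

lemma pderiv_proj (hF : IsSmooth F) (j : Fin d) (y : Fin d → ℝ) :
    pderiv j F (proj y) = fderiv ℝ (fun y => F (proj y)) y (Pi.single j 1) := by
  have := (hF.hasDerivAt_proj j y 0).deriv
  rwa [Pi.single_zero, add_zero] at this

lemma hasDerivAt (hF : IsSmooth F) (j : Fin d) (x : Torus d) (t : ℝ) :
    HasDerivAt (fun t => F (x + axis j t)) (pderiv j F (x + axis j t)) t := by
  obtain ⟨y, rfl⟩ := proj_surjective x
  have := hF.hasDerivAt_proj j y t
  rwa [← hF.pderiv_proj] at this

lemma hasDerivAt_zero (hF : IsSmooth F) (j : Fin d) (x : Torus d) :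
    HasDerivAt (fun t => F (x + axis j t)) (pderiv j F x) 0 := by
  have := hF.hasDerivAt j x 0
  have e : axis j 0 = 0 := by ext i; simp [axis, proj]
  rwa [e, add_zero] at this

lemma pderiv (hF : IsSmooth F) (j : Fin d) : IsSmooth (pderiv j F) := by
  have h1 : ContDiff ℝ ∞ (fderiv ℝ (fun y => F (proj y))) := ContDiff.fderiv_right hF (by simp)
  have h2 : ContDiff ℝ ∞ fun y => fderiv ℝ (fun y => F (proj y)) y (Pi.single j 1) :=
    h1.clm_apply contDiff_const
  simpa only [IsSmooth, hF.pderiv_proj] using h2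

end IsSmooth

/-- The chain and product rules. -/
lemma pderiv_comp_mul {g : ℝ → ℝ} (hg : ContDiff ℝ ∞ g) {w Q : Torus d → ℝ} (hw : IsSmooth w)
    (hQ : IsSmooth Q) (j : Fin d) (x : Torus d) :
    pderiv j (fun x => g (w x) * Q x) x =
      deriv g (w x) * (pderiv j w x * Q x) + g (w x) * pderiv j Q x := by
  have e : axis j 0 = 0 := by ext i; simp [axis, proj]
  have h1 : HasDerivAt g (deriv g (w x)) (w (x + axis j 0)) := by
    rw [e, add_zero]
    exact ((hg.differentiable (by simp)) _).hasDerivAt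
  have h2 := ((h1.comp 0 (hw.hasDerivAt_zero j x)).mul (hQ.hasDerivAt_zero j x)).deriv
  simp only [Function.comp_apply, e, add_zero] at h2
  refine Eq.trans h2 ?_
  ring

lemma mono_axis (k : Fin d → ℤ) (j : Fin d) (t : ℝ) :
    mono k (axis j t) = Complex.exp (Complex.I * k j * t) := by
  rw [mono_apply, Finset.prod_eq_single j]
  · rw [axis, proj, Pi.single_eq_same, fourier_coe_apply]
    congr 1
    have : (Real.pi : ℂ) ≠ 0 := by exact_mod_cast Real.pi_ne_zero
    push_cast
    field_simp
  · intro i _ hi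
    rw [axis, proj, Pi.single_eq_of_ne hi]
    simp
  · simp

lemma mono_add_point (k : Fin d → ℤ) (x y : Torus d) : mono k (x + y) = mono k x * mono k y := by
  simp only [mono_apply, Pi.add_apply, fourier_apply, smul_add, AddCircle.toCircle_add,
    Circle.coe_mul, Finset.prod_mul_distrib]

/-- Translation multiplies the Fourier coefficients by a phase. -/
lemma coeff_translate (F : Torus d → ℝ) (a : Torus d) (k : Fin d → ℤ) :
    coeff (fun x => F (x + a)) k = mono k a * coeff F k := by
  have h : ∫ x, mono (-k) x * (F (x + a) : ℂ) = mono k a * ∫ x, mono (-k) x * (F x : ℂ) := by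
    rw [← integral_add_right_eq_self (fun x => mono (-k) x * (F x : ℂ)) a, ← integral_const_mul]
    congr 1; ext x
    have h1 : mono k a * mono (-k) a = 1 := by rw [← mono_add, add_neg_cancel, mono_zero]
    rw [mono_add_point]
    linear_combination (-(mono (-k) x * (F (x + a) : ℂ))) * h1
  calc coeff (fun x => F (x + a)) k
      = (((2 * Real.pi) ^ d)⁻¹ : ℝ) * ∫ x, mono (-k) x * (F (x + a) : ℂ) := rfl
    _ = mono k a * ((((2 * Real.pi) ^ d)⁻¹ : ℝ) * ∫ x, mono (-k) x * (F x : ℂ)) := by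
        rw [h]; ring
    _ = _ := rfl

/-- Differentiation multiplies the Fourier coefficients by `i k_j`. -/
lemma coeff_pderiv {F : Torus d → ℝ} (hF : IsSmooth F) (j : Fin d) (k : Fin d → ℤ) :
    coeff (pderiv j F) k = Complex.I * k j * coeff F k := by
  obtain ⟨C, hC⟩ := isCompact_univ.exists_bound_of_continuousOn
    (hF.pderiv j).continuous.continuousOn
  have hax : ∀ t, Continuous fun x : Torus d => x + axis j t := fun t => by fun_prop
  have h1 : HasDerivAt (fun t : ℝ => ∫ x, mono (-k) x * (F (x + axis j t) : ℂ))
      (∫ x, mono (-k) x * (pderiv j F x : ℂ)) 0 := by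
    have h2 := (hasDerivAt_integral_of_dominated_loc_of_deriv_le (μ := volume) (𝕜 := ℝ)
      (F := fun (t : ℝ) x => mono (-k) x * (F (x + axis j t) : ℂ))
      (F' := fun t x => mono (-k) x * (pderiv j F (x + axis j t) : ℂ))
      (bound := fun _ => C) (x₀ := 0) (s := univ) univ_mem ?_ ?_ ?_ ?_ ?_ ?_).2
    · have e : axis j 0 = 0 := by ext i; simp [axis, proj]
      simpa only [e, add_zero] using h2
    · refine .of_forall fun t => Continuous.aestronglyMeasurable ?_
      exact (mono (-k)).continuous.mul
        (Complex.continuous_ofReal.comp (hF.continuous.comp (hax t)))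
    · refine integrable_mono_mul ?_ _
      refine (Continuous.integrable_of_hasCompactSupport ?_ (.of_compactSpace _))
      exact Complex.continuous_ofReal.comp (hF.continuous.comp (hax 0))
    · refine Continuous.aestronglyMeasurable ?_
      exact (mono (-k)).continuous.mul
        (Complex.continuous_ofReal.comp ((hF.pderiv j).continuous.comp (hax 0)))
    · refine .of_forall fun x t _ => ?_
      rw [norm_mul, norm_mono, one_mul, Complex.norm_real]
      exact hC _ trivial
    · exact integrable_const _
    · refine .of_forall fun x t _ => ?_
      exact ((hF.hasDerivAt j x t).ofReal_comp).const_mul _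
  have h3 : HasDerivAt (fun t : ℝ => coeff (fun x => F (x + axis j t)) k)
      (coeff (pderiv j F) k) 0 := h1.const_mul _
  have h4 : HasDerivAt (fun t : ℝ => coeff (fun x => F (x + axis j t)) k)
      (Complex.I * k j * coeff F k) 0 := by
    simp only [coeff_translate, mono_axis]
    have h5 : HasDerivAt (fun t : ℝ => Complex.I * k j * (t : ℂ)) (Complex.I * k j) 0 := by
      simpa using (Complex.ofRealCLM.hasDerivAt (x := 0)).const_mul (Complex.I * (k j : ℂ))
    simpa using (h5.cexp).mul_const (coeff F k)
  exact h3.unique h4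

lemma coeff_one (k : Fin d → ℤ) : coeff (fun _ => 1) k = if k = 0 then 1 else 0 := by
  have h : coeff (fun _ => 1) k = (((2 * Real.pi) ^ d)⁻¹ : ℝ) * ∫ x, mono (-k) x := by
    unfold coeff
    congr 2; ext x
    rw [Complex.ofReal_one, mul_one]; rfl
  rw [h, integral_mono]
  have : (Real.pi : ℂ) ≠ 0 := by exact_mod_cast Real.pi_ne_zero
  by_cases hk : k = 0
  · simp [hk]
  · simp [hk]

lemma jap_zero : jap (0 : Fin d → ℤ) = 1 := by simp [jap, freqSq]

lemma wNorm_coeff_one (σ : ℝ) : wNorm σ (coeff fun _ : Torus d => 1) = 1 := by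
  unfold wNorm l2
  rw [tsum_eq_single 0]
  · simp [coeff_one, wt, jap_zero]
  · intro k hk
    simp [coeff_one, hk]

/-! ### Composition with a smooth function -/

lemma eLpNorm_eq_wNorm {v : Torus d → ℝ} (hv : MemLp v 2) :
    eLpNorm v 2 volume = ENNReal.ofReal (volSqrt d) * wNorm 0 (coeff v) := by
  rw [← Lp.enorm_toLp hv, enorm_eq_wNorm, coeff_congr hv.coeFn_toLp]

lemma wNorm_zero_coeff_le {v w : Torus d → ℝ} (hv : MemLp v 2) (hw : MemLp w 2) {C : ℝ≥0}
    (h : ∀ᵐ x, ‖v x‖ₑ ≤ C * ‖w x‖ₑ) : wNorm 0 (coeff v) ≤ C * wNorm 0 (coeff w) := by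
  have h1 : eLpNorm v 2 volume ≤ C * eLpNorm w 2 volume := by
    have := eLpNorm_le_nnreal_smul_eLpNorm_of_ae_le_mul (c := C) (f := v) (g := w)
      (μ := volume) (by filter_upwards [h] with x hx; rwa [← ENNReal.coe_le_coe, ENNReal.coe_mul]) 2
    simpa [ENNReal.smul_def] using this
  rw [eLpNorm_eq_wNorm hv, eLpNorm_eq_wNorm hw, mul_left_comm] at h1
  exact (ENNReal.mul_le_mul_iff_right (by simpa using volSqrt_pos) ENNReal.ofReal_ne_top).1 h1

lemma jap_le_one_add_sum (k : Fin d → ℤ) : jap k ≤ 1 + ∑ j, |(k j : ℝ)| := by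
  have h0 : 0 ≤ ∑ j, |(k j : ℝ)| := Finset.sum_nonneg fun _ _ => abs_nonneg _
  refine (abs_le_of_sq_le_sq' ?_ (by linarith)).2
  have h1 : freqSq k ≤ (∑ j, |(k j : ℝ)|) ^ 2 := by
    unfold freqSq
    simp only [← sq_abs (k _ : ℝ)]
    exact Finset.sum_sq_le_sq_sum_of_nonneg fun _ _ => abs_nonneg _
  rw [jap_sq]
  nlinarith

lemma abs_freq_le_jap (k : Fin d → ℤ) (j : Fin d) : |(k j : ℝ)| ≤ jap k :=
  (norm_le_pi_norm (fun i => (k i : ℝ)) j).trans (norm_le_jap k)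

lemma enorm_I_mul_freq (a : ℤ) : ‖Complex.I * (a : ℂ)‖ₑ = ENNReal.ofReal |(a : ℝ)| := by
  rw [← ofReal_norm, norm_mul, Complex.norm_I, one_mul, Complex.norm_intCast]

lemma wNorm_freq_mul_le (σ : ℝ) (c : (Fin d → ℤ) → ℂ) (j : Fin d) :
    wNorm (σ - 1) (fun k => Complex.I * k j * c k) ≤ wNorm σ c := by
  refine l2_mono fun k => ?_
  have e : σ = (σ - 1) + 1 := by ring
  rw [enorm_mul, enorm_I_mul_freq, ← mul_assoc]
  nth_rw 2 [e]
  rw [wt_add]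
  gcongr
  rw [wt, Real.rpow_one]
  exact ENNReal.ofReal_le_ofReal (abs_freq_le_jap k j)

lemma wNorm_add_one_le (σ : ℝ) (c : (Fin d → ℤ) → ℂ) :
    wNorm (σ + 1) c ≤ wNorm σ c + ∑ j, wNorm σ (fun k => Complex.I * k j * c k) := by
  refine le_trans (l2_mono fun k => ?_)
    ((l2_add_le _ _).trans (add_le_add le_rfl (l2_sum_le Finset.univ
      fun j k => wt σ k * ‖Complex.I * k j * c k‖ₑ)))
  simp only [enorm_mul _ (c k), enorm_I_mul_freq]
  have h0 : wt 1 k = ENNReal.ofReal (jap k) := by rw [wt, Real.rpow_one]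
  rw [wt_add, h0]
  have h1 : ENNReal.ofReal (jap k) ≤ 1 + ∑ j, ENNReal.ofReal |(k j : ℝ)| := by
    rw [← ENNReal.ofReal_sum_of_nonneg (fun _ _ => abs_nonneg _), ← ENNReal.ofReal_one,
      ← ENNReal.ofReal_add zero_le_one (Finset.sum_nonneg fun _ _ => abs_nonneg _)]
    exact ENNReal.ofReal_le_ofReal (jap_le_one_add_sum k)
  calc wt σ k * ENNReal.ofReal (jap k) * ‖c k‖ₑ
      ≤ wt σ k * (1 + ∑ j, ENNReal.ofReal |(k j : ℝ)|) * ‖c k‖ₑ := by gcongr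
    _ = _ := by
        rw [mul_add, add_mul, mul_one, Finset.mul_sum, Finset.sum_mul]
        simp only [mul_assoc]

/-- Smooth functions of one variable, bounded with all their derivatives. -/
def BddSmooth (g : ℝ → ℝ) : Prop :=
  ContDiff ℝ ∞ g ∧ ∀ n : ℕ, ∃ C : ℝ, ∀ y : ℝ, |iteratedDeriv n g y| ≤ C

lemma BddSmooth.deriv {g : ℝ → ℝ} (hg : BddSmooth g) : BddSmooth (deriv g) := by
  refine ⟨(contDiff_infty_iff_deriv.1 hg.1).2, fun n => ?_⟩
  obtain ⟨C, hC⟩ := hg.2 (n + 1)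
  exact ⟨C, fun y => by rw [← iteratedDeriv_succ']; exact hC y⟩

/-- Multiplication by `g(w)` on `H^n`, for smooth functions. In the induction over `n` one
derivative falls on `g(w)` and gives `g'(w) ∂w`; since `∂w ∈ H^{s-1}`, the product with a function
of `H^{n+1}` is in `H^n`, and the induction hypothesis applies to `g'`. -/
lemma exists_wNorm_comp_mul_le_of_isSmooth {s : ℝ} (hs : (d : ℝ) / 2 < s) (n : ℕ) (hn : (n : ℝ) ≤ s)
    {g : ℝ → ℝ} (hg : BddSmooth g) :
    ∃ C : ℝ≥0∞, C < ⊤ ∧ ∀ w Q : Torus d → ℝ, IsSmooth w → IsSmooth Q →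
      wNorm n (coeff fun x => g (w x) * Q x) ≤
        C * (1 + wNorm s (coeff w)) ^ n * wNorm n (coeff Q) := by
  induction n generalizing g with
  | zero =>
    obtain ⟨C, hC⟩ := hg.2 0
    refine ⟨(Real.toNNReal C : ℝ≥0∞), ENNReal.coe_lt_top, fun w Q hw hQ => ?_⟩
    simp only [Nat.cast_zero, pow_zero, mul_one]
    refine wNorm_zero_coeff_le ((hw.comp hg.1).mul hQ).memLp hQ.memLp (.of_forall fun x => ?_)
    rw [enorm_mul]
    gcongr
    rw [← ofReal_norm, Real.norm_eq_abs]
    have := hC (w x)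
    rw [iteratedDeriv_zero] at this
    exact ENNReal.ofReal_le_ofReal this
  | succ n ih =>
    push_cast at hn
    obtain ⟨C₀, hC₀, H₀⟩ := ih (by linarith) hg
    obtain ⟨C₁, hC₁, H₁⟩ := ih (by linarith) hg.deriv
    refine ⟨C₀ + d * (C₁ * prodConst d s + C₀), ?_, fun w Q hw hQ => ?_⟩
    · have := prodConst_lt_top (d := d) hs
      finiteness
    set W := wNorm s (coeff w)
    set q := wNorm (n + 1 : ℝ) (coeff Q)
    have hq : wNorm n (coeff Q) ≤ q := wNorm_mono (by linarith) _
    have hX : (1 + W) ^ n ≤ (1 + W) ^ (n + 1) := pow_le_pow_right₀ le_self_add n.le_succ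
    have hder : ∀ j, wNorm n (coeff (pderiv j Q)) ≤ q := fun j => by
      have := wNorm_freq_mul_le (n + 1 : ℝ) (coeff Q) j
      rw [add_sub_cancel_right] at this
      refine le_trans (le_of_eq ?_) this
      congr 1; ext k; exact coeff_pderiv hQ j k
    have hprod : ∀ j, wNorm n (coeff fun x => pderiv j w x * Q x) ≤ prodConst d s * W * q := by
      intro j
      have h1 := wNorm_coeff_mul_le (s := s) (i := 1) (j := s - n - 1) zero_le_one (by linarith)
        (by linarith) (hw.pderiv j).memLp hQ.memLp
      rw [show s - 1 - (s - n - 1) = n by ring, show s - (s - n - 1) = (n : ℝ) + 1 by ring] at h1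
      refine h1.trans ?_
      gcongr
      refine le_trans (le_of_eq ?_) (wNorm_freq_mul_le s (coeff w) j)
      congr 1; ext k; exact coeff_pderiv hw j k
    have hF := (hw.comp hg.1).mul hQ
    have hstep : ∀ j, wNorm n (fun k => Complex.I * k j * coeff (fun x => g (w x) * Q x) k) ≤
        (C₁ * prodConst d s + C₀) * (1 + W) ^ (n + 1) * q := by
      intro j
      have e : (fun k => Complex.I * k j * coeff (fun x => g (w x) * Q x) k) = fun k =>
          coeff (fun x => deriv g (w x) * (pderiv j w x * Q x)) k
            + coeff (fun x => g (w x) * pderiv j Q x) k := by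
        ext k
        rw [← coeff_pderiv hF j k, ← coeff_add]
        · congr 1; ext x; exact pderiv_comp_mul hg.1 hw hQ j x
        · exact ((hw.comp hg.deriv.1).mul ((hw.pderiv j).mul hQ)).memLp.integrable (by norm_num)
        · exact ((hw.comp hg.1).mul (hQ.pderiv j)).memLp.integrable (by norm_num)
      rw [e]
      refine (wNorm_add_le _ _ _).trans ?_
      calc _ ≤ C₁ * (1 + W) ^ n * (prodConst d s * W * q) + C₀ * (1 + W) ^ n * q := by
            refine add_le_add ((H₁ w _ hw ((hw.pderiv j).mul hQ)).trans ?_)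
              ((H₀ w _ hw (hQ.pderiv j)).trans ?_)
            · gcongr; exact hprod j
            · gcongr; exact hder j
        _ = C₁ * prodConst d s * ((1 + W) ^ n * W) * q + C₀ * (1 + W) ^ n * q := by ring
        _ ≤ C₁ * prodConst d s * (1 + W) ^ (n + 1) * q + C₀ * (1 + W) ^ (n + 1) * q := by
            have : (1 + W) ^ n * W ≤ (1 + W) ^ (n + 1) := by
              rw [pow_succ]; gcongr; exact le_add_self
            gcongr
        _ = _ := by ring
    push_cast
    calc wNorm (n + 1 : ℝ) (coeff fun x => g (w x) * Q x)
        ≤ wNorm n (coeff fun x => g (w x) * Q x)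
          + ∑ j, wNorm n (fun k => Complex.I * k j * coeff (fun x => g (w x) * Q x) k) :=
          wNorm_add_one_le _ _
      _ ≤ C₀ * (1 + W) ^ (n + 1) * q
          + ∑ _j : Fin d, (C₁ * prodConst d s + C₀) * (1 + W) ^ (n + 1) * q := by
          refine add_le_add ((H₀ w Q hw hQ).trans ?_) (Finset.sum_le_sum fun j _ => hstep j)
          gcongr
      _ = _ := by
          rw [Finset.sum_const, Finset.card_univ, Fintype.card_fin, nsmul_eq_mul]; ring

/-- The real part of a trigonometric polynomial. -/
def trigPoly (A : Finset (Fin d → ℤ)) (c : (Fin d → ℤ) → ℂ) (x : Torus d) : ℝ :=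
  (∑ k ∈ A, c k * mono k x).re

lemma isSmooth_trigPoly (A : Finset (Fin d → ℤ)) (c : (Fin d → ℤ) → ℂ) :
    IsSmooth (trigPoly A c) := by
  have h1 : ∀ k : Fin d → ℤ, ContDiff ℝ ∞ fun y : Fin d → ℝ => mono k (proj y) := by
    intro k
    simp only [mono_apply, proj, fourier_coe_apply]
    refine contDiff_prod fun i _ => Complex.contDiff_exp.comp ?_
    have h2 : ContDiff ℝ ∞ fun y : Fin d → ℝ => ((y i : ℝ) : ℂ) :=
      Complex.ofRealCLM.contDiff.comp (contDiff_apply ℝ ℝ i)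
    exact (contDiff_const.mul h2).div_const _
  exact Complex.reCLM.contDiff.comp (ContDiff.sum fun k _ => contDiff_const.mul (h1 k))

lemma ccoeff_mono (l k : Fin d → ℤ) : ccoeff (mono l) k = if k = l then 1 else 0 := by
  unfold ccoeff
  simp only [← mono_add]
  rw [integral_mono]
  have : (Real.pi : ℂ) ≠ 0 := by exact_mod_cast Real.pi_ne_zero
  by_cases h : k = l
  · simp [h]
  · simp [h, neg_add_eq_zero]

lemma ccoeff_sum_mono (A : Finset (Fin d → ℤ)) (c : (Fin d → ℤ) → ℂ) (k : Fin d → ℤ) :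
    ccoeff (fun x => ∑ l ∈ A, c l * mono l x) k = if k ∈ A then c k else 0 := by
  classical
  induction A using Finset.induction_on with
  | empty => simp [ccoeff]
  | insert l A hl ih =>
    have hint : ∀ F : Torus d → ℂ, Continuous F → Integrable F := fun F hF =>
      hF.integrable_of_hasCompactSupport (.of_compactSpace _)
    simp only [Finset.sum_insert hl]
    rw [ccoeff_add, ih, ccoeff_const_mul, ccoeff_mono]
    · by_cases h : k = l
      · subst h; simp [hl]
      · simp [h]
    · exact hint _ (by fun_prop)
    · exact hint _ (by fun_prop)

lemma coeff_trigPoly {A : Finset (Fin d → ℤ)} (hA : ∀ k, -k ∈ A ↔ k ∈ A) {c : (Fin d → ℤ) → ℂ}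
    (hc : ∀ k, c (-k) = conj (c k)) (k : Fin d → ℤ) :
    coeff (trigPoly A c) k = if k ∈ A then c k else 0 := by
  have hint : Integrable (fun x : Torus d => ∑ l ∈ A, c l * mono l x) :=
    Continuous.integrable_of_hasCompactSupport (by fun_prop) (.of_compactSpace _)
  refine (coeff_re hint k).trans ?_
  rw [ccoeff_sum_mono, ccoeff_sum_mono]
  by_cases h : k ∈ A
  · simp [h, hA, hc]
  · simp [h, hA]

lemma enorm_coeff_le_wNorm {σ : ℝ} (hσ : 0 ≤ σ) (c : (Fin d → ℤ) → ℂ) (k : Fin d → ℤ) :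
    ‖c k‖ₑ ≤ wNorm σ c := by
  refine le_of_sq_le_sq ?_
  rw [wNorm_sq]
  refine le_trans ?_ (ENNReal.le_tsum k)
  exact le_mul_of_one_le_left' (one_le_pow₀ (one_le_wt hσ k))

lemma memLp_lipschitz_comp {K : ℝ≥0} {F : ℝ → ℝ} (hF : LipschitzWith K F) {v : Torus d → ℝ}
    (hv : MemLp v 2) : MemLp (fun x => F (v x)) 2 := by
  have h1 := (hF.sub (LipschitzWith.const (F 0))).comp_memLp (by simp) hv
  refine (h1.add (memLp_const (F 0))).ae_eq (.of_forall fun x => ?_)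
  simp

lemma BddSmooth.exists_lipschitzWith {g : ℝ → ℝ} (hg : BddSmooth g) :
    ∃ K : ℝ≥0, LipschitzWith K g := by
  obtain ⟨K, hK⟩ := hg.2 1
  refine ⟨K.toNNReal, lipschitzWith_of_nnnorm_deriv_le (hg.1.differentiable (by simp)) fun y => ?_⟩
  have := hK y
  rw [iteratedDeriv_one] at this
  rw [← NNReal.coe_le_coe, coe_nnnorm, Real.norm_eq_abs]
  exact this.trans (Real.le_coe_toNNReal K)

/-- Composition with a function that is bounded together with its derivatives acts on `H^s`, and
the norm grows at most like the power `s`. -/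
lemma exists_wNorm_comp_le {s : ℕ} (hs : (d : ℝ) / 2 < s) {g : ℝ → ℝ} (hg : BddSmooth g) :
    ∃ C : ℝ≥0∞, C < ⊤ ∧ ∀ w : L2 d, wNorm s (coeff w) < ⊤ →
      wNorm s (coeff fun x => g (w x)) ≤ C * (1 + wNorm s (coeff w)) ^ s := by
  classical
  obtain ⟨C, hC, H⟩ := exists_wNorm_comp_mul_le_of_isSmooth hs s le_rfl hg
  refine ⟨C, hC, fun w hw => ?_⟩
  obtain ⟨K, hK⟩ := hg.exists_lipschitzWith
  -- The truncations are taken over symmetric sets of frequencies to keep the functions real.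
  let sym : Finset (Fin d → ℤ) → Finset (Fin d → ℤ) := fun A => A ∪ A.image Neg.neg
  have hsym : ∀ A k, -k ∈ sym A ↔ k ∈ sym A := fun A k => by
    simp only [sym, Finset.mem_union, Finset.mem_image]
    constructor
    · rintro (h | ⟨l, hl, h⟩)
      · exact Or.inr ⟨-k, h, neg_neg k⟩
      · rw [neg_inj] at h; exact Or.inl (h ▸ hl)
    · rintro (h | ⟨l, hl, h⟩)
      · exact Or.inr ⟨k, h, rfl⟩
      · exact Or.inl (by rw [← h, neg_neg]; exact hl)
  have hsymm : Tendsto sym atTop atTop :=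
    tendsto_atTop_mono (fun A => Finset.subset_union_left) tendsto_id
  let W : Finset (Fin d → ℤ) → Torus d → ℝ := fun A => trigPoly (sym A) (coeff w)
  have hW : ∀ A k, coeff (W A) k = if k ∈ sym A then coeff w k else 0 := fun A k =>
    coeff_trigPoly (hsym A) (coeff_neg_freq w) k
  have hWs : ∀ A, IsSmooth (W A) := fun A => isSmooth_trigPoly _ _
  have hWle : ∀ A, wNorm s (coeff (W A)) ≤ wNorm s (coeff w) := fun A => by
    refine wNorm_mono_coeff fun k => ?_
    rw [hW]; split_ifs <;> simp
  have hbound : ∀ A, wNorm s (coeff fun x => g (W A x)) ≤ C * (1 + wNorm s (coeff w)) ^ s := by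
    intro A
    have h1 := H (W A) (fun _ => 1) (hWs A) (IsSmooth.const 1)
    simp only [mul_one, wNorm_coeff_one] at h1
    refine h1.trans ?_
    gcongr
    exact hWle A
  have hw0 : wNorm 0 (coeff w) < ⊤ := (wNorm_mono (by positivity) _).trans_lt hw
  -- The truncated Fourier series converge in `L²`.
  have hconv : Tendsto (fun A => wNorm 0 (coeff fun x => W A x - w x)) atTop (𝓝 0) := by
    have h1 : ∑' k, ‖coeff w k‖ₑ ^ 2 ≠ ⊤ := by
      have := wNorm_sq 0 (coeff w)
      simp only [wt_zero, one_pow, one_mul] at this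
      rw [← this]
      exact (ENNReal.pow_lt_top hw0).ne
    have h2 := ((ENNReal.tendsto_tsum_compl_atTop_zero h1).comp hsymm).ennrpow_const (1 / 2 : ℝ)
    rw [ENNReal.zero_rpow_of_pos (by norm_num)] at h2
    refine h2.congr fun A => ?_
    unfold wNorm l2
    congr 1
    rw [Function.comp_apply]
    refine (tsum_subtype {k | k ∉ sym A} fun k => ‖coeff w k‖ₑ ^ 2).trans (tsum_congr fun k => ?_)
    have h3 := coeff_sub ((hWs A).memLp.integrable (by norm_num)) (coeFn_integrable w) k
    simp only [wt_zero, one_mul, h3, hW]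
    by_cases h : k ∈ sym A <;> simp [h]
  refine l2_le_of_tendsto (F := atTop) (a := fun A k => wt s k * ‖coeff (fun x => g (W A x)) k‖ₑ)
    (fun k => ?_) (.of_forall hbound)
  refine ENNReal.Tendsto.const_mul ?_ (Or.inr (wt_ne_top _ _))
  refine (continuous_enorm.tendsto _).comp ?_
  rw [tendsto_iff_edist_tendsto_0]
  have hgw : MemLp (fun x => g (w x)) 2 := memLp_lipschitz_comp hK (coeFn_memLp w)
  refine tendsto_of_tendsto_of_tendsto_of_le_of_le tendsto_const_nhds
    (by simpa using ENNReal.Tendsto.const_mul hconv (Or.inr (ENNReal.coe_ne_top (r := K))))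
    (fun _ => zero_le) fun A => ?_
  have hgW := ((hWs A).comp hg.1).memLp
  rw [edist_eq_enorm_sub, ← coeff_sub (hgW.integrable (by norm_num)) (hgw.integrable (by norm_num))]
  refine (enorm_coeff_le_wNorm le_rfl _ k).trans ?_
  refine wNorm_zero_coeff_le (hgW.sub hgw) ((hWs A).memLp.sub (coeFn_memLp w))
    (.of_forall fun x => ?_)
  simpa only [Pi.sub_apply, edist_eq_enorm_sub] using hK (W A x) (w x)

/-! ### The nonlinearity on `H^s` -/

lemma ae_enorm_le_of_memLp (s : ℝ) {v : Torus d → ℝ} (hv : MemLp v 2) :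
    ∀ᵐ x, ‖v x‖ₑ ≤ embConst d s * wNorm s (coeff v) := by
  have h := ae_enorm_le s (hv.toLp v)
  rw [coeff_congr hv.coeFn_toLp] at h
  filter_upwards [h, hv.coeFn_toLp] with x hx hx'
  rwa [hx'] at hx

lemma wNorm_coeff_add_le (σ : ℝ) {v w : Torus d → ℝ} (hv : MemLp v 2) (hw : MemLp w 2) :
    wNorm σ (coeff fun x => v x + w x) ≤ wNorm σ (coeff v) + wNorm σ (coeff w) := by
  have e : coeff (fun x => v x + w x) = fun k => coeff v k + coeff w k := by
    ext k; exact coeff_add (hv.integrable (by norm_num)) (hw.integrable (by norm_num)) k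
  rw [e]
  exact wNorm_add_le _ _ _

lemma wNorm_coeff_const_mul (σ : ℝ) (a : ℝ) (v : Torus d → ℝ) :
    wNorm σ (coeff fun x => a * v x) = ‖a‖ₑ * wNorm σ (coeff v) := by
  have e : coeff (fun x => a * v x) = fun k => (a : ℂ) * coeff v k := by
    ext k; exact coeff_const_mul a v k
  rw [e, wNorm_const_mul, ← ofReal_norm, Complex.norm_real, ofReal_norm]

lemma coeff_zero_fun : coeff (fun _ : Torus d => (0 : ℝ)) = fun _ => 0 := by
  ext k; simp [coeff]

lemma wNorm_coeff_sum_le (σ : ℝ) {ι : Type*} (t : Finset ι) {v : ι → Torus d → ℝ}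
    (hv : ∀ i ∈ t, MemLp (v i) 2) :
    wNorm σ (coeff fun x => ∑ i ∈ t, v i x) ≤ ∑ i ∈ t, wNorm σ (coeff (v i)) := by
  classical
  induction t using Finset.induction_on with
  | empty =>
    simp [coeff_zero_fun, wNorm_zero]
  | insert i t hi ih =>
    simp only [Finset.sum_insert hi]
    have h1 : ∀ j ∈ t, MemLp (v j) 2 := fun j hj => hv j (Finset.mem_insert_of_mem hj)
    refine (wNorm_coeff_add_le σ (hv i (Finset.mem_insert_self _ _))
      (memLp_finsetSum t h1)).trans ?_
    gcongr
    exact ih h1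

/-- A function of `H^s` with `s > d/2` is bounded, so multiplication by it preserves `L²`. -/
lemma memLp_mul {s : ℝ} (hs : (d : ℝ) / 2 < s) {v w : Torus d → ℝ} (hv : MemLp v 2)
    (hv' : wNorm s (coeff v) < ⊤) (hw : MemLp w 2) : MemLp (fun x => v x * w x) 2 := by
  have hfin : embConst d s * wNorm s (coeff v) ≠ ⊤ :=
    (ENNReal.mul_lt_top (embConst_lt_top hs) hv').ne
  refine hw.of_le_mul (c := (embConst d s * wNorm s (coeff v)).toReal) (hv.1.mul hw.1) ?_
  filter_upwards [ae_enorm_le_of_memLp s hv] with x hx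
  rw [norm_mul]
  gcongr
  rw [← toReal_enorm]
  exact ENNReal.toReal_mono hfin hx

/-- `H^s` is an algebra for `s > d/2`. -/
lemma wNorm_mul_le {s : ℝ} (hs : 0 ≤ s) {v w : Torus d → ℝ} (hv : MemLp v 2)
    (hw : MemLp w 2) : wNorm s (coeff fun x => v x * w x) ≤
      prodConst d s * wNorm s (coeff v) * wNorm s (coeff w) := by
  simpa using wNorm_coeff_mul_le (s := s) (i := 0) (j := 0) le_rfl le_rfl (by simpa) hv hw

/-- Powers are bounded and Lipschitz on balls of `H^s`. -/
lemma exists_wNorm_pow_le {s : ℝ} (hs : (d : ℝ) / 2 < s) {R : ℝ≥0∞} (hR : R < ⊤) (i : ℕ) :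
    ∃ C : ℝ≥0∞, C < ⊤ ∧ ∀ v : Torus d → ℝ, MemLp v 2 → wNorm s (coeff v) ≤ R →
      (MemLp (fun x => v x ^ i) 2 ∧ wNorm s (coeff fun x => v x ^ i) ≤ C) ∧
      ∀ w : Torus d → ℝ, MemLp w 2 → wNorm s (coeff w) ≤ R →
        wNorm s (coeff fun x => v x ^ i - w x ^ i) ≤ C * wNorm s (coeff fun x => v x - w x) := by
  have hs0 : 0 ≤ s := (lt_of_le_of_lt (by positivity) hs).le
  induction i with
  | zero =>
    refine ⟨1, ENNReal.one_lt_top, fun v hv hvR => ⟨⟨?_, ?_⟩, fun w hw hwR => ?_⟩⟩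
    · simpa using memLp_const (1 : ℝ)
    · simp [wNorm_coeff_one]
    · simp [coeff_zero_fun, wNorm_zero]
  | succ i ih =>
    obtain ⟨C, hC, H⟩ := ih
    refine ⟨prodConst d s * R * C + prodConst d s * C, ?_, fun v hv hvR => ?_⟩
    · have := prodConst_lt_top (d := d) hs
      finiteness
    obtain ⟨⟨h1, h2⟩, h3⟩ := H v hv hvR
    refine ⟨⟨?_, ?_⟩, fun w hw hwR => ?_⟩
    · simp only [pow_succ']
      exact memLp_mul hs hv (hvR.trans_lt hR) h1
    · simp only [pow_succ']
      calc _ ≤ prodConst d s * wNorm s (coeff v) * wNorm s (coeff fun x => v x ^ i) :=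
            wNorm_mul_le hs0 hv h1
        _ ≤ prodConst d s * R * C := by gcongr
        _ ≤ _ := le_self_add
    · obtain ⟨⟨h1', h2'⟩, -⟩ := H w hw hwR
      have hvw := hv.sub hw
      have hvwR : wNorm s (coeff fun x => v x - w x) < ⊤ := by
        have h4 := wNorm_coeff_add_le s hv (hw.const_mul (-1))
        rw [wNorm_coeff_const_mul] at h4
        simp only [neg_mul, one_mul, ← sub_eq_add_neg, enorm_neg, enorm_one] at h4
        exact h4.trans_lt (ENNReal.add_lt_top.2 ⟨hvR.trans_lt hR, hwR.trans_lt hR⟩)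
      have e : (fun x => v x ^ (i + 1) - w x ^ (i + 1)) =
          fun x => v x * (v x ^ i - w x ^ i) + (v x - w x) * w x ^ i := by
        ext x; ring
      rw [e]
      refine (wNorm_coeff_add_le s (memLp_mul hs hv (hvR.trans_lt hR) (h1.sub h1'))
        (memLp_mul hs hvw hvwR h1')).trans ?_
      rw [add_mul]
      refine add_le_add ?_ ?_
      · refine (wNorm_mul_le hs0 hv (h1.sub h1')).trans ?_
        rw [mul_assoc (prodConst d s * R)]
        gcongr
        exact h3 w hw hwR
      · refine (wNorm_mul_le hs0 hvw h1').trans ?_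
        rw [mul_right_comm]
        gcongr
        exact le_rfl

/-- The leading term of the nonlinearity for large arguments: `κ^p f(u + ζ/κ) = ζ^p + O(κ)` in
`H^s`. -/
lemma exists_wNorm_nonlinearity_sub_le {s : ℕ} (hs : (d : ℝ) / 2 < s) {p : ℕ} {P : Polynomial ℝ}
    (hPdeg : P.natDegree = p) (hPmonic : P.Monic) {g : ℝ → ℝ} (hg : BddSmooth g)
    (hcond : g = 0 ∨ s < p) {R : ℝ≥0∞} (hR : R < ⊤) :
    ∃ C : ℝ≥0∞, C < ⊤ ∧ ∀ κ : ℝ, 0 < κ → κ ≤ 1 → ∀ u ζ : L2 d, wNorm s (coeff u) ≤ R →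
      wNorm s (coeff ζ) ≤ R → ∀ y : Torus d → ℝ, (∀ᵐ x, y x = u x + κ⁻¹ * ζ x) →
      MemLp (fun x => κ ^ p * (P.eval (y x) + g (y x)) - ζ x ^ p) 2 ∧
      wNorm s (coeff fun x => κ ^ p * (P.eval (y x) + g (y x)) - ζ x ^ p) ≤
        C * ENNReal.ofReal κ := by
  have hs0 : (0 : ℝ) ≤ s := s.cast_nonneg
  have hR2 : 2 * R < ⊤ := ENNReal.mul_lt_top (by simp) hR
  choose D hD HD using fun i => exists_wNorm_pow_le hs hR2 i
  obtain ⟨Cg, hCg, Hg⟩ := exists_wNorm_comp_le hs hg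
  refine ⟨∑ i ∈ Finset.range p, ‖P.coeff i‖ₑ * D i + D p * R + Cg * (1 + 2 * R) ^ s, ?_,
    fun κ hκ hκ1 u ζ hu hζ y hy => ?_⟩
  · have h1 : ∑ i ∈ Finset.range p, ‖P.coeff i‖ₑ * D i < ⊤ :=
      ENNReal.sum_lt_top.2 fun i _ => ENNReal.mul_lt_top enorm_lt_top (hD i)
    have := hD p
    finiteness
  set ε := ENNReal.ofReal κ with hε
  have hε1 : ε ≤ 1 := ENNReal.ofReal_le_one.2 hκ1
  have hε0 : ε ≠ 0 := by simpa [hε] using hκ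
  have hεtop : ε ≠ ⊤ := ENNReal.ofReal_ne_top
  have hκε : ‖κ‖ₑ = ε := by rw [← ofReal_norm, Real.norm_of_nonneg hκ.le]
  -- All terms are expressed through `w = κu + ζ`, which is bounded in `H^s`.
  set w : L2 d := κ • u + ζ with hw
  have hwae : ∀ᵐ x, w x = κ * u x + ζ x := by
    filter_upwards [Lp.coeFn_add (κ • u) ζ, Lp.coeFn_smul κ u] with x h1 h2
    rw [hw, h1, Pi.add_apply, h2]; rfl
  have hwζ : wNorm s (coeff fun x => w x - ζ x) ≤ ε * R := by
    have e : coeff (fun x => w x - ζ x) = coeff fun x => κ * u x := by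
      refine coeff_congr ?_
      filter_upwards [hwae] with x h1
      rw [h1]; ring
    rw [e, wNorm_coeff_const_mul, hκε]
    gcongr
  have hwR : wNorm s (coeff w) ≤ 2 * R := by
    have e : coeff w = coeff fun x => κ * u x + ζ x := coeff_congr hwae
    rw [e]
    refine (wNorm_coeff_add_le s ((coeFn_memLp u).const_mul κ) (coeFn_memLp ζ)).trans ?_
    rw [wNorm_coeff_const_mul, hκε, two_mul R]
    exact add_le_add ((mul_le_of_le_one_left' hε1).trans hu) hζ
  have hζR : wNorm s (coeff ζ) ≤ 2 * R := hζ.trans (by rw [two_mul R]; exact le_self_add)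
  have hpow : ∀ i, MemLp (fun x => w x ^ i) 2 := fun i => (HD i w (coeFn_memLp w) hwR).1.1
  have hpowζ : MemLp (fun x => ζ x ^ p) 2 := (HD p ζ (coeFn_memLp ζ) hζR).1.1
  -- The bounded part of the nonlinearity.
  obtain ⟨K, hK⟩ : ∃ K : ℝ≥0, LipschitzWith K g := hg.exists_lipschitzWith
  set w' : L2 d := κ⁻¹ • w with hw'
  have hw'ae : ∀ᵐ x, w' x = κ⁻¹ * w x := by
    filter_upwards [Lp.coeFn_smul κ⁻¹ w] with x h1
    rw [hw', h1]; rfl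
  have hgm : MemLp (fun x => g (w' x)) 2 := memLp_lipschitz_comp hK (coeFn_memLp w')
  have hw'R : wNorm s (coeff w') ≤ ε⁻¹ * (2 * R) := by
    have e : coeff w' = coeff fun x => κ⁻¹ * w x := coeff_congr hw'ae
    rw [e, wNorm_coeff_const_mul, enorm_inv hκ.ne', hκε]
    gcongr
  have hgN : wNorm s (coeff fun x => κ ^ p * g (w' x)) ≤ Cg * (1 + 2 * R) ^ s * ε := by
    rw [wNorm_coeff_const_mul, enorm_pow, hκε]
    rcases hcond with h0 | hsp
    · have e : coeff (fun x => g (w' x)) = fun _ => 0 := by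
        simp only [h0, Pi.zero_apply]; exact coeff_zero_fun
      rw [e, wNorm_zero, mul_zero]
      exact zero_le
    · have hfin : wNorm s (coeff w') < ⊤ :=
        hw'R.trans_lt (ENNReal.mul_lt_top (ENNReal.inv_lt_top.2 (pos_iff_ne_zero.2 hε0)) hR2)
      -- `g(w/κ)` is of order `κ⁻ˢ` in `H^s`, and `s < p`.
      calc ε ^ p * wNorm s (coeff fun x => g (w' x))
          ≤ ε ^ (s + 1) * (Cg * (1 + ε⁻¹ * (2 * R)) ^ s) := by
            refine mul_le_mul' (pow_le_pow_right_of_le_one' hε1 hsp) ((Hg w' hfin).trans ?_)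
            gcongr
        _ = Cg * (ε * (1 + ε⁻¹ * (2 * R))) ^ s * ε := by rw [mul_pow]; ring
        _ = Cg * (ε + 2 * R) ^ s * ε := by
            rw [mul_add, mul_one, ← mul_assoc, ENNReal.mul_inv_cancel hε0 hεtop, one_mul]
        _ ≤ Cg * (1 + 2 * R) ^ s * ε := by gcongr
  have hterm : ∀ i ∈ Finset.range p, wNorm s (coeff fun x => P.coeff i * κ ^ (p - i) * w x ^ i) ≤
      ‖P.coeff i‖ₑ * D i * ε := by
    intro i hi
    rw [wNorm_coeff_const_mul, enorm_mul, enorm_pow, hκε]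
    have h1 : ε ^ (p - i) ≤ ε := by
      have h2 : 1 ≤ p - i := by have := Finset.mem_range.1 hi; omega
      exact (pow_le_pow_right_of_le_one' hε1 h2).trans (pow_one ε).le
    calc _ ≤ ‖P.coeff i‖ₑ * ε * D i := by gcongr; exact (HD i w (coeFn_memLp w) hwR).1.2
      _ = _ := by ring
  have hae : (fun x => κ ^ p * (P.eval (y x) + g (y x)) - ζ x ^ p) =ᵐ[volume] fun x =>
      (∑ i ∈ Finset.range p, P.coeff i * κ ^ (p - i) * w x ^ i + (w x ^ p - ζ x ^ p))
        + κ ^ p * g (w' x) := by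
    filter_upwards [hy, hwae, hw'ae] with x h1 h2 h3
    have h4 : y x = κ⁻¹ * w x := by
      rw [h1, h2]; field_simp
    rw [h3, h4, Polynomial.eval_eq_sum_range, hPdeg, Finset.sum_range_succ]
    have h5 : P.coeff p = 1 := by rw [← hPdeg]; exact hPmonic
    have h6 : ∀ i ≤ p, κ ^ p * (κ⁻¹ * w x) ^ i = κ ^ (p - i) * w x ^ i := fun i hi => by
      rw [mul_pow, ← mul_assoc, inv_pow, pow_sub₀ κ hκ.ne' hi]
    rw [mul_add, mul_add, Finset.mul_sum, h5, one_mul, h6 p le_rfl, Nat.sub_self, pow_zero, one_mul]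
    rw [Finset.sum_congr rfl (g := fun i => P.coeff i * κ ^ (p - i) * w x ^ i) fun i hi => by
      rw [mul_left_comm, h6 i (Finset.mem_range.1 hi).le, mul_assoc]]
    ring
  have hm1 : ∀ i ∈ Finset.range p, MemLp (fun x => P.coeff i * κ ^ (p - i) * w x ^ i) 2 :=
    fun i _ => (hpow i).const_mul _
  have hm2 : MemLp (fun x => ∑ i ∈ Finset.range p, P.coeff i * κ ^ (p - i) * w x ^ i) 2 :=
    memLp_finsetSum _ hm1
  have hm3 : MemLp (fun x => w x ^ p - ζ x ^ p) 2 := (hpow p).sub hpowζ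
  have hm4 : MemLp (fun x => κ ^ p * g (w' x)) 2 := hgm.const_mul _
  refine ⟨((hm2.add hm3).add hm4).ae_eq hae.symm, ?_⟩
  rw [coeff_congr hae]
  refine (wNorm_coeff_add_le s (hm2.add hm3) hm4).trans ?_
  rw [add_mul, add_mul]
  refine add_le_add ((wNorm_coeff_add_le s hm2 hm3).trans (add_le_add ?_ ?_)) hgN
  · rw [Finset.sum_mul]
    exact (wNorm_coeff_sum_le s _ hm1).trans (Finset.sum_le_sum hterm)
  · refine ((HD p w (coeFn_memLp w) hwR).2 ζ (coeFn_memLp ζ) hζR).trans ?_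
    rw [mul_assoc, mul_comm R]
    gcongr

/-- The rescaled nonlinearity `κ^p f(·/κ)` is Lipschitz on bounded sets, uniformly in `κ`. -/
lemma exists_lipschitz_scaled {p : ℕ} (hp : 1 ≤ p) {P : Polynomial ℝ} (hPdeg : P.natDegree = p)
    {g : ℝ → ℝ} (hg : BddSmooth g) (R : ℝ) :
    ∃ C : ℝ≥0, ∀ κ : ℝ, 0 < κ → κ ≤ 1 → ∀ x y : ℝ, |x| ≤ R → |y| ≤ R →
      |κ ^ p * (P.eval (κ⁻¹ * x) + g (κ⁻¹ * x)) - κ ^ p * (P.eval (κ⁻¹ * y) + g (κ⁻¹ * y))| ≤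
        C * |x - y| := by
  obtain ⟨K, hK⟩ : ∃ K : ℝ≥0, LipschitzWith K g := hg.exists_lipschitzWith
  set C : ℝ := ∑ i ∈ Finset.range (p + 1), |P.coeff i| * (i * |R| ^ (i - 1)) + K with hC
  have hC0 : 0 ≤ C := by positivity
  refine ⟨⟨C, hC0⟩, fun κ hκ hκ1 x y hx hy => ?_⟩
  change _ ≤ C * |x - y|
  have hP : ∀ z : ℝ, κ ^ p * P.eval (κ⁻¹ * z) =
      ∑ i ∈ Finset.range (p + 1), P.coeff i * κ ^ (p - i) * z ^ i := fun z => by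
    rw [Polynomial.eval_eq_sum_range, hPdeg, Finset.mul_sum]
    refine Finset.sum_congr rfl fun i hi => ?_
    rw [mul_pow, inv_pow, pow_sub₀ κ hκ.ne' (Nat.lt_succ_iff.1 (Finset.mem_range.1 hi))]
    ring
  have hterm : ∀ i ∈ Finset.range (p + 1),
      |P.coeff i * κ ^ (p - i) * x ^ i - P.coeff i * κ ^ (p - i) * y ^ i| ≤
        |P.coeff i| * (i * |R| ^ (i - 1)) * |x - y| := by
    intro i _
    rw [← mul_sub, abs_mul, abs_mul, abs_of_nonneg (pow_nonneg hκ.le _)]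
    have h1 : κ ^ (p - i) ≤ 1 := pow_le_one₀ hκ.le hκ1
    have h2 : |x ^ i - y ^ i| ≤ |x - y| * i * |R| ^ (i - 1) := by
      refine (abs_pow_sub_pow_le x y i).trans ?_
      gcongr
      exact max_le (hx.trans (le_abs_self R)) (hy.trans (le_abs_self R))
    calc |P.coeff i| * κ ^ (p - i) * |x ^ i - y ^ i|
        ≤ |P.coeff i| * 1 * (|x - y| * i * |R| ^ (i - 1)) := by gcongr
      _ = _ := by ring
  have hgl : |κ ^ p * g (κ⁻¹ * x) - κ ^ p * g (κ⁻¹ * y)| ≤ K * |x - y| := by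
    have h1 : |g (κ⁻¹ * x) - g (κ⁻¹ * y)| ≤ K * |κ⁻¹ * x - κ⁻¹ * y| := by
      simpa [Real.dist_eq] using hK.dist_le_mul (κ⁻¹ * x) (κ⁻¹ * y)
    rw [← mul_sub, abs_mul, abs_inv, abs_of_pos hκ] at h1
    rw [← mul_sub, abs_mul, abs_of_nonneg (pow_nonneg hκ.le _)]
    have h2 : κ ^ p * κ⁻¹ ≤ 1 := by
      rw [← div_eq_mul_inv, div_le_one hκ]
      exact pow_le_of_le_one hκ.le hκ1 (by omega)
    calc κ ^ p * |g (κ⁻¹ * x) - g (κ⁻¹ * y)| ≤ κ ^ p * (K * (κ⁻¹ * |x - y|)) := by gcongr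
      _ = (κ ^ p * κ⁻¹) * (K * |x - y|) := by ring
      _ ≤ 1 * (K * |x - y|) := by gcongr
      _ = _ := one_mul _
  have e : κ ^ p * (P.eval (κ⁻¹ * x) + g (κ⁻¹ * x)) - κ ^ p * (P.eval (κ⁻¹ * y) + g (κ⁻¹ * y)) =
      ∑ i ∈ Finset.range (p + 1),
        (P.coeff i * κ ^ (p - i) * x ^ i - P.coeff i * κ ^ (p - i) * y ^ i)
        + (κ ^ p * g (κ⁻¹ * x) - κ ^ p * g (κ⁻¹ * y)) := by
    rw [mul_add, mul_add, hP, hP, Finset.sum_sub_distrib]; ring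
  rw [e, hC, add_mul, Finset.sum_mul]
  exact (abs_add_le _ _).trans (add_le_add ((Finset.abs_sum_le_sum_abs _ _).trans
    (Finset.sum_le_sum hterm)) hgl)

/-- Superposition with `F`, as a map of `L²(𝕋^d)`; it is meaningful for Lipschitz functions `F`. -/
def superpose (F : ℝ → ℝ) (v : L2 d) : L2 d := by
  classical
  exact if h : MemLp (fun x => F (v x)) 2 then h.toLp _ else 0

lemma coeFn_superpose {K : ℝ≥0} {F : ℝ → ℝ} (hF : LipschitzWith K F) (v : L2 d) :
    superpose F v =ᵐ[volume] fun x => F (v x) := by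
  have h := memLp_lipschitz_comp hF (coeFn_memLp v)
  rw [superpose, dif_pos h]
  exact h.coeFn_toLp

lemma lipschitzWith_superpose {K : ℝ≥0} {F : ℝ → ℝ} (hF : LipschitzWith K F) :
    LipschitzWith K (superpose (d := d) F) := by
  intro v w
  rw [Lp.edist_def, Lp.edist_def]
  have h1 := eLpNorm_le_nnreal_smul_eLpNorm_of_ae_le_mul (c := K)
    (f := (superpose F v : Torus d → ℝ) - (superpose F w : Torus d → ℝ))
    (g := (v : Torus d → ℝ) - (w : Torus d → ℝ)) (μ := volume) (by
      filter_upwards [coeFn_superpose hF v, coeFn_superpose hF w] with x hx hx'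
      rw [Pi.sub_apply, hx, hx', ← ENNReal.coe_le_coe, ENNReal.coe_mul]
      have h2 := hF (v x) (w x)
      rwa [edist_eq_enorm_sub, edist_eq_enorm_sub] at h2) 2
  simpa [ENNReal.smul_def] using h1

/-- Truncation of a function of one variable outside `[-ρ, ρ]`. -/
def truncate (ρ : ℝ) (f : ℝ → ℝ) (y : ℝ) : ℝ := f (max (-ρ) (min ρ y))

lemma truncate_of_abs_le {ρ : ℝ} {f : ℝ → ℝ} {y : ℝ} (h : |y| ≤ ρ) : truncate ρ f y = f y := by
  obtain ⟨h1, h2⟩ := abs_le.1 h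
  rw [truncate, min_eq_right h2, max_eq_right h1]

lemma lipschitzWith_truncate {ρ : ℝ} (hρ : 0 ≤ ρ) {K : ℝ≥0} {f : ℝ → ℝ}
    (hf : ∀ x y, |x| ≤ ρ → |y| ≤ ρ → |f x - f y| ≤ K * |x - y|) :
    LipschitzWith K (truncate ρ f) := by
  refine LipschitzWith.of_dist_le_mul fun x y => ?_
  have hb : ∀ z : ℝ, |max (-ρ) (min ρ z)| ≤ ρ := fun z =>
    abs_le.2 ⟨le_max_left _ _, max_le (by linarith) (min_le_left _ _)⟩
  have h1 : LipschitzWith 1 fun z : ℝ => max (-ρ) (min ρ z) :=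
    (LipschitzWith.id.const_min ρ).const_max (-ρ)
  refine (hf _ _ (hb x) (hb y)).trans ?_
  gcongr
  simpa [Real.dist_eq] using h1.dist_le_mul x y

/-! ### The scalar linear equation `y' = -ay + n` -/

/-- Grönwall's inequality in integral form, with zero initial value. -/
lemma eq_zero_of_le_integral {T L : ℝ} {φ : ℝ → ℝ} (hφ : ContinuousOn φ (Icc 0 T))
    (h0 : ∀ t ∈ Icc 0 T, 0 ≤ φ t) (h : ∀ t ∈ Icc 0 T, φ t ≤ L * ∫ r in (0 : ℝ)..t, φ r) :
    ∀ t ∈ Icc 0 T, φ t = 0 := by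
  intro t ht
  have hT : 0 ≤ T := ht.1.trans ht.2
  set ψ : ℝ → ℝ := IccExtend hT ((Icc 0 T).domRestrict φ) with hψdef
  have hψ : Continuous ψ := (continuousOn_iff_continuous_domRestrict.1 hφ).Icc_extend'
  have hψφ : ∀ r ∈ Icc 0 T, ψ r = φ r := fun r hr => IccExtend_of_mem hT _ hr
  have hint : ∀ r ∈ Icc 0 T, ∫ ρ in (0 : ℝ)..r, φ ρ = ∫ ρ in (0 : ℝ)..r, ψ ρ := fun r hr => by
    refine intervalIntegral.integral_congr fun ρ hρ => ?_
    rw [uIcc_of_le hr.1] at hρ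
    exact (hψφ ρ ⟨hρ.1, hρ.2.trans hr.2⟩).symm
  have hder : ∀ r, HasDerivAt (fun r => ∫ ρ in (0 : ℝ)..r, ψ ρ) (ψ r) r := fun r =>
    intervalIntegral.integral_hasDerivAt_right (hψ.intervalIntegrable _ _)
      (hψ.stronglyMeasurableAtFilter _ _) hψ.continuousAt
  have key := eq_zero_of_abs_deriv_le_mul_abs_self_of_eq_zero_right
    (f := fun r => ∫ ρ in (0 : ℝ)..r, ψ ρ) (f' := ψ) (K := L) (a := 0) (b := T)
    (fun r _ => (hder r).continuousAt.continuousWithinAt)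
    (fun r _ => (hder r).hasDerivWithinAt) (by simp) ?_
  · have h1 := h t ht
    rw [hint t ht, key t ht, mul_zero] at h1
    exact le_antisymm h1 (h0 t ht)
  · intro r hr
    have hr' : r ∈ Icc 0 T := ⟨hr.1, hr.2.le⟩
    have hnn : 0 ≤ ∫ ρ in (0 : ℝ)..r, ψ ρ := by
      rw [← hint r hr']
      exact intervalIntegral.integral_nonneg hr.1 fun ρ hρ => h0 ρ ⟨hρ.1, hρ.2.trans hr'.2⟩
    rw [Real.norm_of_nonneg hnn, hψφ r hr', Real.norm_of_nonneg (h0 r hr'), ← hint r hr']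
    exact h r hr'

/-- The Duhamel integral `∫₀ᵗ e^{-a(t-r)} n(r) dr`. -/
def duhamel (a : ℝ) (n : ℝ → ℂ) (t : ℝ) : ℂ :=
  ∫ r in (0 : ℝ)..t, (Real.exp (-(a * (t - r))) : ℂ) * n r

section

variable {a T : ℝ} {n : ℝ → ℂ}

lemma intervalIntegrable_of_integrableOn (hn : IntegrableOn n (Icc 0 T)) {t : ℝ}
    (ht : t ∈ Icc 0 T) : IntervalIntegrable n volume 0 t :=
  (intervalIntegrable_iff_integrableOn_Icc_of_le ht.1).2
    (hn.mono_set (Icc_subset_Icc le_rfl ht.2))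

lemma intervalIntegrable_exp_mul (hn : IntegrableOn n (Icc 0 T)) {t : ℝ} (ht : t ∈ Icc 0 T) :
    IntervalIntegrable (fun r => (Real.exp (-(a * (t - r))) : ℂ) * n r) volume 0 t := by
  have h1 : IntervalIntegrable n volume 0 t :=
    intervalIntegrable_of_integrableOn hn ht
  exact h1.continuousOn_mul (Continuous.continuousOn (by fun_prop))

lemma continuousOn_duhamel (hn : IntegrableOn n (Icc 0 T)) :
    ContinuousOn (duhamel a n) (Icc 0 T) := by
  have e : ∀ t, duhamel a n t =
      (Real.exp (-(a * t)) : ℂ) * ∫ r in (0 : ℝ)..t, (Real.exp (a * r) : ℂ) * n r := by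
    intro t
    rw [duhamel, ← intervalIntegral.integral_const_mul]
    congr 1; ext r
    rw [← mul_assoc, ← Complex.ofReal_mul, ← Real.exp_add]
    congr 3; ring
  rcases lt_or_ge T 0 with hT | hT
  · rw [Icc_eq_empty (not_le.2 hT)]; exact continuousOn_empty _
  have h1 : IntegrableOn (fun r => (Real.exp (a * r) : ℂ) * n r) (uIcc 0 T) := by
    rw [uIcc_of_le hT]
    exact hn.continuousOn_mul (Continuous.continuousOn (by fun_prop)) isCompact_Icc
  have h2 := intervalIntegral.continuousOn_primitive_interval h1
  rw [uIcc_of_le hT] at h2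
  have h3 : ContinuousOn (fun t : ℝ => (Real.exp (-(a * t)) : ℂ)) (Icc 0 T) :=
    Continuous.continuousOn (by fun_prop)
  exact (h3.mul h2).congr fun t _ => e t

lemma integral_exp_kernel (r t : ℝ) :
    ∫ ρ in r..t, a * Real.exp (-(a * (ρ - r))) = 1 - Real.exp (-(a * (t - r))) := by
  have h : ∀ ρ ∈ uIcc r t, HasDerivAt (fun ρ => -Real.exp (-(a * (ρ - r))))
      (a * Real.exp (-(a * (ρ - r)))) ρ := fun ρ _ => by
    have h1 : HasDerivAt (fun ρ => -(a * (ρ - r))) (-(a * 1)) ρ :=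
      (((hasDerivAt_id ρ).sub_const r).const_mul a).neg
    exact h1.exp.neg.congr_deriv (by ring)
  rw [intervalIntegral.integral_eq_sub_of_hasDerivAt h
    (Continuous.intervalIntegrable (by fun_prop) _ _)]
  rw [sub_self, mul_zero, neg_zero, Real.exp_zero]; ring

/-- Fubini's theorem for the Duhamel integral. -/
lemma integral_mul_duhamel (ha : 0 ≤ a) (hn : IntegrableOn n (Icc 0 T)) {t : ℝ}
    (ht : t ∈ Icc 0 T) :
    ∫ ρ in (0 : ℝ)..t, (a : ℂ) * duhamel a n ρ =
      (∫ r in (0 : ℝ)..t, n r) - duhamel a n t := by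
  set μ := volume.restrict (Ioc 0 t) with hμ
  have hn' : Integrable n μ := hn.mono_set fun x hx => ⟨hx.1.le, hx.2.trans ht.2⟩
  let g : ℝ → ℝ → ℂ := fun ρ r => if r ≤ ρ then ((a * Real.exp (-(a * (ρ - r))) : ℝ) : ℂ) else 0
  have hgm : Measurable (Function.uncurry g) :=
    Measurable.ite (measurableSet_le measurable_snd measurable_fst) (by fun_prop) measurable_const
  have hgb : ∀ z, ‖Function.uncurry g z‖ ≤ a := fun z => by
    simp only [Function.uncurry, g]
    split_ifs with hz
    · rw [Complex.norm_real, Real.norm_of_nonneg (mul_nonneg ha (Real.exp_pos _).le)]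
      refine mul_le_of_le_one_right ha (Real.exp_le_one_iff.2 ?_)
      have := mul_nonneg ha (sub_nonneg.2 hz)
      linarith
    · simpa using ha
  have hint : Integrable (Function.uncurry fun ρ r => g ρ r * n r) (μ.prod μ) :=
    (hn'.comp_snd μ).bdd_mul hgm.aestronglyMeasurable (.of_forall hgb)
  have hswap := integral_integral_swap hint
  have hL : ∫ ρ, ∫ r, g ρ r * n r ∂μ ∂μ = ∫ ρ in (0 : ℝ)..t, (a : ℂ) * duhamel a n ρ := by
    rw [intervalIntegral.integral_of_le ht.1]
    refine setIntegral_congr_fun measurableSet_Ioc fun ρ hρ => ?_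
    rw [duhamel, ← intervalIntegral.integral_const_mul, intervalIntegral.integral_of_le hρ.1.le]
    have e : (fun r => g ρ r * n r) = (Iic ρ).indicator fun r =>
        (a : ℂ) * ((Real.exp (-(a * (ρ - r))) : ℂ) * n r) := by
      ext r
      simp only [g, indicator, mem_Iic]
      split_ifs
      · push_cast; ring
      · simp
    rw [e, setIntegral_indicator measurableSet_Iic]
    congr 2
    ext r
    simp only [mem_inter_iff, mem_Ioc, mem_Iic]
    constructor
    · rintro ⟨⟨h1, _⟩, h3⟩; exact ⟨h1, h3⟩
    · rintro ⟨h1, h3⟩; exact ⟨⟨h1, h3.trans hρ.2⟩, h3⟩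
  have hR : ∫ r, ∫ ρ, g ρ r * n r ∂μ ∂μ =
      ∫ r in (0 : ℝ)..t, (n r - (Real.exp (-(a * (t - r))) : ℂ) * n r) := by
    rw [intervalIntegral.integral_of_le ht.1]
    refine setIntegral_congr_fun measurableSet_Ioc fun r hr => ?_
    rw [integral_mul_const]
    have e : (fun ρ => g ρ r) = (Ici r).indicator fun ρ =>
        ((a * Real.exp (-(a * (ρ - r))) : ℝ) : ℂ) := by
      ext ρ
      simp only [g, indicator, mem_Ici]
    rw [e, setIntegral_indicator measurableSet_Ici]
    have e2 : Ioc 0 t ∩ Ici r = Icc r t := by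
      ext ρ
      simp only [mem_inter_iff, mem_Ioc, mem_Ici, mem_Icc]
      constructor
      · rintro ⟨⟨_, h2⟩, h3⟩; exact ⟨h3, h2⟩
      · rintro ⟨h3, h2⟩; exact ⟨⟨hr.1.trans_le h3, h2⟩, h3⟩
    rw [e2, integral_Icc_eq_integral_Ioc, ← intervalIntegral.integral_of_le hr.2,
      intervalIntegral.integral_ofReal, integral_exp_kernel]
    push_cast; ring
  rw [← hL, hswap, hR, intervalIntegral.integral_sub _ (intervalIntegrable_exp_mul hn ht)]
  · rfl
  · exact intervalIntegrable_of_integrableOn hn ht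

/-- Variation of constants: the integrated equation `y = y₀ + ∫ (-ay + n)` with integrable `n` is
equivalent to Duhamel's formula. -/
lemma integral_equation_iff (ha : 0 ≤ a) (hn : IntegrableOn n (Icc 0 T)) {y : ℝ → ℂ}
    (hy : ContinuousOn y (Icc 0 T)) (y₀ : ℂ) :
    (∀ t ∈ Icc 0 T, y t = y₀ + ∫ r in (0 : ℝ)..t, (-(a : ℂ) * y r + n r)) ↔
      ∀ t ∈ Icc 0 T, y t = (Real.exp (-(a * t)) : ℂ) * y₀ + duhamel a n t := by
  set z : ℝ → ℂ := fun t => (Real.exp (-(a * t)) : ℂ) * y₀ + duhamel a n t with hz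
  have hexp : ContinuousOn (fun t : ℝ => (Real.exp (-(a * t)) : ℂ) * y₀) (Icc 0 T) :=
    Continuous.continuousOn (by fun_prop)
  have hzc : ContinuousOn z (Icc 0 T) := hexp.add (continuousOn_duhamel hn)
  have hnI : ∀ t ∈ Icc 0 T, IntervalIntegrable n volume 0 t := fun t ht =>
    intervalIntegrable_of_integrableOn hn ht
  have hcI : ∀ {w : ℝ → ℂ}, ContinuousOn w (Icc 0 T) → ∀ t ∈ Icc 0 T,
      IntervalIntegrable w volume 0 t := fun hw t ht =>
    (hw.mono (Icc_subset_Icc le_rfl ht.2)).intervalIntegrable_of_Icc ht.1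
  have hzeq : ∀ t ∈ Icc 0 T, z t = y₀ + ∫ r in (0 : ℝ)..t, (-(a : ℂ) * z r + n r) := by
    intro t ht
    have h1 : ∫ r in (0 : ℝ)..t, (-(a : ℂ) * z r + n r) =
        -(∫ r in (0 : ℝ)..t, (a : ℂ) * ((Real.exp (-(a * r)) : ℂ) * y₀))
        - (∫ r in (0 : ℝ)..t, (a : ℂ) * duhamel a n r) + ∫ r in (0 : ℝ)..t, n r := by
      rw [← intervalIntegral.integral_neg, ← intervalIntegral.integral_sub,
        ← intervalIntegral.integral_add]
      · congr 1; ext r; simp only [hz]; ring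
      · exact ((hcI hexp t ht).const_mul _).neg.sub
          ((hcI (continuousOn_duhamel hn) t ht).const_mul _)
      · exact hnI t ht
      · exact ((hcI hexp t ht).const_mul _).neg
      · exact (hcI (continuousOn_duhamel hn) t ht).const_mul _
    have h2 : ∫ r in (0 : ℝ)..t, (a : ℂ) * ((Real.exp (-(a * r)) : ℂ) * y₀) =
        (1 - (Real.exp (-(a * t)) : ℂ)) * y₀ := by
      have h3 := integral_exp_kernel (a := a) 0 t
      simp only [sub_zero] at h3
      have h4 : ∀ r : ℝ, (a : ℂ) * ((Real.exp (-(a * r)) : ℂ) * y₀) =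
          ((a * Real.exp (-(a * r)) : ℝ) : ℂ) * y₀ := fun r => by push_cast; ring
      simp only [h4]
      rw [intervalIntegral.integral_mul_const, intervalIntegral.integral_ofReal, h3]
      push_cast; ring
    rw [h1, h2, integral_mul_duhamel ha hn ht]
    simp only [hz]
    ring
  constructor
  · intro h
    have hd : ∀ t ∈ Icc 0 T, ‖y t - z t‖ = 0 := by
      refine eq_zero_of_le_integral (L := a) ((hy.sub hzc).norm) (fun _ _ => norm_nonneg _) ?_
      intro t ht
      have h1 : y t - z t = ∫ r in (0 : ℝ)..t, -(a : ℂ) * (y r - z r) := by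
        rw [h t ht, hzeq t ht, add_sub_add_left_eq_sub, ← intervalIntegral.integral_sub]
        · congr 1; ext r; ring
        · exact ((hcI hy t ht).const_mul _).add (hnI t ht)
        · exact ((hcI hzc t ht).const_mul _).add (hnI t ht)
      rw [h1, intervalIntegral.integral_const_mul, norm_mul, norm_neg, Complex.norm_real,
        Real.norm_of_nonneg ha]
      gcongr
      exact intervalIntegral.norm_integral_le_integral_norm ht.1
    intro t ht
    exact sub_eq_zero.1 (norm_eq_zero.1 (hd t ht))
  · intro h t ht
    rw [h t ht]
    change z t = _
    rw [hzeq t ht]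
    congr 1
    refine intervalIntegral.integral_congr fun r hr => ?_
    rw [uIcc_of_le ht.1] at hr
    rw [h r ⟨hr.1, hr.2.trans ht.2⟩]

/-- The heat kernel `e^{-ax}` of a single mode for times `x ∈ [0, 1]`, extended by zero. The cutoff
makes the mass finite for the mode `a = 0` too, and suffices on time intervals of length at most
one. -/
def heatKer (a : ℝ) (x : ℝ) : ℝ≥0∞ :=
  (Icc 0 1).indicator (fun x => ENNReal.ofReal (Real.exp (-(a * x)))) x

lemma measurable_heatKer : Measurable (heatKer a) :=
  Measurable.indicator (by fun_prop) measurableSet_Icc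

lemma heatKer_le_one (ha : 0 ≤ a) (x : ℝ) : heatKer a x ≤ 1 := by
  unfold heatKer indicator
  split_ifs with h
  · refine ENNReal.ofReal_le_one.2 (Real.exp_le_one_iff.2 ?_)
    have := mul_nonneg ha h.1
    linarith
  · exact zero_le_one

lemma enorm_duhamel_le (hT : T ≤ 1) {t : ℝ} (ht : t ∈ Icc 0 T) :
    ‖duhamel a n t‖ₑ ≤ ∫⁻ r in Icc 0 T, heatKer a (t - r) * ‖n r‖ₑ := by
  rw [duhamel, intervalIntegral.integral_of_le ht.1]
  refine (enorm_integral_le_lintegral_enorm _).trans ?_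
  calc ∫⁻ r in Ioc 0 t, ‖(Real.exp (-(a * (t - r))) : ℂ) * n r‖ₑ
      = ∫⁻ r in Ioc 0 t, heatKer a (t - r) * ‖n r‖ₑ := by
        refine setLIntegral_congr_fun measurableSet_Ioc fun r hr => ?_
        have h1 : t - r ∈ Icc (0 : ℝ) 1 := ⟨by linarith [hr.2], by linarith [hr.1, ht.2]⟩
        rw [enorm_mul, heatKer, indicator_of_mem h1, ← ofReal_norm, Complex.norm_real,
          Real.norm_of_nonneg (Real.exp_pos _).le]
    _ ≤ _ := lintegral_mono_set
        (Ioc_subset_Icc_self.trans (Icc_subset_Icc le_rfl ht.2))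

lemma enorm_duhamel_sq_le (hT : T ≤ 1) (hn : IntegrableOn n (Icc 0 T)) {t : ℝ}
    (ht : t ∈ Icc 0 T) : ‖duhamel a n t‖ₑ ^ 2 ≤
      (∫⁻ r in Icc 0 T, heatKer a (t - r)) * ∫⁻ r in Icc 0 T, heatKer a (t - r) * ‖n r‖ₑ ^ 2 := by
  refine le_trans (by gcongr; exact enorm_duhamel_le hT ht) (lintegral_mul_sq_le ?_ hn.1.enorm)
  exact (measurable_heatKer.comp (by fun_prop)).aemeasurable

/-- The Duhamel integral is bounded by the `L²` norm of the forcing. -/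
lemma enorm_duhamel_sq_le_mul (ha : 0 ≤ a) (hT : T ≤ 1) (hn : IntegrableOn n (Icc 0 T)) {t : ℝ}
    (ht : t ∈ Icc 0 T) :
    ‖duhamel a n t‖ₑ ^ 2 ≤ ENNReal.ofReal T * ∫⁻ r in Icc 0 T, ‖n r‖ₑ ^ 2 := by
  refine (enorm_duhamel_sq_le hT hn ht).trans (mul_le_mul' ?_ ?_)
  · calc ∫⁻ r in Icc 0 T, heatKer a (t - r) ≤ ∫⁻ _r in Icc 0 T, 1 :=
          lintegral_mono fun r => heatKer_le_one ha _
      _ = _ := by simp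
  · exact lintegral_mono fun r => mul_le_of_le_one_left' (heatKer_le_one ha _)

lemma lintegral_heatKer_sub_left_le (t : ℝ) :
    ∫⁻ r in Icc 0 T, heatKer a (t - r) ≤ ∫⁻ x, heatKer a x :=
  (setLIntegral_le_lintegral _ _).trans (lintegral_sub_left_eq_self (heatKer a) t).le

lemma enorm_duhamel_sq_le_heatKer (ha : 0 ≤ a) (hT : T ≤ 1) (hn : IntegrableOn n (Icc 0 T)) {t : ℝ}
    (ht : t ∈ Icc 0 T) :
    ‖duhamel a n t‖ₑ ^ 2 ≤ (∫⁻ x, heatKer a x) * ∫⁻ r in Icc 0 T, ‖n r‖ₑ ^ 2 := by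
  refine (enorm_duhamel_sq_le hT hn ht).trans
    (mul_le_mul' (lintegral_heatKer_sub_left_le t) ?_)
  exact lintegral_mono fun r => mul_le_of_le_one_left' (heatKer_le_one ha _)

lemma lintegral_enorm_duhamel_sq_le (hT : T ≤ 1) (hn : IntegrableOn n (Icc 0 T)) :
    ∫⁻ t in Icc 0 T, ‖duhamel a n t‖ₑ ^ 2 ≤
      (∫⁻ x, heatKer a x) ^ 2 * ∫⁻ r in Icc 0 T, ‖n r‖ₑ ^ 2 := by
  calc ∫⁻ t in Icc 0 T, ‖duhamel a n t‖ₑ ^ 2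
      ≤ ∫⁻ t in Icc 0 T, (∫⁻ x, heatKer a x) *
          ∫⁻ r in Icc 0 T, heatKer a (t - r) * ‖n r‖ₑ ^ 2 := by
        refine setLIntegral_mono' measurableSet_Icc fun t ht => ?_
        refine (enorm_duhamel_sq_le hT hn ht).trans ?_
        exact mul_le_mul' (lintegral_heatKer_sub_left_le t) le_rfl
    _ = (∫⁻ x, heatKer a x) *
          ∫⁻ r in Icc 0 T, ∫⁻ t in Icc 0 T, heatKer a (t - r) * ‖n r‖ₑ ^ 2 := by
        have hm : AEMeasurable (Function.uncurry fun t r => heatKer a (t - r) * ‖n r‖ₑ ^ 2)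
            ((volume.restrict (Icc 0 T)).prod (volume.restrict (Icc 0 T))) := by
          refine AEMeasurable.mul ?_ ?_
          · exact (measurable_heatKer.comp (by fun_prop)).aemeasurable
          · exact ((hn.1.enorm.pow_const 2).comp_snd)
        rw [lintegral_const_mul'', lintegral_lintegral_swap hm]
        exact hm.lintegral_prod_right'
    _ ≤ (∫⁻ x, heatKer a x) * ∫⁻ r in Icc 0 T, (∫⁻ x, heatKer a x) * ‖n r‖ₑ ^ 2 := by
        gcongr with r
        have hm : Measurable fun t => heatKer a (t - r) :=
          measurable_heatKer.comp (measurable_id.sub_const r)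
        rw [lintegral_mul_const _ hm]
        refine mul_le_mul' ?_ le_rfl
        exact (setLIntegral_le_lintegral _ _).trans (lintegral_sub_right_eq_self (heatKer a) r).le
    _ = _ := by
        rw [lintegral_const_mul'' _ (hn.1.enorm.pow_const 2), sq, mul_assoc]

end

/-- The heat kernel of the mode `k` has mass `O(⟨k⟩^{-2})`. -/
lemma lintegral_heatKer_le {ν : ℝ} (hν : 0 < ν) (k : Fin d → ℤ) :
    ∫⁻ x, heatKer (ν * freqSq k) x ≤ ENNReal.ofReal (Real.exp ν / ν) * wt (-2) k := by
  set b := ν * jap k ^ 2 with hb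
  have hb0 : 0 < b := mul_pos hν (pow_pos (jap_pos k) 2)
  have h1 : ∀ x ∈ Icc (0 : ℝ) 1, ENNReal.ofReal (Real.exp (-(ν * freqSq k * x))) ≤
      ENNReal.ofReal (Real.exp ν / b * (b * Real.exp (-(b * (x - 0))))) := by
    intro x hx
    refine ENNReal.ofReal_le_ofReal ?_
    have e : Real.exp ν / b * (b * Real.exp (-(b * (x - 0)))) = Real.exp (ν + -(b * x)) := by
      rw [Real.exp_add, sub_zero]; field_simp
    rw [e]
    refine Real.exp_le_exp.2 ?_
    rw [hb, jap_sq]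
    nlinarith [mul_le_mul_of_nonneg_left hx.2 hν.le]
  calc ∫⁻ x, heatKer (ν * freqSq k) x
      = ∫⁻ x in Icc 0 1, ENNReal.ofReal (Real.exp (-(ν * freqSq k * x))) :=
        lintegral_indicator measurableSet_Icc _
    _ ≤ ∫⁻ x in Icc 0 1, ENNReal.ofReal (Real.exp ν / b * (b * Real.exp (-(b * (x - 0))))) :=
        setLIntegral_mono' measurableSet_Icc h1
    _ = ENNReal.ofReal (∫ x in Icc 0 1, Real.exp ν / b * (b * Real.exp (-(b * (x - 0))))) := by
        rw [ofReal_integral_eq_lintegral_ofReal]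
        · exact (Continuous.continuousOn (by fun_prop)).integrableOn_Icc
        · exact .of_forall fun x => by positivity
    _ ≤ ENNReal.ofReal (Real.exp ν / b) := by
        refine ENNReal.ofReal_le_ofReal ?_
        rw [integral_Icc_eq_integral_Ioc, ← intervalIntegral.integral_of_le zero_le_one,
          intervalIntegral.integral_const_mul, integral_exp_kernel]
        refine mul_le_of_le_one_right (by positivity) ?_
        linarith [Real.exp_pos (-(b * (1 - 0)))]
    _ = _ := by
        rw [wt, ← ENNReal.ofReal_mul (by positivity), hb]
        congr 1
        rw [Real.rpow_neg (jap_pos k).le, Real.rpow_two]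
        field_simp

/-! ### The linear heat equation -/

lemma enorm_coeff_le (v : L2 d) (k : Fin d → ℤ) :
    ‖coeff v k‖ₑ ≤ (ENNReal.ofReal (volSqrt d))⁻¹ * ‖v‖ₑ := by
  have h0 : ENNReal.ofReal (volSqrt d) ≠ 0 := by simpa using volSqrt_pos
  rw [enorm_eq_wNorm, ← mul_assoc, ENNReal.inv_mul_cancel h0 ENNReal.ofReal_ne_top, one_mul]
  exact enorm_coeff_le_wNorm le_rfl _ k

lemma continuous_coeff (k : Fin d → ℤ) : Continuous fun v : L2 d => coeff v k := by
  have hK : (ENNReal.ofReal (volSqrt d))⁻¹ ≠ ⊤ := by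
    simpa using volSqrt_pos
  refine LipschitzWith.continuous (K := ((ENNReal.ofReal (volSqrt d))⁻¹).toNNReal) fun v w => ?_
  rw [ENNReal.coe_toNNReal hK, edist_eq_enorm_sub, edist_eq_enorm_sub, ← coeff_Lp_sub]
  exact enorm_coeff_le _ k

/-- `F ∈ L²([0,T], H^σ)`, in terms of Fourier coefficients. -/
def ForcingClass (σ T : ℝ) (F : ℝ → L2 d) : Prop :=
  AEStronglyMeasurable F (volume.restrict (Icc 0 T)) ∧
    (∫⁻ t in Icc 0 T, wNorm σ (coeff (F t)) ^ 2) < ⊤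

lemma memL2H_iff {σ T : ℝ} {F : ℝ → L2 d} : MemL2H σ T F ↔ ForcingClass σ T F := by
  simp only [MemL2H, ForcingClass, sobNorm_eq_wNorm]

lemma add_sq_le_four_mul (x y : ℝ≥0∞) : (x + y) ^ 2 ≤ 4 * (x ^ 2 + y ^ 2) := by
  have h : ∀ z : ℝ≥0∞, (z + z) ^ 2 = 4 * z ^ 2 := fun z => by ring
  rcases le_total x y with hxy | hxy
  · calc (x + y) ^ 2 ≤ (y + y) ^ 2 := by gcongr
      _ = 4 * y ^ 2 := h y
      _ ≤ _ := by gcongr; exact le_add_self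
  · calc (x + y) ^ 2 ≤ (x + x) ^ 2 := by gcongr
      _ = 4 * x ^ 2 := h x
      _ ≤ _ := by gcongr; exact le_self_add

namespace ForcingClass

variable {σ T : ℝ} {F G : ℝ → L2 d}

lemma mono_time (hF : ForcingClass σ T F) {T' : ℝ} (h : T' ≤ T) : ForcingClass σ T' F :=
  ⟨hF.1.mono_measure (Measure.restrict_mono (Icc_subset_Icc le_rfl h) le_rfl),
    (lintegral_mono_set (Icc_subset_Icc le_rfl h)).trans_lt hF.2⟩

lemma mono_exponent (hF : ForcingClass σ T F) {τ : ℝ} (h : τ ≤ σ) : ForcingClass τ T F :=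
  ⟨hF.1, (lintegral_mono fun t => by gcongr; exact wNorm_mono h _).trans_lt hF.2⟩

lemma aemeasurable_coeff (hF : ForcingClass σ T F) (k : Fin d → ℤ) :
    AEStronglyMeasurable (fun r => coeff (F r) k) (volume.restrict (Icc 0 T)) :=
  (continuous_coeff k).comp_aestronglyMeasurable hF.1

lemma tsum_lintegral (hF : ForcingClass σ T F) (τ : ℝ) :
    ∑' k, wt τ k ^ 2 * ∫⁻ r in Icc 0 T, ‖coeff (F r) k‖ₑ ^ 2 =
      ∫⁻ r in Icc 0 T, wNorm τ (coeff (F r)) ^ 2 := by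
  simp only [wNorm_sq]
  rw [lintegral_tsum]
  · refine tsum_congr fun k => ?_
    rw [lintegral_const_mul'' _ ((hF.aemeasurable_coeff k).enorm.pow_const 2)]
  · exact fun k => ((hF.aemeasurable_coeff k).enorm.pow_const 2).const_mul _

lemma integrableOn_coeff (hσ : 0 ≤ σ) (hF : ForcingClass σ T F) (k : Fin d → ℤ) :
    IntegrableOn (fun r => coeff (F r) k) (Icc 0 T) := by
  refine ⟨hF.aemeasurable_coeff k, ?_⟩
  rw [hasFiniteIntegral_iff_enorm]
  calc ∫⁻ r in Icc 0 T, ‖coeff (F r) k‖ₑ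
      ≤ ∫⁻ r in Icc 0 T, (1 + wNorm σ (coeff (F r)) ^ 2) := by
        refine lintegral_mono fun r => ?_
        rcases le_total (wNorm σ (coeff (F r))) 1 with h | h
        · exact (enorm_coeff_le_wNorm hσ _ k).trans (h.trans le_self_add)
        · exact (enorm_coeff_le_wNorm hσ _ k).trans
            ((le_self_pow₀ h two_ne_zero).trans le_add_self)
    _ < ⊤ := by
        rw [lintegral_add_left measurable_const]
        refine ENNReal.add_lt_top.2 ⟨?_, hF.2⟩
        simp

lemma add (hF : ForcingClass σ T F) (hG : ForcingClass σ T G) :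
    ForcingClass σ T fun t => F t + G t := by
  refine ⟨hF.1.add hG.1, ?_⟩
  have hm : ∀ {H : ℝ → L2 d}, ForcingClass σ T H →
      AEMeasurable (fun r => wNorm σ (coeff (H r)) ^ 2) (volume.restrict (Icc 0 T)) := by
    intro H hH
    simp only [wNorm_sq]
    exact AEMeasurable.tsum fun k =>
      ((hH.aemeasurable_coeff k).enorm.pow_const 2).const_mul _
  calc ∫⁻ t in Icc 0 T, wNorm σ (coeff (F t + G t : L2 d)) ^ 2
      ≤ ∫⁻ t in Icc 0 T, 4 * (wNorm σ (coeff (F t)) ^ 2 + wNorm σ (coeff (G t)) ^ 2) := by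
        refine lintegral_mono fun t => le_trans ?_ (add_sq_le_four_mul _ _)
        gcongr
        have e : coeff (F t + G t : L2 d) = fun k => coeff (F t) k + coeff (G t) k :=
          funext (coeff_Lp_add _ _)
        rw [e]
        exact wNorm_add_le _ _ _
    _ < ⊤ := by
        rw [lintegral_const_mul' _ _ (by simp), lintegral_add_left' (hm hF)]
        exact ENNReal.mul_lt_top (by simp) (ENNReal.add_lt_top.2 ⟨hF.2, hG.2⟩)

lemma of_continuousOn (hF : ContinuousOn F (Icc 0 T)) {B : ℝ≥0∞} (hB : B < ⊤)
    (h : ∀ t ∈ Icc 0 T, wNorm σ (coeff (F t)) ≤ B) : ForcingClass σ T F := by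
  refine ⟨hF.aestronglyMeasurable measurableSet_Icc, ?_⟩
  calc ∫⁻ t in Icc 0 T, wNorm σ (coeff (F t)) ^ 2 ≤ ∫⁻ _t in Icc 0 T, B ^ 2 :=
        setLIntegral_mono' measurableSet_Icc fun t ht => by gcongr; exact h t ht
    _ < ⊤ := by
        simp only [lintegral_const, Measure.restrict_apply_univ, Real.volume_Icc]
        exact ENNReal.mul_lt_top (ENNReal.pow_lt_top hB) ENNReal.ofReal_lt_top

end ForcingClass

/-- The Fourier coefficients of the Duhamel integral `∫₀ᵗ e^{ν(t-r)Δ} F(r) dr`. -/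
def duhamelCoeff (ν : ℝ) (F : ℝ → L2 d) (t : ℝ) (k : Fin d → ℤ) : ℂ :=
  duhamel (ν * freqSq k) (fun r => coeff (F r) k) t

/-- The Fourier coefficients of the mild solution of `u' = νΔu + F`, `u(0) = u₀`. -/
def mildCoeff (ν : ℝ) (u₀ : L2 d) (F : ℝ → L2 d) (t : ℝ) (k : Fin d → ℤ) : ℂ :=
  (Real.exp (-(ν * freqSq k * t)) : ℂ) * coeff u₀ k + duhamelCoeff ν F t k

/-- A constant `C` with `∫₀¹ e^{-ν|k|²x} dx ≤ C ⟨k⟩^{-2}` for all frequencies `k`. -/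
def heatConst (ν : ℝ) : ℝ≥0∞ := ENNReal.ofReal (Real.exp ν / ν)

section

variable {ν σ T : ℝ} {F : ℝ → L2 d}

lemma nonneg_mul_freqSq (hν : 0 < ν) (k : Fin d → ℤ) : 0 ≤ ν * freqSq k :=
  mul_nonneg hν.le (freqSq_nonneg k)

/-- The Duhamel integral is bounded in `H^τ` by the `L²(H^τ)` norm of the forcing, with a factor
small for short times. -/
lemma wNorm_duhamelCoeff_sq_le (hν : 0 < ν) (hσ : 0 ≤ σ) (hT : T ≤ 1) (hF : ForcingClass σ T F)
    {t : ℝ} (ht : t ∈ Icc 0 T) (τ : ℝ) :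
    wNorm τ (duhamelCoeff ν F t) ^ 2 ≤
      ENNReal.ofReal T * ∫⁻ r in Icc 0 T, wNorm τ (coeff (F r)) ^ 2 := by
  rw [wNorm_sq, ← hF.tsum_lintegral, ← ENNReal.tsum_mul_left]
  refine ENNReal.tsum_le_tsum fun k => ?_
  rw [mul_left_comm]
  gcongr
  exact enorm_duhamel_sq_le_mul (nonneg_mul_freqSq hν k) hT (hF.integrableOn_coeff hσ k) ht

lemma enorm_duhamelCoeff_sq_le (hν : 0 < ν) (hσ : 0 ≤ σ) (hT : T ≤ 1) (hF : ForcingClass σ T F)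
    {t : ℝ} (ht : t ∈ Icc 0 T) (k : Fin d → ℤ) :
    ‖duhamelCoeff ν F t k‖ₑ ^ 2 ≤
      heatConst ν * (wt (-2) k * ∫⁻ r in Icc 0 T, ‖coeff (F r) k‖ₑ ^ 2) := by
  rw [← mul_assoc]
  refine (enorm_duhamel_sq_le_heatKer (nonneg_mul_freqSq hν k) hT
    (hF.integrableOn_coeff hσ k) ht).trans ?_
  gcongr
  exact lintegral_heatKer_le hν k

lemma wt_add_one_sq (τ : ℝ) (k : Fin d → ℤ) : wt (τ + 1) k ^ 2 * wt (-2) k = wt τ k ^ 2 := by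
  rw [sq, sq, ← wt_add, ← wt_add, ← wt_add]
  congr 1; ring

/-- The Duhamel integral gains one derivative, uniformly in time. -/
lemma wNorm_add_one_duhamelCoeff_sq_le (hν : 0 < ν) (hσ : 0 ≤ σ) (hT : T ≤ 1)
    (hF : ForcingClass σ T F) {t : ℝ} (ht : t ∈ Icc 0 T) :
    wNorm (σ + 1) (duhamelCoeff ν F t) ^ 2 ≤
      heatConst ν * ∫⁻ r in Icc 0 T, wNorm σ (coeff (F r)) ^ 2 := by
  rw [wNorm_sq, ← hF.tsum_lintegral, ← ENNReal.tsum_mul_left]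
  refine ENNReal.tsum_le_tsum fun k => ?_
  calc _ ≤ wt (σ + 1) k ^ 2 *
        (heatConst ν * (wt (-2) k * ∫⁻ r in Icc 0 T, ‖coeff (F r) k‖ₑ ^ 2)) := by
        gcongr; exact enorm_duhamelCoeff_sq_le hν hσ hT hF ht k
    _ = heatConst ν * ((wt (σ + 1) k ^ 2 * wt (-2) k) * ∫⁻ r in Icc 0 T, ‖coeff (F r) k‖ₑ ^ 2) := by
        ring
    _ = _ := by rw [wt_add_one_sq]

lemma continuousOn_duhamelCoeff (hσ : 0 ≤ σ) (hF : ForcingClass σ T F) (k : Fin d → ℤ) :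
    ContinuousOn (fun t => duhamelCoeff ν F t k) (Icc 0 T) :=
  continuousOn_duhamel (hF.integrableOn_coeff hσ k)

/-- The Duhamel integral gains two derivatives in the mean square over time. -/
lemma lintegral_wNorm_duhamelCoeff_sq_le (hν : 0 < ν) (hσ : 0 ≤ σ) (hT : T ≤ 1)
    (hF : ForcingClass σ T F) :
    ∫⁻ t in Icc 0 T, wNorm (σ + 2) (duhamelCoeff ν F t) ^ 2 ≤
      heatConst ν ^ 2 * ∫⁻ r in Icc 0 T, wNorm σ (coeff (F r)) ^ 2 := by
  have hm : ∀ k, AEMeasurable (fun t => ‖duhamelCoeff ν F t k‖ₑ ^ 2)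
      (volume.restrict (Icc 0 T)) := fun k =>
    (((continuousOn_duhamelCoeff hσ hF k).aestronglyMeasurable measurableSet_Icc).enorm).pow_const 2
  simp only [wNorm_sq (σ + 2)]
  rw [lintegral_tsum fun k => (hm k).const_mul _, ← hF.tsum_lintegral, ← ENNReal.tsum_mul_left]
  refine ENNReal.tsum_le_tsum fun k => ?_
  rw [lintegral_const_mul'' _ (hm k)]
  have e : wt (σ + 2) k ^ 2 * wt (-2) k ^ 2 = wt σ k ^ 2 := by
    rw [← mul_pow, ← wt_add]; congr 2; ring
  calc _ ≤ wt (σ + 2) k ^ 2 *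
        ((heatConst ν * wt (-2) k) ^ 2 * ∫⁻ r in Icc 0 T, ‖coeff (F r) k‖ₑ ^ 2) := by
        gcongr
        refine (lintegral_enorm_duhamel_sq_le hT (hF.integrableOn_coeff hσ k)).trans ?_
        gcongr
        exact lintegral_heatKer_le hν k
    _ = heatConst ν ^ 2 *
        ((wt (σ + 2) k ^ 2 * wt (-2) k ^ 2) * ∫⁻ r in Icc 0 T, ‖coeff (F r) k‖ₑ ^ 2) := by ring
    _ = _ := by rw [e]

/-- A dominated convergence criterion for continuity with values in `H^τ`. -/
lemma tendsto_wNorm_sub {τ : ℝ} {c : ℝ → (Fin d → ℤ) → ℂ} {b : (Fin d → ℤ) → ℝ≥0∞} {S : Set ℝ}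
    (hc : ∀ k, ContinuousOn (fun t => c t k) S) (hb : ∀ t ∈ S, ∀ k, ‖c t k‖ₑ ^ 2 ≤ b k)
    (hsum : ∑' k, wt τ k ^ 2 * b k < ⊤) {t : ℝ} (ht : t ∈ S) :
    Tendsto (fun r => wNorm τ (fun k => c r k - c t k)) (𝓝[S] t) (𝓝 0) := by
  let _ : MeasurableSpace (Fin d → ℤ) := ⊤
  have h1 : Tendsto (fun r => ∑' k, wt τ k ^ 2 * ‖c r k - c t k‖ₑ ^ 2) (𝓝[S] t) (𝓝 0) := by
    simp only [← lintegral_count]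
    have h2 := tendsto_lintegral_filter_of_dominated_convergence (μ := Measure.count)
      (l := 𝓝[S] t) (F := fun r k => wt τ k ^ 2 * ‖c r k - c t k‖ₑ ^ 2) (f := fun _ => 0)
      (fun k => 4 * (wt τ k ^ 2 * b k + wt τ k ^ 2 * b k))
      (.of_forall fun r => measurable_of_countable _) ?_ ?_ ?_
    · simpa using h2
    · filter_upwards [self_mem_nhdsWithin] with r hr
      refine .of_forall fun k => ?_
      calc wt τ k ^ 2 * ‖c r k - c t k‖ₑ ^ 2
          ≤ wt τ k ^ 2 * (4 * (‖c r k‖ₑ ^ 2 + ‖c t k‖ₑ ^ 2)) := by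
            gcongr
            refine le_trans ?_ (add_sq_le_four_mul _ _)
            gcongr
            exact enorm_sub_le
        _ ≤ wt τ k ^ 2 * (4 * (b k + b k)) := by
            gcongr
            · exact hb r hr k
            · exact hb t ht k
        _ = _ := by ring
    · rw [lintegral_count, ENNReal.tsum_mul_left, ENNReal.tsum_add]
      exact (ENNReal.mul_lt_top (by simp) (ENNReal.add_lt_top.2 ⟨hsum, hsum⟩)).ne
    · refine .of_forall fun k => ?_
      have h3 : Tendsto (fun r => c r k - c t k) (𝓝[S] t) (𝓝 0) := by
        have h4 : Tendsto (fun r => c r k) (𝓝[S] t) (𝓝 (c t k)) := hc k t ht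
        simpa using h4.sub_const (c t k)
      have h4 := ((continuous_enorm.tendsto _).comp h3)
      rw [enorm_zero] at h4
      have h5 := ((ENNReal.continuous_pow 2).tendsto _).comp h4
      have h6 := ENNReal.Tendsto.const_mul h5
        (Or.inr (ENNReal.pow_ne_top (wt_ne_top τ k) (n := 2)))
      simpa [Function.comp_def] using h6
  have h7 := h1.ennrpow_const (1 / 2 : ℝ)
  rw [ENNReal.zero_rpow_of_pos (by norm_num)] at h7
  refine h7.congr fun r => ?_
  rw [wNorm, l2]
  simp only [mul_pow]

lemma enorm_exp_le_one (hν : 0 < ν) (k : Fin d → ℤ) {t : ℝ} (ht : 0 ≤ t) :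
    ‖(Real.exp (-(ν * freqSq k * t)) : ℂ)‖ₑ ≤ 1 := by
  rw [← ofReal_norm, Complex.norm_real, Real.norm_of_nonneg (Real.exp_pos _).le]
  refine ENNReal.ofReal_le_one.2 (Real.exp_le_one_iff.2 ?_)
  have := mul_nonneg (nonneg_mul_freqSq hν k) ht
  linarith

lemma wNorm_heat_le (hν : 0 < ν) (τ : ℝ) (u₀ : L2 d) {t : ℝ} (ht : 0 ≤ t) :
    wNorm τ (fun k => (Real.exp (-(ν * freqSq k * t)) : ℂ) * coeff u₀ k) ≤ wNorm τ (coeff u₀) :=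
  wNorm_mono_coeff fun k => by
    rw [enorm_mul]; exact mul_le_of_le_one_left' (enorm_exp_le_one hν k ht)

lemma continuousOn_mildCoeff (hσ : 0 ≤ σ) (hF : ForcingClass σ T F) (u₀ : L2 d) (k : Fin d → ℤ) :
    ContinuousOn (fun t => mildCoeff ν u₀ F t k) (Icc 0 T) := by
  refine ContinuousOn.add (Continuous.continuousOn (by fun_prop)) ?_
  exact continuousOn_duhamelCoeff hσ hF k

/-- The mild solution is continuous in time with values in `H^{σ+1}`. -/
lemma tendsto_wNorm_mildCoeff_sub (hν : 0 < ν) (hσ : 0 ≤ σ) (hT : T ≤ 1)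
    (hF : ForcingClass σ T F) {u₀ : L2 d} (hu₀ : wNorm (σ + 1) (coeff u₀) < ⊤) {t : ℝ}
    (ht : t ∈ Icc 0 T) :
    Tendsto (fun r => wNorm (σ + 1) (fun k => mildCoeff ν u₀ F r k - mildCoeff ν u₀ F t k))
      (𝓝[Icc 0 T] t) (𝓝 0) := by
  refine tendsto_wNorm_sub (b := fun k => 4 * (‖coeff u₀ k‖ₑ ^ 2 +
    heatConst ν * (wt (-2) k * ∫⁻ r in Icc 0 T, ‖coeff (F r) k‖ₑ ^ 2)))
    (continuousOn_mildCoeff hσ hF u₀) ?_ ?_ ht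
  · intro r hr k
    refine le_trans ?_ ((add_sq_le_four_mul _ _).trans (mul_le_mul_right (add_le_add le_rfl
      (enorm_duhamelCoeff_sq_le hν hσ hT hF hr k)) 4))
    gcongr
    refine (enorm_add_le _ _).trans (add_le_add ?_ le_rfl)
    rw [enorm_mul]
    exact mul_le_of_le_one_left' (enorm_exp_le_one hν k hr.1)
  · have e : ∀ k : Fin d → ℤ, wt (σ + 1) k ^ 2 * (4 * (‖coeff u₀ k‖ₑ ^ 2 +
        heatConst ν * (wt (-2) k * ∫⁻ r in Icc 0 T, ‖coeff (F r) k‖ₑ ^ 2))) =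
        4 * (wt (σ + 1) k ^ 2 * ‖coeff u₀ k‖ₑ ^ 2 +
          heatConst ν * (wt σ k ^ 2 * ∫⁻ r in Icc 0 T, ‖coeff (F r) k‖ₑ ^ 2)) := by
      intro k
      rw [← wt_add_one_sq σ k]; ring
    simp only [e]
    rw [ENNReal.tsum_mul_left, ENNReal.tsum_add, ENNReal.tsum_mul_left, ← wNorm_sq,
      hF.tsum_lintegral]
    exact ENNReal.mul_lt_top (by simp) (ENNReal.add_lt_top.2 ⟨ENNReal.pow_lt_top hu₀,
      ENNReal.mul_lt_top ENNReal.ofReal_lt_top hF.2⟩)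

lemma wNorm_mildCoeff_lt_top (hν : 0 < ν) (hσ : 0 ≤ σ) (hT : T ≤ 1)
    (hF : ForcingClass σ T F) {u₀ : L2 d} (hu₀ : wNorm (σ + 1) (coeff u₀) < ⊤) {t : ℝ}
    (ht : t ∈ Icc 0 T) : wNorm (σ + 1) (mildCoeff ν u₀ F t) < ⊤ := by
  refine (wNorm_add_le _ _ _).trans_lt (ENNReal.add_lt_top.2
    ⟨(wNorm_heat_le hν _ u₀ ht.1).trans_lt hu₀, ?_⟩)
  have h := (wNorm_add_one_duhamelCoeff_sq_le hν hσ hT hF ht).trans_lt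
    (ENNReal.mul_lt_top (by exact ENNReal.ofReal_lt_top) hF.2)
  exact (ENNReal.pow_lt_top_iff.1 h).resolve_right two_ne_zero

/-- The mild solution is square integrable in time with values in `H^{σ+2}`. -/
lemma lintegral_wNorm_mildCoeff_lt_top (hν : 0 < ν) (hσ : 0 ≤ σ) (hT : T ≤ 1)
    (hF : ForcingClass σ T F) {u₀ : L2 d} (hu₀ : wNorm (σ + 2) (coeff u₀) < ⊤) :
    ∫⁻ t in Icc 0 T, wNorm (σ + 2) (mildCoeff ν u₀ F t) ^ 2 < ⊤ := by
  calc ∫⁻ t in Icc 0 T, wNorm (σ + 2) (mildCoeff ν u₀ F t) ^ 2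
      ≤ ∫⁻ t in Icc 0 T, 4 * (wNorm (σ + 2) (coeff u₀) ^ 2 +
          wNorm (σ + 2) (duhamelCoeff ν F t) ^ 2) := by
        refine setLIntegral_mono' measurableSet_Icc fun t ht => ?_
        refine le_trans ?_ (add_sq_le_four_mul _ _)
        gcongr
        refine (wNorm_add_le _ _ _).trans (add_le_add (wNorm_heat_le hν _ u₀ ht.1) le_rfl)
    _ = 4 * (wNorm (σ + 2) (coeff u₀) ^ 2 * ENNReal.ofReal T +
          ∫⁻ t in Icc 0 T, wNorm (σ + 2) (duhamelCoeff ν F t) ^ 2) := by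
        rw [lintegral_const_mul' _ _ (by simp), lintegral_add_left measurable_const]
        simp
    _ < ⊤ := by
        refine ENNReal.mul_lt_top (by simp) (ENNReal.add_lt_top.2 ⟨?_, ?_⟩)
        · exact ENNReal.mul_lt_top (ENNReal.pow_lt_top hu₀) ENNReal.ofReal_lt_top
        · exact (lintegral_wNorm_duhamelCoeff_sq_le hν hσ hT hF).trans_lt
            (ENNReal.mul_lt_top (ENNReal.pow_lt_top ENNReal.ofReal_lt_top) hF.2)

lemma duhamel_conj (a : ℝ) (n : ℝ → ℂ) (t : ℝ) :
    duhamel a (fun r => conj (n r)) t = conj (duhamel a n t) := by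
  unfold duhamel
  rw [intervalIntegral, intervalIntegral, map_sub, ← integral_conj, ← integral_conj]
  simp only [map_mul, Complex.conj_ofReal]

lemma mildCoeff_neg_freq (u₀ : L2 d) (t : ℝ) (k : Fin d → ℤ) :
    mildCoeff ν u₀ F t (-k) = conj (mildCoeff ν u₀ F t k) := by
  unfold mildCoeff duhamelCoeff
  rw [freqSq_neg, coeff_neg_freq, map_add, map_mul, Complex.conj_ofReal, ← duhamel_conj]
  simp only [coeff_neg_freq]

lemma exists_coeff_eq_mildCoeff (hν : 0 < ν) (hT : T ≤ 1) (hF : ForcingClass 0 T F) (u₀ : L2 d)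
    {t : ℝ} (ht : t ∈ Icc 0 T) : ∃ v : L2 d, ∀ k, coeff v k = mildCoeff ν u₀ F t k := by
  refine exists_coeff_eq ?_ (mildCoeff_neg_freq u₀ t)
  refine (wNorm_add_le _ _ _).trans_lt (ENNReal.add_lt_top.2
    ⟨(wNorm_heat_le hν _ u₀ ht.1).trans_lt ?_, ?_⟩)
  · have h1 : ENNReal.ofReal (volSqrt d) * wNorm 0 (coeff u₀) < ⊤ := by
      rw [← enorm_eq_wNorm]; exact enorm_lt_top
    exact ENNReal.lt_top_of_mul_ne_top_right h1.ne (by simpa using volSqrt_pos)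
  · have h := (wNorm_duhamelCoeff_sq_le hν le_rfl hT hF ht 0).trans_lt
      (ENNReal.mul_lt_top ENNReal.ofReal_lt_top hF.2)
    exact (ENNReal.pow_lt_top_iff.1 h).resolve_right two_ne_zero

end

/-! ### Mild solutions with a Lipschitz nonlinearity -/

lemma wNorm_zero_eq (v : L2 d) : wNorm 0 (coeff v) = (ENNReal.ofReal (volSqrt d))⁻¹ * ‖v‖ₑ := by
  have h0 : ENNReal.ofReal (volSqrt d) ≠ 0 := by simpa using volSqrt_pos
  rw [enorm_eq_wNorm, ← mul_assoc, ENNReal.inv_mul_cancel h0 ENNReal.ofReal_ne_top, one_mul]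

lemma ForcingClass.of_continuousOn_L2 {T : ℝ} {F : ℝ → L2 d} (hF : ContinuousOn F (Icc 0 T)) :
    ForcingClass 0 T F := by
  obtain ⟨C, hC⟩ := isCompact_Icc.exists_bound_of_continuousOn hF
  refine ForcingClass.of_continuousOn hF
    (B := (ENNReal.ofReal (volSqrt d))⁻¹ * ENNReal.ofReal C) ?_ fun t ht => ?_
  · exact ENNReal.mul_lt_top (ENNReal.inv_lt_top.2 (by simpa using volSqrt_pos))
      ENNReal.ofReal_lt_top
  · rw [wNorm_zero_eq]
    gcongr
    rw [← ofReal_norm]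
    exact ENNReal.ofReal_le_ofReal (hC t ht)

section

variable {ν T : ℝ}

lemma duhamelCoeff_add {σ : ℝ} (hσ : 0 ≤ σ) {F G : ℝ → L2 d} (hF : ForcingClass σ T F)
    (hG : ForcingClass σ T G) {t : ℝ} (ht : t ∈ Icc 0 T) (k : Fin d → ℤ) :
    duhamelCoeff ν (fun r => F r + G r) t k = duhamelCoeff ν F t k + duhamelCoeff ν G t k := by
  unfold duhamelCoeff duhamel
  simp only [coeff_Lp_add, mul_add]
  exact intervalIntegral.integral_add
    (intervalIntegrable_exp_mul (hF.integrableOn_coeff hσ k) ht)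
    (intervalIntegrable_exp_mul (hG.integrableOn_coeff hσ k) ht)

/-- The `L²` bound for the difference of two mild solutions. -/
lemma enorm_sub_sq_le (hν : 0 < ν) (hT : T ≤ 1) {u₀ : L2 d} {F G h : ℝ → L2 d}
    (hF : ForcingClass 0 T F) (hG : ForcingClass 0 T G) (hh : ForcingClass 0 T h) {t : ℝ}
    (ht : t ∈ Icc 0 T) {v w : L2 d} (hv : ∀ k, coeff v k = mildCoeff ν u₀ (fun r => F r + h r) t k)
    (hw : ∀ k, coeff w k = mildCoeff ν u₀ (fun r => G r + h r) t k) :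
    ‖v - w‖ₑ ^ 2 ≤ ENNReal.ofReal t * ∫⁻ r in Icc 0 t, ‖F r - G r‖ₑ ^ 2 := by
  have ht' : t ∈ Icc 0 t := ⟨ht.1, le_rfl⟩
  replace hF := hF.mono_time ht.2
  replace hG := hG.mono_time ht.2
  replace hh := hh.mono_time ht.2
  have hFG : ForcingClass 0 t fun r => F r - G r := by
    have hnG : ForcingClass 0 t fun r => (-1 : ℝ) • G r := by
      refine ⟨hG.1.fun_const_smul _, (lintegral_mono fun r => ?_).trans_lt hG.2⟩
      gcongr
      refine wNorm_mono_coeff fun k => ?_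
      rw [coeff_Lp_smul]; simp
    simpa only [neg_smul, one_smul, ← sub_eq_add_neg] using hF.add hnG
  have h1 : ∀ k, duhamelCoeff ν F t k = duhamelCoeff ν (fun r => F r - G r) t k
      + duhamelCoeff ν G t k := fun k => by
    rw [← duhamelCoeff_add le_rfl hFG hG ht']
    simp only [sub_add_cancel]
  have h2 : coeff (v - w : L2 d) = duhamelCoeff ν (fun r => F r - G r) t := by
    ext k
    rw [coeff_Lp_sub, hv, hw, mildCoeff, mildCoeff, duhamelCoeff_add le_rfl hF hh ht',
      duhamelCoeff_add le_rfl hG hh ht', h1]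
    ring
  have h3 := wNorm_duhamelCoeff_sq_le hν le_rfl (ht.2.trans hT) hFG ht' 0
  calc ‖v - w‖ₑ ^ 2
      = ENNReal.ofReal (volSqrt d) ^ 2 * wNorm 0 (duhamelCoeff ν (fun r => F r - G r) t) ^ 2 := by
        rw [enorm_eq_wNorm, h2, mul_pow]
    _ ≤ ENNReal.ofReal (volSqrt d) ^ 2 *
          (ENNReal.ofReal t * ∫⁻ r in Icc 0 t, wNorm 0 (coeff (F r - G r : L2 d)) ^ 2) := by gcongr
    _ = _ := by
        rw [mul_left_comm, ← lintegral_const_mul' _ _ (by finiteness)]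
        simp only [← mul_pow, ← enorm_eq_wNorm]

lemma continuousOn_of_coeff_eq_mildCoeff (hν : 0 < ν) (hT : T ≤ 1) {u₀ : L2 d}
    (hu₀ : wNorm 1 (coeff u₀) < ⊤) {F : ℝ → L2 d} (hF : ForcingClass 0 T F) {u : ℝ → L2 d}
    (hu : ∀ t ∈ Icc 0 T, ∀ k, coeff (u t) k = mildCoeff ν u₀ F t k) :
    ContinuousOn u (Icc 0 T) := by
  intro t ht
  have h1 := tendsto_wNorm_mildCoeff_sub hν le_rfl hT hF (by simpa using hu₀) ht
  rw [ContinuousWithinAt, tendsto_iff_edist_tendsto_0]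
  have h2 := ENNReal.Tendsto.const_mul h1
    (Or.inr (ENNReal.ofReal_ne_top (r := volSqrt d)))
  rw [mul_zero] at h2
  refine tendsto_of_tendsto_of_tendsto_of_le_of_le' tendsto_const_nhds h2
    (.of_forall fun _ => zero_le) ?_
  filter_upwards [self_mem_nhdsWithin] with r hr
  rw [edist_eq_enorm_sub, enorm_eq_wNorm]
  gcongr
  refine (wNorm_mono (by norm_num : (0 : ℝ) ≤ 0 + 1) _).trans (le_of_eq ?_)
  congr 1; ext k
  rw [coeff_Lp_sub, hu r hr, hu t ht]

lemma isClosed_wNorm_le (σ : ℝ) (M : ℝ≥0∞) : IsClosed {v : L2 d | wNorm σ (coeff v) ≤ M} := by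
  refine IsSeqClosed.isClosed fun v w hv hw => ?_
  refine l2_le_of_tendsto (F := atTop) (a := fun n k => wt σ k * ‖coeff (v n) k‖ₑ) (fun k => ?_)
    (.of_forall hv)
  refine ENNReal.Tendsto.const_mul ?_ (Or.inr (wt_ne_top _ _))
  exact (continuous_enorm.tendsto _).comp (((continuous_coeff k).tendsto w).comp hw)

/-- Existence of mild solutions by the contraction principle in `C([0,T], L²)`, on the closed set of
curves that stay in a ball of `H^σ`. -/
lemma exists_mild (hν : 0 < ν) (hT0 : 0 ≤ T) (hT : T ≤ 1) {u₀ : L2 d}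
    (hu₀ : wNorm 1 (coeff u₀) < ⊤) {G : L2 d → L2 d} {K : ℝ≥0} (hG : LipschitzWith K G)
    (hTK : T * K < 1) {h : ℝ → L2 d} (hh : ForcingClass 0 T h) {σ : ℝ} {M : ℝ≥0∞}
    (hu₀M : wNorm σ (coeff u₀) ≤ M)
    (hinv : ∀ u : ℝ → L2 d, ContinuousOn u (Icc 0 T) →
      (∀ t ∈ Icc 0 T, wNorm σ (coeff (u t)) ≤ M) →
      ∀ t ∈ Icc 0 T, wNorm σ (mildCoeff ν u₀ (fun r => G (u r) + h r) t) ≤ M) :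
    ∃ u : ℝ → L2 d, ContinuousOn u (Icc 0 T) ∧ (∀ t ∈ Icc 0 T, wNorm σ (coeff (u t)) ≤ M) ∧
      ∀ t ∈ Icc 0 T, ∀ k, coeff (u t) k = mildCoeff ν u₀ (fun r => G (u r) + h r) t k := by
  have hGc : ∀ U : C(Icc 0 T, L2 d), ForcingClass 0 T fun r => G (IccExtend hT0 U r) := fun U =>
    ForcingClass.of_continuousOn_L2 (hG.continuous.comp U.continuous.Icc_extend').continuousOn
  have hF : ∀ U : C(Icc 0 T, L2 d), ForcingClass 0 T fun r => G (IccExtend hT0 U r) + h r :=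
    fun U => (hGc U).add hh
  have hex : ∀ (U : C(Icc 0 T, L2 d)) (t : ℝ), ∃ v : L2 d, t ∈ Icc 0 T →
      ∀ k, coeff v k = mildCoeff ν u₀ (fun r => G (IccExtend hT0 U r) + h r) t k := by
    intro U t
    by_cases ht : t ∈ Icc 0 T
    · obtain ⟨v, hv⟩ := exists_coeff_eq_mildCoeff hν hT (hF U) u₀ ht
      exact ⟨v, fun _ => hv⟩
    · exact ⟨0, fun h => absurd h ht⟩
  choose W hW using hex
  have hWc : ∀ U, ContinuousOn (W U) (Icc 0 T) := fun U =>
    continuousOn_of_coeff_eq_mildCoeff hν hT hu₀ (hF U) (hW U)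
  let Φ : C(Icc 0 T, L2 d) → C(Icc 0 T, L2 d) := fun U =>
    ⟨(Icc 0 T).domRestrict (W U), continuousOn_iff_continuous_domRestrict.1 (hWc U)⟩
  let S : Set C(Icc 0 T, L2 d) := {U | ∀ t, wNorm σ (coeff (U t)) ≤ M}
  have hS : IsClosed S := by
    have e : S = ⋂ t, (fun U : C(Icc 0 T, L2 d) => U t) ⁻¹' {v : L2 d | wNorm σ (coeff v) ≤ M} := by
      ext U; simp [S]
    rw [e]
    exact isClosed_iInter fun t => (isClosed_wNorm_le σ M).preimage (continuous_eval_const t)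
  have hext : ∀ U ∈ S, ∀ t ∈ Icc 0 T, wNorm σ (coeff (IccExtend hT0 U t : L2 d)) ≤ M :=
    fun U hU t ht => by rw [IccExtend_of_mem hT0 U ht]; exact hU ⟨t, ht⟩
  have hmaps : MapsTo Φ S S := by
    intro U hU t
    have e : coeff (Φ U t) = mildCoeff ν u₀ (fun r => G (IccExtend hT0 U r) + h r) t :=
      funext (hW U t t.2)
    rw [e]
    exact hinv _ U.continuous.Icc_extend'.continuousOn (hext U hU) t t.2
  have hTK0 : 0 ≤ T * K := mul_nonneg hT0 K.2
  have hcontr : ContractingWith (T * K).toNNReal (hmaps.restrict Φ S S) := by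
    refine ⟨Real.toNNReal_lt_one.2 hTK, LipschitzWith.of_dist_le_mul fun U V => ?_⟩
    rw [Real.coe_toNNReal _ hTK0]
    change dist (Φ U) (Φ V) ≤ T * K * dist (U : C(Icc 0 T, L2 d)) V
    set D := dist (U : C(Icc 0 T, L2 d)) V
    refine (ContinuousMap.dist_le (mul_nonneg hTK0 dist_nonneg)).2 fun t => ?_
    have h1 := enorm_sub_sq_le hν hT (hGc U) (hGc V) hh t.2 (hW U t t.2) (hW V t t.2)
    have h2 : ∀ r, ‖G (IccExtend hT0 U r) - G (IccExtend hT0 V r)‖ₑ ≤ ENNReal.ofReal (K * D) := by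
      intro r
      rw [← ofReal_norm, ← dist_eq_norm]
      refine ENNReal.ofReal_le_ofReal ((hG.dist_le_mul _ _).trans ?_)
      gcongr
      exact ContinuousMap.dist_apply_le_dist _
    have h3 : ‖W U t - W V t‖ₑ ^ 2 ≤ ENNReal.ofReal (T * (K * D)) ^ 2 := by
      refine h1.trans ?_
      calc ENNReal.ofReal t * ∫⁻ r in Icc 0 (t : ℝ),
            ‖G (IccExtend hT0 U r) - G (IccExtend hT0 V r)‖ₑ ^ 2
          ≤ ENNReal.ofReal t * ∫⁻ _r in Icc 0 (t : ℝ), ENNReal.ofReal (K * D) ^ 2 := by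
            gcongr with r; exact h2 r
        _ = ENNReal.ofReal t * (ENNReal.ofReal (K * D) ^ 2 * ENNReal.ofReal t) := by simp
        _ ≤ ENNReal.ofReal T * (ENNReal.ofReal (K * D) ^ 2 * ENNReal.ofReal T) := by
            have := ENNReal.ofReal_le_ofReal t.2.2
            gcongr
        _ = _ := by rw [ENNReal.ofReal_mul hT0]; ring
    have h4 := le_of_sq_le_sq h3
    rw [← ofReal_norm, ENNReal.ofReal_le_ofReal_iff (by positivity), ← dist_eq_norm] at h4
    rw [mul_assoc]
    exact h4
  obtain ⟨U, hUS, hfix, -⟩ := ContractingWith.exists_fixedPoint' hS.isComplete hmaps hcontr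
    (x := ContinuousMap.const _ u₀) (fun _ => hu₀M) (edist_ne_top _ _)
  refine ⟨IccExtend hT0 U, U.continuous.Icc_extend'.continuousOn, hext U hUS, fun t ht k => ?_⟩
  have e : IccExtend hT0 U t = W U t := by
    rw [IccExtend_of_mem hT0 U ht]
    exact (DFunLike.congr_fun hfix ⟨t, ht⟩).symm
  rw [e, hW U t ht]

/-- Mild solutions are unique in `C([0,T], L²)`. -/
lemma mild_unique (hν : 0 < ν) (hT : T ≤ 1) {u₀ : L2 d}
    {G : L2 d → L2 d} {K : ℝ≥0} (hG : LipschitzWith K G) {h : ℝ → L2 d} (hh : ForcingClass 0 T h)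
    {u v : ℝ → L2 d} (hu : ContinuousOn u (Icc 0 T)) (hv : ContinuousOn v (Icc 0 T))
    (hu' : ∀ t ∈ Icc 0 T, ∀ k, coeff (u t) k = mildCoeff ν u₀ (fun r => G (u r) + h r) t k)
    (hv' : ∀ t ∈ Icc 0 T, ∀ k, coeff (v t) k = mildCoeff ν u₀ (fun r => G (v r) + h r) t k) :
    ∀ t ∈ Icc 0 T, v t = u t := by
  have hφ : ContinuousOn (fun t => ‖u t - v t‖ ^ 2) (Icc 0 T) := (hu.sub hv).norm.pow 2
  have key := eq_zero_of_le_integral (L := (K : ℝ) ^ 2) hφ (fun _ _ => by positivity) ?_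
  · intro t ht
    have := key t ht
    rw [sq_eq_zero_iff, norm_eq_zero, sub_eq_zero] at this
    exact this.symm
  intro t ht
  have hGu := ForcingClass.of_continuousOn_L2 (hG.continuous.comp_continuousOn hu)
  have hGv := ForcingClass.of_continuousOn_L2 (hG.continuous.comp_continuousOn hv)
  have h1 := enorm_sub_sq_le hν hT hGu hGv hh ht (hu' t ht) (hv' t ht)
  have hint : IntegrableOn (fun r => ‖u r - v r‖ ^ 2) (Icc 0 t) :=
    (hφ.mono (Icc_subset_Icc le_rfl ht.2)).integrableOn_Icc
  have h2 : ∫⁻ r in Icc 0 t, ‖G (u r) - G (v r)‖ₑ ^ 2 ≤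
      ENNReal.ofReal (K ^ 2 * ∫ r in (0 : ℝ)..t, ‖u r - v r‖ ^ 2) := by
    rw [intervalIntegral.integral_of_le ht.1, ← integral_Icc_eq_integral_Ioc,
      ← integral_const_mul, ofReal_integral_eq_lintegral_ofReal (hint.const_mul _)
        (.of_forall fun r => by positivity)]
    refine lintegral_mono fun r => ?_
    rw [← ofReal_norm, ← ENNReal.ofReal_pow (norm_nonneg _), ← mul_pow]
    refine ENNReal.ofReal_le_ofReal ?_
    gcongr
    rw [← dist_eq_norm, ← dist_eq_norm]
    exact hG.dist_le_mul _ _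
  have hnn : 0 ≤ ∫ r in (0 : ℝ)..t, ‖u r - v r‖ ^ 2 :=
    intervalIntegral.integral_nonneg ht.1 fun _ _ => by positivity
  have h3 : ‖u t - v t‖ₑ ^ 2 ≤ ENNReal.ofReal (K ^ 2 * ∫ r in (0 : ℝ)..t, ‖u r - v r‖ ^ 2) := by
    refine h1.trans (le_trans (mul_le_mul' ?_ h2) (one_mul _).le)
    exact ENNReal.ofReal_le_one.2 (ht.2.trans hT)
  rw [← ofReal_norm, ← ENNReal.ofReal_pow (norm_nonneg _),
    ENNReal.ofReal_le_ofReal_iff (mul_nonneg (by positivity) hnn)] at h3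
  exact h3

end

/-! ### Short-time estimates for the Duhamel integral -/

section

variable {ν T : ℝ}

lemma forcingClass_const (c : L2 d) : ForcingClass 0 T fun _ => c :=
  ForcingClass.of_continuousOn_L2 continuousOn_const

/-- A forcing bounded by `b` in `H^τ` contributes at most `T * b` to the mild solution. -/
lemma wNorm_duhamelCoeff_le_of_le (hν : 0 < ν) (hT : T ≤ 1) {F : ℝ → L2 d}
    (hF : ForcingClass 0 T F) {τ : ℝ} {b : ℝ≥0∞} (hb : ∀ r ∈ Icc 0 T, wNorm τ (coeff (F r)) ≤ b)
    {t : ℝ} (ht : t ∈ Icc 0 T) : wNorm τ (duhamelCoeff ν F t) ≤ ENNReal.ofReal T * b := by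
  refine le_of_sq_le_sq ((wNorm_duhamelCoeff_sq_le hν le_rfl hT hF ht τ).trans ?_)
  calc ENNReal.ofReal T * ∫⁻ r in Icc 0 T, wNorm τ (coeff (F r)) ^ 2
      ≤ ENNReal.ofReal T * ∫⁻ _r in Icc 0 T, b ^ 2 := by
        refine mul_le_mul' le_rfl (setLIntegral_mono' measurableSet_Icc fun r hr => ?_)
        gcongr; exact hb r hr
    _ = (ENNReal.ofReal T * b) ^ 2 := by simp; ring

lemma wNorm_duhamelCoeff_le_rpow (hν : 0 < ν) (hT : T ≤ 1) {σ : ℝ} (hσ : 0 ≤ σ) {F : ℝ → L2 d}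
    (hF : ForcingClass σ T F) {t : ℝ} (ht : t ∈ Icc 0 T) :
    wNorm (σ + 1) (duhamelCoeff ν F t) ≤
      (heatConst ν * ∫⁻ r in Icc 0 T, wNorm σ (coeff (F r)) ^ 2) ^ (1 / 2 : ℝ) := by
  refine le_of_sq_le_sq ((wNorm_add_one_duhamelCoeff_sq_le hν hσ hT hF ht).trans (le_of_eq ?_))
  rw [← ENNReal.rpow_natCast, ← ENNReal.rpow_mul]
  norm_num

lemma one_sub_exp_neg_le_sqrt {x : ℝ} (hx : 0 ≤ x) : 1 - Real.exp (-x) ≤ √x := by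
  rcases le_total x 1 with h | h
  · have h1 := Real.add_one_le_exp (-x)
    have h2 : x ≤ √x := Real.le_sqrt_of_sq_le (by nlinarith)
    linarith
  · have h1 := Real.exp_pos (-x)
    have h2 : 1 ≤ √x := Real.one_le_sqrt.2 h
    linarith

lemma sqrt_mul_freqSq_le (ν : ℝ) (k : Fin d → ℤ) (t : ℝ) :
    √(ν * freqSq k * t) ≤ √(ν * t) * jap k := by
  rw [mul_right_comm, mul_comm (ν * t), Real.sqrt_mul (freqSq_nonneg k), mul_comm]
  gcongr
  refine (Real.sqrt_le_sqrt (?_ : freqSq k ≤ jap k ^ 2)).trans (Real.sqrt_sq (jap_pos k).le).le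
  rw [jap_sq]; linarith

lemma wt_add_one_eq (τ : ℝ) (k : Fin d → ℤ) : wt (τ + 1) k = wt τ k * ENNReal.ofReal (jap k) := by
  rw [wt_add]; congr 1; simp [wt]

/-- A Fourier multiplier bounded by `b * (1 + |k|²)^{1/2}` costs one derivative. -/
lemma wNorm_mul_le_of_norm_le {τ b : ℝ} (hb : 0 ≤ b) {m c : (Fin d → ℤ) → ℂ}
    (hm : ∀ k, ‖m k‖ ≤ b * jap k) :
    wNorm τ (fun k => m k * c k) ≤ ENNReal.ofReal b * wNorm (τ + 1) c := by
  have h1 : ENNReal.ofReal b * wNorm (τ + 1) c = wNorm (τ + 1) fun k => (b : ℂ) * c k := by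
    rw [wNorm_const_mul, ← ofReal_norm, Complex.norm_real, Real.norm_of_nonneg hb]
  rw [h1]
  refine l2_mono fun k => ?_
  have hk : ‖m k‖ₑ ≤ ENNReal.ofReal (jap k) * ‖(b : ℂ)‖ₑ := by
    rw [← ofReal_norm (m k), ← ofReal_norm (b : ℂ), Complex.norm_real,
      Real.norm_of_nonneg hb, ← ENNReal.ofReal_mul (jap_pos k).le, mul_comm]
    exact ENNReal.ofReal_le_ofReal (hm k)
  rw [wt_add_one_eq, enorm_mul, enorm_mul, mul_assoc, ← mul_assoc (ENNReal.ofReal _)]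
  gcongr

/-- Continuity of the heat semigroup at time zero, with a rate. -/
lemma wNorm_heat_sub_le (hν : 0 < ν) (τ : ℝ) (c : (Fin d → ℤ) → ℂ) {t : ℝ} (ht : 0 ≤ t) :
    wNorm τ (fun k => ((Real.exp (-(ν * freqSq k * t)) : ℂ) - 1) * c k) ≤
      ENNReal.ofReal √(ν * t) * wNorm (τ + 1) c := by
  refine wNorm_mul_le_of_norm_le (Real.sqrt_nonneg _) fun k => ?_
  have h0 := mul_nonneg (nonneg_mul_freqSq hν k) ht
  rw [← Complex.ofReal_one, ← Complex.ofReal_sub, Complex.norm_real, norm_sub_rev,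
    Real.norm_of_nonneg (sub_nonneg.2 (Real.exp_le_one_iff.2 (by linarith)))]
  exact (one_sub_exp_neg_le_sqrt h0).trans (sqrt_mul_freqSq_le ν k t)

/-- Forcing by `t⁻¹ • q` up to the time `t` produces nearly `q`. -/
lemma wNorm_duhamelCoeff_const_sub_le (hν : 0 < ν) (τ : ℝ) (q : L2 d) {t : ℝ} (ht : 0 < t) :
    wNorm τ (fun k => duhamelCoeff ν (fun _ => t⁻¹ • q) t k - coeff q k) ≤
      ENNReal.ofReal √(ν * t) * wNorm (τ + 1) (coeff q) := by
  have e : ∀ k, duhamelCoeff ν (fun _ => t⁻¹ • q) t k - coeff q k =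
      ((t⁻¹ * ∫ r in (0 : ℝ)..t, (Real.exp (-(ν * freqSq k * (t - r))) - 1) : ℝ) : ℂ) *
        coeff q k := by
    intro k
    rw [intervalIntegral.integral_sub (Continuous.intervalIntegrable (by fun_prop) _ _)
      (Continuous.intervalIntegrable (by fun_prop) _ _), duhamelCoeff, duhamel,
      intervalIntegral.integral_mul_const, intervalIntegral.integral_ofReal, coeff_Lp_smul]
    simp only [intervalIntegral.integral_const, sub_zero, smul_eq_mul, mul_one]
    rw [mul_sub, inv_mul_cancel₀ ht.ne']
    push_cast
    ring
  simp only [e]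
  refine wNorm_mul_le_of_norm_le (Real.sqrt_nonneg _) fun k => ?_
  rw [Complex.norm_real, norm_mul, norm_inv, Real.norm_of_nonneg ht.le, inv_mul_le_iff₀ ht]
  have h1 := intervalIntegral.norm_integral_le_of_norm_le_const (a := 0) (b := t)
    (f := fun r => Real.exp (-(ν * freqSq k * (t - r))) - 1) (C := √(ν * t) * jap k) ?_
  · rwa [sub_zero, abs_of_pos ht, mul_comm (_ * _) t] at h1
  · intro r hr
    rw [uIoc_of_le ht.le] at hr
    have h0 : 0 ≤ ν * freqSq k * (t - r) :=
      mul_nonneg (nonneg_mul_freqSq hν k) (sub_nonneg.2 hr.2)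
    rw [norm_sub_rev, Real.norm_of_nonneg (sub_nonneg.2 (Real.exp_le_one_iff.2 (by linarith)))]
    refine (one_sub_exp_neg_le_sqrt h0).trans ((Real.sqrt_le_sqrt ?_).trans
      (sqrt_mul_freqSq_le ν k t))
    exact mul_le_mul_of_nonneg_left (by linarith [hr.1]) (nonneg_mul_freqSq hν k)

end

/-! ### The parabolic equation in mild form -/

lemma wNorm_freqSq_mul_le (σ : ℝ) (c : (Fin d → ℤ) → ℂ) :
    wNorm σ (fun k => (freqSq k : ℂ) * c k) ≤ wNorm (σ + 2) c := by
  refine l2_mono fun k => ?_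
  have e : wt (σ + 2) k = wt σ k * ENNReal.ofReal (1 + freqSq k) := by
    rw [wt_add, ← jap_sq, ← Real.rpow_two]; rfl
  rw [e, enorm_mul, mul_assoc, ← ofReal_norm (freqSq k : ℂ), Complex.norm_real,
    Real.norm_of_nonneg (freqSq_nonneg k)]
  gcongr
  linarith

/-- The Laplacian `-Δv` of `v ∈ H²`. -/
lemma exists_coeff_eq_freqSq_mul {v : L2 d} (hv : wNorm 2 (coeff v) < ⊤) :
    ∃ w : L2 d, ∀ k, coeff w k = freqSq k * coeff v k := by
  refine exists_coeff_eq ((wNorm_freqSq_mul_le 0 _).trans_lt (by simpa using hv)) fun k => ?_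
  rw [freqSq_neg, coeff_neg_freq, map_mul, Complex.conj_ofReal]

section

variable {ν T : ℝ} {f : ℝ → ℝ} {A ζ η u₀ : L2 d} {h u v : ℝ → L2 d}

/-- As long as `|u + ζ| ≤ ρ`, the equation in the sense of distributions is the mild form of the
equation whose nonlinearity is truncated at height `ρ`. -/
lemma equation_iff_mild (hν : 0 < ν)
    (hA : ∀ k, coeff A k = -((ν * freqSq k : ℝ) : ℂ) * coeff ζ k + coeff η k)
    {ρ : ℝ} {K : ℝ≥0} (hK : LipschitzWith K (truncate ρ f)) (hh : ForcingClass 0 T h)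
    (hu : ContinuousOn u (Icc 0 T)) (hρ : ∀ t ∈ Icc 0 T, ∀ᵐ x, |u t x + ζ x| ≤ ρ) :
    (∀ t ∈ Icc 0 T, ∀ k : Fin d → ℤ, coeff (u t) k = coeff u₀ k +
      ∫ r in (0 : ℝ)..t,
        (-((ν * freqSq k : ℝ) : ℂ) * (coeff (u r) k + coeff ζ k)
          - coeff (fun x => f (u r x + ζ x)) k + coeff (h r + η : L2 d) k)) ↔
    ∀ t ∈ Icc 0 T, ∀ k, coeff (u t) k =
      mildCoeff ν u₀ (fun r => (A - superpose (truncate ρ f) (u r + ζ)) + h r) t k := by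
  have hGc : ForcingClass 0 T fun r => (A - superpose (truncate ρ f) (u r + ζ)) :=
    ForcingClass.of_continuousOn_L2 (continuousOn_const.sub
      ((lipschitzWith_superpose hK).continuous.comp_continuousOn (hu.add continuousOn_const)))
  have hF := hGc.add hh
  have hsup : ∀ r ∈ Icc 0 T, coeff (superpose (truncate ρ f) (u r + ζ)) =
      coeff fun x => f (u r x + ζ x) := by
    intro r hr
    refine coeff_congr ?_
    filter_upwards [coeFn_superpose hK (u r + ζ), Lp.coeFn_add (u r) ζ, hρ r hr] with x h1 h2 h3
    rw [h1, h2, Pi.add_apply, truncate_of_abs_le h3]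
  have hint : ∀ t ∈ Icc 0 T, ∀ k, (∫ r in (0 : ℝ)..t,
        (-((ν * freqSq k : ℝ) : ℂ) * (coeff (u r) k + coeff ζ k)
          - coeff (fun x => f (u r x + ζ x)) k + coeff (h r + η : L2 d) k)) =
      ∫ r in (0 : ℝ)..t, (-((ν * freqSq k : ℝ) : ℂ) * coeff (u r) k +
        coeff ((A - superpose (truncate ρ f) (u r + ζ)) + h r : L2 d) k) := by
    intro t ht k
    refine intervalIntegral.integral_congr fun r hr => ?_
    rw [uIcc_of_le ht.1] at hr
    rw [coeff_Lp_add, coeff_Lp_add, coeff_Lp_sub, hsup r ⟨hr.1, hr.2.trans ht.2⟩, hA]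
    ring
  have key := fun k => integral_equation_iff (nonneg_mul_freqSq hν k)
    (hF.integrableOn_coeff le_rfl k) ((continuous_coeff k).comp_continuousOn hu) (coeff u₀ k)
  constructor
  · intro H t ht k
    refine (key k).1 (fun t ht => ?_) t ht
    rw [Function.comp_apply, H t ht k, hint t ht k]
    rfl
  · intro H t ht k
    rw [hint t ht k]
    exact (key k).2 (fun t ht => H t ht k) t ht

lemma MemCH.exists_bound {σ : ℝ} (hu : MemCH σ T u) :
    ∃ B < ⊤, ∀ t ∈ Icc 0 T, wNorm σ (coeff (u t)) ≤ B := by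
  refine isCompact_Icc.induction_on (p := fun S => ∃ B < ⊤, ∀ t ∈ S, wNorm σ (coeff (u t)) ≤ B)
    ⟨0, by simp, by simp⟩ (fun S S' hS ⟨B, hB, h⟩ => ⟨B, hB, fun t ht => h t (hS ht)⟩) ?_ ?_
  · rintro S S' ⟨B, hB, h⟩ ⟨B', hB', h'⟩
    refine ⟨max B B', max_lt hB hB', ?_⟩
    rintro t (ht | ht)
    · exact (h t ht).trans (le_max_left _ _)
    · exact (h' t ht).trans (le_max_right _ _)
  · intro t ht
    refine ⟨_, (hu.2 t ht).eventually (gt_mem_nhds zero_lt_one), 1 + wNorm σ (coeff (u t)),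
      ENNReal.add_lt_top.2 ⟨ENNReal.one_lt_top, ?_⟩, fun r hr => ?_⟩
    · rw [← sobNorm_eq_wNorm]; exact hu.1 t ht
    · have e : coeff (u r) = fun k => coeff (u r - u t : L2 d) k + coeff (u t) k := by
        ext k; rw [coeff_Lp_sub]; ring
      rw [e]
      refine (wNorm_add_le _ _ _).trans (add_le_add ?_ le_rfl)
      rw [← sobNorm_eq_wNorm]; exact le_of_lt hr

lemma MemCH.continuousOn {σ : ℝ} (hσ : 0 ≤ σ) (hu : MemCH σ T u) : ContinuousOn u (Icc 0 T) := by
  intro t ht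
  have h1 := hu.2 t ht
  rw [ContinuousWithinAt, tendsto_iff_edist_tendsto_0]
  have h2 := ENNReal.Tendsto.const_mul h1 (Or.inr (ENNReal.ofReal_ne_top (r := volSqrt d)))
  rw [mul_zero] at h2
  refine tendsto_of_tendsto_of_tendsto_of_le_of_le tendsto_const_nhds h2
    (fun _ => zero_le) fun r => ?_
  rw [edist_eq_enorm_sub, enorm_eq_wNorm, sobNorm_eq_wNorm]
  exact mul_le_mul' le_rfl (wNorm_mono hσ _)

/-- By the Sobolev embedding, `v + κ⁻¹ ζ` is of size `κ⁻¹` in `L^∞` for `v` in a ball of `H^s`. -/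
lemma exists_ae_abs_add_le {s : ℝ} (hs : (d : ℝ) / 2 < s) {M : ℝ≥0∞} (hM : M < ⊤)
    (hζ : wNorm s (coeff ζ) < ⊤) :
    ∃ ρ : ℝ, 0 ≤ ρ ∧ ∀ v : L2 d, wNorm s (coeff v) ≤ M → ∀ κ : ℝ, 0 < κ → κ ≤ 1 →
      ∀ᵐ x, |v x + κ⁻¹ * ζ x| ≤ κ⁻¹ * ρ := by
  set B := embConst d s * (M + wNorm s (coeff ζ)) with hB
  have hBt : B ≠ ⊤ :=
    (ENNReal.mul_lt_top (embConst_lt_top hs) (ENNReal.add_lt_top.2 ⟨hM, hζ⟩)).ne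
  refine ⟨B.toReal, ENNReal.toReal_nonneg, fun v hv κ hκ hκ1 => ?_⟩
  filter_upwards [ae_enorm_le s v, ae_enorm_le s ζ] with x h1 h2
  have h3 : ‖v x‖ₑ + ‖ζ x‖ₑ ≤ B := by
    rw [hB, mul_add]
    exact add_le_add (h1.trans (by gcongr)) h2
  have h4 : |v x| + |ζ x| ≤ B.toReal := by
    have := ENNReal.toReal_mono hBt h3
    rwa [ENNReal.toReal_add (by simp) (by simp), toReal_enorm, toReal_enorm] at this
  have h5 : 1 ≤ κ⁻¹ := (one_le_inv₀ hκ).2 hκ1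
  calc |v x + κ⁻¹ * ζ x| ≤ |v x| + |κ⁻¹ * ζ x| := abs_add_le _ _
    _ = 1 * |v x| + κ⁻¹ * |ζ x| := by rw [abs_mul, abs_of_pos (inv_pos.2 hκ), one_mul]
    _ ≤ κ⁻¹ * |v x| + κ⁻¹ * |ζ x| := by gcongr
    _ ≤ κ⁻¹ * B.toReal := by rw [← mul_add]; gcongr

/-- Solutions are unique when the nonlinearity is locally Lipschitz, because they are bounded. -/
lemma IsSolution.unique {s : ℝ} (hs : (d : ℝ) / 2 < s) (hν : 0 < ν) (hT : T ≤ 1)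
    (hA : ∀ k, coeff A k = -((ν * freqSq k : ℝ) : ℂ) * coeff ζ k + coeff η k)
    (hζ : wNorm s (coeff ζ) < ⊤) (hf : ∀ ρ : ℝ, 0 ≤ ρ → ∃ K : ℝ≥0, ∀ x y, |x| ≤ ρ → |y| ≤ ρ →
      |f x - f y| ≤ K * |x - y|) (hh : ForcingClass 0 T h)
    (hu : IsSolution ν f s T u₀ (fun _ => ζ) (fun t => h t + η) u)
    (hv : IsSolution ν f s T u₀ (fun _ => ζ) (fun t => h t + η) v) :
    ∀ t ∈ Icc 0 T, v t = u t := by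
  have hs0 : 0 ≤ s := (by positivity : (0 : ℝ) ≤ (d : ℝ) / 2).trans hs.le
  obtain ⟨B, hB, hBu⟩ := hu.memCH.exists_bound
  obtain ⟨B', hB', hBv⟩ := hv.memCH.exists_bound
  obtain ⟨ρ, hρ0, hρ⟩ := exists_ae_abs_add_le hs (max_lt hB hB') hζ
  obtain ⟨K, hK⟩ := hf ρ hρ0
  have hKρ := lipschitzWith_truncate hρ0 hK
  have hbd : ∀ w : L2 d, wNorm s (coeff w) ≤ max B B' → ∀ᵐ x, |w x + ζ x| ≤ ρ := fun w hw => by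
    simpa using hρ w hw 1 one_pos le_rfl
  have huc := hu.memCH.continuousOn hs0
  have hvc := hv.memCH.continuousOn hs0
  refine mild_unique hν hT (G := fun w => A - superpose (truncate ρ f) (w + ζ))
    (K := K) ?_ hh huc hvc
    ((equation_iff_mild hν hA hKρ hh huc fun t ht =>
      hbd _ ((hBu t ht).trans (le_max_left _ _))).1 hu.equation)
    ((equation_iff_mild hν hA hKρ hh hvc fun t ht =>
      hbd _ ((hBv t ht).trans (le_max_right _ _))).1 hv.equation)
  exact LipschitzWith.of_dist_le_mul fun w w' => by
    rw [dist_sub_left]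
    simpa using (lipschitzWith_superpose (d := d) hKρ).dist_le_mul (w + ζ) (w' + ζ)

lemma memCH_of_mild {σ : ℝ} (hν : 0 < ν) (hσ : 0 ≤ σ) (hT : T ≤ 1) {F : ℝ → L2 d}
    (hF : ForcingClass σ T F) (hu₀ : wNorm (σ + 1) (coeff u₀) < ⊤)
    (hu : ∀ t ∈ Icc 0 T, ∀ k, coeff (u t) k = mildCoeff ν u₀ F t k) : MemCH (σ + 1) T u := by
  refine ⟨fun t ht => ?_, fun t ht => ?_⟩
  · rw [MemH, sobNorm_eq_wNorm, funext (hu t ht)]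
    exact wNorm_mildCoeff_lt_top hν hσ hT hF hu₀ ht
  · refine (tendsto_wNorm_mildCoeff_sub hν hσ hT hF hu₀ ht).congr' ?_
    filter_upwards [self_mem_nhdsWithin] with r hr
    rw [sobNorm_eq_wNorm]
    congr 1; ext k
    rw [coeff_Lp_sub, hu r hr, hu t ht]

lemma memL2H_of_mild {σ : ℝ} (hν : 0 < ν) (hσ : 0 ≤ σ) (hT : T ≤ 1) {F : ℝ → L2 d}
    (hF : ForcingClass σ T F) (hu₀ : wNorm (σ + 2) (coeff u₀) < ⊤)
    (huc : ContinuousOn u (Icc 0 T))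
    (hu : ∀ t ∈ Icc 0 T, ∀ k, coeff (u t) k = mildCoeff ν u₀ F t k) : MemL2H (σ + 2) T u := by
  refine memL2H_iff.2 ⟨huc.aestronglyMeasurable measurableSet_Icc, ?_⟩
  refine lt_of_eq_of_lt (setLIntegral_congr_fun measurableSet_Icc fun t ht => ?_)
    (lintegral_wNorm_mildCoeff_lt_top hν hσ hT hF hu₀)
  rw [funext (hu t ht)]

end

/-! ### Existence and the asymptotics for short times -/

lemma wNorm_coeff_smul (σ a : ℝ) (v : L2 d) :
    wNorm σ (coeff (a • v : L2 d)) = ‖a‖ₑ * wNorm σ (coeff v) := by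
  have e : coeff (a • v : L2 d) = fun k => (a : ℂ) * coeff v k := funext (coeff_Lp_smul _ _)
  rw [e, wNorm_const_mul, ← ofReal_norm, Complex.norm_real, ofReal_norm]

lemma wNorm_coeff_sub_lt_top {σ : ℝ} {v w : L2 d} (hv : wNorm σ (coeff v) < ⊤)
    (hw : wNorm σ (coeff w) < ⊤) : wNorm σ (coeff (v - w : L2 d)) < ⊤ := by
  have e : coeff (v - w : L2 d) = fun k => coeff v k + coeff ((-1 : ℝ) • w : L2 d) k := by
    ext k; rw [coeff_Lp_sub, coeff_Lp_smul]; push_cast; ring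
  rw [e]
  refine (wNorm_add_le _ _ _).trans_lt (ENNReal.add_lt_top.2 ⟨hv, ?_⟩)
  rw [wNorm_coeff_smul]
  exact ENNReal.mul_lt_top (by simp) hw

lemma memL2H_const {σ T : ℝ} {v : L2 d} (hv : wNorm σ (coeff v) < ⊤) : MemL2H σ T fun _ => v :=
  memL2H_iff.2 (ForcingClass.of_continuousOn continuousOn_const hv fun _ _ => le_rfl)

lemma memCH_const {σ T : ℝ} {v : L2 d} (hv : wNorm σ (coeff v) < ⊤) : MemCH σ T fun _ => v := by
  refine ⟨fun t _ => by rwa [MemH, sobNorm_eq_wNorm], fun t _ => ?_⟩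
  have e : sobNorm σ (v - v) = 0 := by
    have e : coeff (v - v : L2 d) = fun _ => 0 := by ext k; rw [coeff_Lp_sub, sub_self]
    rw [sobNorm_eq_wNorm, e, wNorm_zero]
  simp only [e]
  exact tendsto_const_nhds

/-- The size in `H^s` of the contribution of a forcing `h ∈ L²([0,t], H^{s-1})` up to time `t`. -/
def heatResponse (ν s : ℝ) (h : ℝ → L2 d) (t : ℝ) : ℝ≥0∞ :=
  (heatConst ν * ∫⁻ r in Icc 0 t, wNorm (s - 1) (coeff (h r)) ^ 2) ^ (1 / 2 : ℝ)

lemma tendsto_heatResponse {ν s T : ℝ} (hT : 0 < T) {h : ℝ → L2 d}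
    (hh : ForcingClass (s - 1) T h) :
    Tendsto (heatResponse ν s h) (𝓝[>] 0) (𝓝 0) := by
  have h1 : Tendsto (fun t => (volume.restrict (Icc 0 T)) (Icc 0 t)) (𝓝[>] 0) (𝓝 0) := by
    have h2 : Tendsto (fun t : ℝ => ENNReal.ofReal t) (𝓝[>] 0) (𝓝 0) := by
      have := (ENNReal.continuous_ofReal.tendsto 0).mono_left (nhdsWithin_le_nhds (s := Ioi 0))
      simpa using this
    refine tendsto_of_tendsto_of_tendsto_of_le_of_le tendsto_const_nhds h2
      (fun _ => zero_le) fun t => ?_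
    refine (Measure.restrict_apply_le _ _).trans (by simp)
  have h3 := tendsto_setLIntegral_zero hh.2.ne h1
  have h4 : Tendsto (fun t => ∫⁻ r in Icc 0 t, wNorm (s - 1) (coeff (h r)) ^ 2)
      (𝓝[>] 0) (𝓝 0) := by
    refine h3.congr' ?_
    filter_upwards [Ioo_mem_nhdsGT hT] with t ht
    rw [Measure.restrict_restrict measurableSet_Icc,
      inter_eq_left.2 (Icc_subset_Icc le_rfl ht.2.le)]
  have h5 := (ENNReal.Tendsto.const_mul h4
    (Or.inr (ENNReal.ofReal_ne_top (r := Real.exp ν / ν)))).ennrpow_const (1 / 2 : ℝ)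
  rw [mul_zero, ENNReal.zero_rpow_of_pos (by norm_num)] at h5
  exact h5

/-- Existence on a short interval `[0,δ]` under a forcing which equals `δ⁻¹ • q` up to a remainder
of size `δ⁻¹ * b`, and the distance at time `δ` between the solution and `u₀ + q`. -/
lemma exists_isSolution {ν s δ ρ : ℝ} (hν : 0 < ν) (hs : 1 ≤ s) (hδ : 0 < δ) (hδ1 : δ ≤ 1)
    {f : ℝ → ℝ} {A ζ η u₀ q : L2 d} {h : ℝ → L2 d}
    (hA : ∀ k, coeff A k = -((ν * freqSq k : ℝ) : ℂ) * coeff ζ k + coeff η k)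
    {K : ℝ≥0} (hK : LipschitzWith K (truncate ρ f)) (hδK : δ * K < 1)
    (hh : ForcingClass (s - 1) δ h) (hu₀ : wNorm (s + 1) (coeff u₀) < ⊤)
    (hq : wNorm (s + 1) (coeff q) < ⊤) {M b : ℝ≥0∞} (hb : b < ⊤)
    (hρ : ∀ v : L2 d, wNorm s (coeff v) ≤ M → ∀ᵐ x, |v x + ζ x| ≤ ρ)
    (hrem : ∀ v : L2 d, wNorm s (coeff v) ≤ M →
      wNorm s (coeff (A - superpose (truncate ρ f) (v + ζ) - δ⁻¹ • q : L2 d)) ≤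
        ENNReal.ofReal δ⁻¹ * b)
    (hM : wNorm s (coeff u₀) + (wNorm s (coeff q) + b + heatResponse ν s h δ) ≤ M) :
    ∃ u : ℝ → L2 d, IsSolution ν f s δ u₀ (fun _ => ζ) (fun t => h t + η) u ∧
      wNorm s (coeff (u δ - (u₀ + q) : L2 d)) ≤
        ENNReal.ofReal √(ν * δ) * wNorm (s + 1) (coeff u₀) +
          (ENNReal.ofReal √(ν * δ) * wNorm (s + 1) (coeff q) + b + heatResponse ν s h δ) := by
  have hs0 : 0 ≤ s - 1 := by linarith
  have hss : s - 1 + 1 = s := by ring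
  have hss2 : s - 1 + 2 = s + 1 := by ring
  set G : L2 d → L2 d := fun v => A - superpose (truncate ρ f) (v + ζ) with hGdef
  have hG : LipschitzWith K G := LipschitzWith.of_dist_le_mul fun w w' => by
    rw [hGdef, dist_sub_left]
    simpa using (lipschitzWith_superpose (d := d) hK).dist_le_mul (w + ζ) (w' + ζ)
  have hh0 : ForcingClass 0 δ h := hh.mono_exponent hs0
  have hδδ : ENNReal.ofReal δ * ENNReal.ofReal δ⁻¹ = 1 := by
    rw [← ENNReal.ofReal_mul hδ.le, mul_inv_cancel₀ hδ.ne', ENNReal.ofReal_one]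
  have hremc : ∀ u : ℝ → L2 d, ContinuousOn u (Icc 0 δ) →
      ForcingClass 0 δ fun r => G (u r) - δ⁻¹ • q := fun u hu =>
    ForcingClass.of_continuousOn_L2 ((hG.continuous.comp_continuousOn hu).sub continuousOn_const)
  -- The mild solution is the sum of the free evolution and the responses to `δ⁻¹ • q`, to the
  -- remainder and to `h`.
  have hdec : ∀ u : ℝ → L2 d, ContinuousOn u (Icc 0 δ) → ∀ t ∈ Icc 0 δ, ∀ k,
      mildCoeff ν u₀ (fun r => G (u r) + h r) t k =
        (Real.exp (-(ν * freqSq k * t)) : ℂ) * coeff u₀ k +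
          (duhamelCoeff ν (fun _ => δ⁻¹ • q) t k +
            duhamelCoeff ν (fun r => G (u r) - δ⁻¹ • q) t k + duhamelCoeff ν h t k) := by
    intro u hu t ht k
    have e : (fun r => G (u r) + h r) =
        fun r => (δ⁻¹ • q + (G (u r) - δ⁻¹ • q)) + h r := by
      funext r; abel
    rw [e, mildCoeff, duhamelCoeff_add le_rfl ((forcingClass_const _).add (hremc u hu)) hh0 ht,
      duhamelCoeff_add le_rfl (forcingClass_const _) (hremc u hu) ht]
  have hdrem : ∀ u : ℝ → L2 d, ContinuousOn u (Icc 0 δ) →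
      (∀ t ∈ Icc 0 δ, wNorm s (coeff (u t)) ≤ M) → ∀ t ∈ Icc 0 δ,
      wNorm s (duhamelCoeff ν (fun r => G (u r) - δ⁻¹ • q) t) ≤ b := by
    intro u hu huM t ht
    refine (wNorm_duhamelCoeff_le_of_le hν hδ1 (hremc u hu)
      (fun r hr => hrem _ (huM r hr)) ht).trans (le_of_eq ?_)
    rw [← mul_assoc, hδδ, one_mul]
  have hdh : ∀ t ∈ Icc 0 δ, wNorm s (duhamelCoeff ν h t) ≤ heatResponse ν s h δ := by
    intro t ht
    have h1 := wNorm_duhamelCoeff_le_rpow hν hδ1 hs0 hh ht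
    rwa [hss] at h1
  have hdq : ∀ t ∈ Icc 0 δ, wNorm s (duhamelCoeff ν (fun _ => δ⁻¹ • q) t) ≤
      wNorm s (coeff q) := by
    intro t ht
    refine (wNorm_duhamelCoeff_le_of_le (b := ENNReal.ofReal δ⁻¹ * wNorm s (coeff q)) hν hδ1
      (forcingClass_const _) (fun r _ => le_of_eq ?_) ht).trans (le_of_eq ?_)
    · rw [wNorm_coeff_smul, ← ofReal_norm, Real.norm_of_nonneg (inv_nonneg.2 hδ.le)]
    · rw [← mul_assoc, hδδ, one_mul]
  have hsum : ∀ {c₁ c₂ c₃ c₄ : (Fin d → ℤ) → ℂ} {b₁ b₂ b₃ b₄ : ℝ≥0∞}, wNorm s c₁ ≤ b₁ →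
      wNorm s c₂ ≤ b₂ → wNorm s c₃ ≤ b₃ → wNorm s c₄ ≤ b₄ →
      wNorm s (fun k => c₁ k + (c₂ k + c₃ k + c₄ k)) ≤ b₁ + (b₂ + b₃ + b₄) :=
    fun h₁ h₂ h₃ h₄ => (wNorm_add_le _ _ _).trans (add_le_add h₁ ((wNorm_add_le _ _ _).trans
      (add_le_add ((wNorm_add_le _ _ _).trans (add_le_add h₂ h₃)) h₄)))
  have hu₀1 : wNorm 1 (coeff u₀) < ⊤ := (wNorm_mono (by linarith) _).trans_lt hu₀
  obtain ⟨u, huc, huM, hu⟩ := exists_mild hν hδ.le hδ1 hu₀1 hG hδK hh0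
    (le_self_add.trans hM) fun u huc huM t ht => by
      rw [funext (hdec u huc t ht)]
      exact (hsum (wNorm_heat_le hν s u₀ ht.1) (hdq t ht) (hdrem u huc huM t ht)
        (hdh t ht)).trans hM
  have hF : ForcingClass (s - 1) δ fun r => G (u r) + h r := by
    refine ForcingClass.add (ForcingClass.of_continuousOn (hG.continuous.comp_continuousOn huc)
      (B := ENNReal.ofReal δ⁻¹ * b + ‖δ⁻¹‖ₑ * wNorm s (coeff q)) ?_ fun t ht => ?_) hh
    · refine ENNReal.add_lt_top.2 ⟨ENNReal.mul_lt_top ENNReal.ofReal_lt_top hb,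
        ENNReal.mul_lt_top (by simp) ((wNorm_mono (by linarith) _).trans_lt hq)⟩
    · refine (wNorm_mono (by linarith : s - 1 ≤ s) _).trans ?_
      have e : coeff (G (u t)) = fun k => coeff (G (u t) - δ⁻¹ • q : L2 d) k +
          ((δ⁻¹ : ℝ) : ℂ) * coeff q k := by
        ext k; rw [coeff_Lp_sub (G (u t)), coeff_Lp_smul]; ring
      rw [e]
      refine (wNorm_add_le _ _ _).trans (add_le_add (hrem _ (huM t ht)) (le_of_eq ?_))
      rw [wNorm_const_mul, ← ofReal_norm, Complex.norm_real, ofReal_norm]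
  have hmemCH := memCH_of_mild hν hs0 hδ1 hF
    (u₀ := u₀) (u := u) (by rw [hss]; exact (wNorm_mono (by linarith) _).trans_lt hu₀) hu
  have hmemL2H := memL2H_of_mild hν hs0 hδ1 hF (u₀ := u₀) (u := u) (by rwa [hss2]) huc hu
  rw [hss] at hmemCH
  rw [hss2] at hmemL2H
  refine ⟨u, ⟨hmemCH, hmemL2H, coeff_injective fun k => ?_, ?_⟩, ?_⟩
  · rw [hu 0 ⟨le_rfl, hδ.le⟩, mildCoeff, duhamelCoeff, duhamel]
    simp
  · exact (equation_iff_mild hν hA hK hh0 huc fun t ht => hρ _ (huM t ht)).2 hu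
  · have hδm : δ ∈ Icc 0 δ := ⟨hδ.le, le_rfl⟩
    have e : coeff (u δ - (u₀ + q) : L2 d) = fun k =>
        ((Real.exp (-(ν * freqSq k * δ)) : ℂ) - 1) * coeff u₀ k +
          ((duhamelCoeff ν (fun _ => δ⁻¹ • q) δ k - coeff q k) +
            duhamelCoeff ν (fun r => G (u r) - δ⁻¹ • q) δ k + duhamelCoeff ν h δ k) := by
      ext k
      rw [coeff_Lp_sub, coeff_Lp_add, hu δ hδm, hdec u huc δ hδm]
      ring
    rw [e]
    exact hsum (wNorm_heat_sub_le hν s _ hδ.le) (wNorm_duhamelCoeff_const_sub_le hν s q hδ)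
      (hdrem u huc huM δ hδm) (hdh δ hδm)

/-- With the controls `κ⁻¹ • ζ` and `κ⁻ᵖ • η`, the forcing equals `κ⁻ᵖ • (η - ζᵖ)` up to a remainder
of relative size `κ`: the leading term of the nonlinearity produces `-ζᵖ`. Here `D` stands for
`-Δζ`. -/
lemma exists_wNorm_remainder_le {s : ℕ} (hs : (d : ℝ) / 2 < s) {ν : ℝ} (hν : 0 < ν) {p : ℕ}
    (hp : 2 ≤ p) {P : Polynomial ℝ} (hPdeg : P.natDegree = p) (hPmonic : P.Monic) {g : ℝ → ℝ}
    (hg : BddSmooth g) (hcond : g = 0 ∨ s < p) {M : ℝ≥0∞} (hM : M < ⊤) {ζ η z D : L2 d}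
    (hζ : wNorm s (coeff ζ) < ⊤) (hD : wNorm s (coeff D) < ⊤) (hz : ∀ᵐ x, z x = ζ x ^ p) :
    ∃ C < ⊤, ∀ κ : ℝ, 0 < κ → κ ≤ 1 → ∀ (ρ : ℝ) (K : ℝ≥0),
      LipschitzWith K (truncate ρ fun y => P.eval y + g y) → ∀ v : L2 d, wNorm s (coeff v) ≤ M →
      (∀ᵐ x, |v x + κ⁻¹ * ζ x| ≤ ρ) →
      wNorm s (coeff ((κ ^ p)⁻¹ • η - (ν * κ⁻¹) • D -
        superpose (truncate ρ fun y => P.eval y + g y) (v + κ⁻¹ • ζ) -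
          (κ ^ p)⁻¹ • (η - z) : L2 d)) ≤ ENNReal.ofReal (κ ^ p)⁻¹ * (C * ENNReal.ofReal κ) := by
  obtain ⟨C, hC, H⟩ := exists_wNorm_nonlinearity_sub_le hs hPdeg hPmonic hg hcond (max_lt hM hζ)
  refine ⟨ENNReal.ofReal ν * wNorm s (coeff D) + C, ENNReal.add_lt_top.2
    ⟨ENNReal.mul_lt_top ENNReal.ofReal_lt_top hD, hC⟩, fun κ hκ hκ1 ρ K hK v hv hρ => ?_⟩
  set N := superpose (truncate ρ fun y => P.eval y + g y) (v + κ⁻¹ • ζ) with hN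
  have hy : ∀ᵐ x, (v + κ⁻¹ • ζ : L2 d) x = v x + κ⁻¹ * ζ x := by
    filter_upwards [Lp.coeFn_add v (κ⁻¹ • ζ), Lp.coeFn_smul κ⁻¹ ζ] with x h1 h2
    rw [h1, Pi.add_apply, h2]; rfl
  obtain ⟨-, hE⟩ := H κ hκ hκ1 v ζ (hv.trans (le_max_left _ _)) (le_max_right _ _)
    ⇑(v + κ⁻¹ • ζ) hy
  set y : Torus d → ℝ := ⇑(v + κ⁻¹ • ζ) with hydef
  have hcoeffE : coeff (fun x => κ ^ p * (P.eval (y x) + g (y x)) - ζ x ^ p) =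
      coeff ((κ ^ p) • N - z : L2 d) := by
    refine (coeff_congr ?_).symm
    filter_upwards [Lp.coeFn_sub ((κ ^ p) • N) z, Lp.coeFn_smul (κ ^ p) N,
      coeFn_superpose hK (v + κ⁻¹ • ζ), hz, hρ, hy] with x h1 h2 h3 h4 h5 h6
    rw [h1, Pi.sub_apply, h2, Pi.smul_apply, h3, h4, truncate_of_abs_le (by rwa [← hydef, h6])]
    rfl
  have hκp : (κ ^ p)⁻¹ * κ ^ p = 1 := inv_mul_cancel₀ (pow_pos hκ p).ne'
  have e : coeff ((κ ^ p)⁻¹ • η - (ν * κ⁻¹) • D - N - (κ ^ p)⁻¹ • (η - z) : L2 d) = fun k =>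
      ((-(ν * κ⁻¹) : ℝ) : ℂ) * coeff D k + ((-(κ ^ p)⁻¹ : ℝ) : ℂ) *
        coeff (fun x => κ ^ p * (P.eval (y x) + g (y x)) - ζ x ^ p) k := by
    have hκp' : (((κ ^ p)⁻¹ : ℝ) : ℂ) * ((κ ^ p : ℝ) : ℂ) = 1 := by exact_mod_cast hκp
    rw [hcoeffE]
    ext k
    simp only [coeff_Lp_sub, coeff_Lp_smul, Complex.ofReal_neg]
    linear_combination coeff N k * hκp'
  rw [e]
  -- The diffusion of the control is of lower order because `p ≥ 2`.
  have hκ2 : κ⁻¹ ≤ (κ ^ p)⁻¹ * κ := by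
    rw [inv_mul_eq_div, le_div_iff₀ (pow_pos hκ p), inv_mul_le_iff₀ hκ, ← sq]
    exact pow_le_pow_of_le_one hκ.le hκ1 hp
  have hnonneg : 0 ≤ (κ ^ p)⁻¹ := by positivity
  refine (wNorm_add_le _ _ _).trans ?_
  rw [wNorm_const_mul, wNorm_const_mul, ← ofReal_norm, ← ofReal_norm, Complex.norm_real,
    Complex.norm_real, norm_neg, norm_neg, Real.norm_of_nonneg hnonneg,
    Real.norm_of_nonneg (mul_nonneg hν.le (inv_nonneg.2 hκ.le)), add_mul, mul_add]
  refine add_le_add ?_ (mul_le_mul' le_rfl hE)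
  calc ENNReal.ofReal (ν * κ⁻¹) * wNorm s (coeff D)
      ≤ ENNReal.ofReal (ν * ((κ ^ p)⁻¹ * κ)) * wNorm s (coeff D) := by gcongr
    _ = _ := by
        rw [ENNReal.ofReal_mul hν.le, ENNReal.ofReal_mul hnonneg]; ring

/-- The nonlinearity is Lipschitz on `[-ρ/κ, ρ/κ]` with a constant of order `κ^{1-p}`. -/
lemma exists_lipschitzWith_truncate {p : ℕ} (hp : 1 ≤ p) {P : Polynomial ℝ}
    (hPdeg : P.natDegree = p) {g : ℝ → ℝ} (hg : BddSmooth g) {ρ : ℝ} (hρ : 0 ≤ ρ) :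
    ∃ C : ℝ≥0, ∀ κ : ℝ, 0 < κ → κ ≤ 1 → ∃ K : ℝ≥0, κ ^ p * K = C * κ ∧
      (∀ x y, |x| ≤ κ⁻¹ * ρ → |y| ≤ κ⁻¹ * ρ →
        |(P.eval x + g x) - (P.eval y + g y)| ≤ K * |x - y|) ∧
      LipschitzWith K (truncate (κ⁻¹ * ρ) fun y => P.eval y + g y) := by
  obtain ⟨C, hC⟩ := exists_lipschitz_scaled hp hPdeg hg ρ
  refine ⟨C, fun κ hκ hκ1 => ?_⟩
  have hκp : 0 < κ ^ p := pow_pos hκ p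
  set K : ℝ≥0 := (C * κ * (κ ^ p)⁻¹).toNNReal with hKdef
  have hK : (K : ℝ) = C * κ * (κ ^ p)⁻¹ := Real.coe_toNNReal _ (by positivity)
  have hl : ∀ x y, |x| ≤ κ⁻¹ * ρ → |y| ≤ κ⁻¹ * ρ →
      |(P.eval x + g x) - (P.eval y + g y)| ≤ K * |x - y| := by
    intro x y hx hy
    have hs : ∀ w, |w| ≤ κ⁻¹ * ρ → |κ * w| ≤ ρ := fun w hw => by
      rw [abs_mul, abs_of_pos hκ]
      calc κ * |w| ≤ κ * (κ⁻¹ * ρ) := by gcongr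
        _ = ρ := mul_inv_cancel_left₀ hκ.ne' ρ
    have h1 := hC κ hκ hκ1 (κ * x) (κ * y) (hs x hx) (hs y hy)
    rw [inv_mul_cancel_left₀ hκ.ne', inv_mul_cancel_left₀ hκ.ne', ← mul_sub, ← mul_sub, abs_mul,
      abs_mul, abs_of_pos hκp, abs_of_pos hκ] at h1
    rw [hK, mul_assoc, mul_comm _⁻¹, ← mul_assoc, ← div_eq_mul_inv, le_div_iff₀ hκp]
    linarith
  refine ⟨K, ?_, hl, lipschitzWith_truncate (by positivity) hl⟩
  rw [hK]; field_simp

end TorusParabolic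

end

open TorusParabolic

theorem proposition2p4
    (d : ℕ) (hd : 1 ≤ d)
    (s : ℕ) (hs : (d : ℝ) / 2 < s)
    (ν : ℝ) (hν : 0 < ν)
    (T : ℝ) (hT : 0 < T)
    (p : ℕ) (hp : 2 ≤ p)
    (P : Polynomial ℝ) (hPdeg : P.natDegree = p) (hPmonic : P.Monic)
    (g : ℝ → ℝ) (hg : ContDiff ℝ ∞ g)
    (hgb : ∀ n : ℕ, ∃ C : ℝ, ∀ y : ℝ, |iteratedDeriv n g y| ≤ C)
    (hcond : g = 0 ∨ s < p)
    (u₀ η ζ : L2 d) (hu₀ : MemH ((s : ℝ) + 1) u₀) (hη : MemH ((s : ℝ) + 1) η)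
    (hζ : MemH ((s : ℝ) + 2) ζ)
    (h : ℝ → L2 d) (hh : MemL2H ((s : ℝ) - 1) T h) :
    ∃ δ₀ : ℝ, 0 < δ₀ ∧ δ₀ ≤ T ∧
      ∃ u : ℝ → ℝ → L2 d,
        (∀ δ ∈ Set.Ioo 0 δ₀,
          ((fun _ => δ⁻¹ • η, fun _ => δ ^ (-(1 / (p : ℝ))) • ζ) ∈
            ThetaHat ν (fun y => P.eval y + g y) s u₀ h δ) ∧
          IsSolution ν (fun y => P.eval y + g y) s δ u₀
            (fun _ => δ ^ (-(1 / (p : ℝ))) • ζ) (fun t => h t + δ⁻¹ • η) (u δ) ∧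
          ∀ v : ℝ → L2 d,
            IsSolution ν (fun y => P.eval y + g y) s δ u₀
              (fun _ => δ ^ (-(1 / (p : ℝ))) • ζ) (fun t => h t + δ⁻¹ • η) v →
            ∀ t ∈ Set.Icc 0 δ, v t = u δ t) ∧
        ∃ z : L2 d, (∀ᵐ x, z x = ζ x ^ p) ∧ MemH (s : ℝ) z ∧
          Tendsto (fun δ : ℝ => sobNorm (s : ℝ) (u δ δ - (u₀ + η - z))) (𝓝[>] 0) (𝓝 0) := by
  have hgB : BddSmooth g := ⟨hg, hgb⟩
  have hs1 : (1 : ℝ) ≤ s := by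
    have h1 : (1 : ℝ) ≤ d := by exact_mod_cast hd
    have h2 : (0 : ℝ) < s := by linarith
    exact_mod_cast h2
  rw [MemH, sobNorm_eq_wNorm] at hu₀ hη hζ
  replace hh := memL2H_iff.1 hh
  have hζ1 : wNorm ((s : ℝ) + 1) (coeff ζ) < ⊤ := (wNorm_mono (by linarith) _).trans_lt hζ
  have hζ0 : wNorm (s : ℝ) (coeff ζ) < ⊤ := (wNorm_mono (by linarith) _).trans_lt hζ
  obtain ⟨z, hz, hz1⟩ : ∃ z : L2 d, (∀ᵐ x, z x = ζ x ^ p) ∧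
      wNorm ((s : ℝ) + 1) (coeff z) < ⊤ := by
    obtain ⟨C, hC, H⟩ := exists_wNorm_pow_le (hs.trans (lt_add_one _)) hζ1 p
    obtain ⟨hm, hle⟩ := (H ζ (coeFn_memLp ζ) le_rfl).1
    refine ⟨hm.toLp _, hm.coeFn_toLp, ?_⟩
    rw [coeff_congr hm.coeFn_toLp]
    exact hle.trans_lt hC
  obtain ⟨D, hDk⟩ := exists_coeff_eq_freqSq_mul (v := ζ) ((wNorm_mono (by linarith) _).trans_lt hζ)
  have hD : wNorm (s : ℝ) (coeff D) < ⊤ := by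
    rw [funext hDk]
    exact (wNorm_freqSq_mul_le _ _).trans_lt hζ
  have hq : wNorm ((s : ℝ) + 1) (coeff (η - z : L2 d)) < ⊤ :=
    wNorm_coeff_sub_lt_top hη hz1
  -- The solutions will stay in the ball of radius `M`, which does not depend on `δ`.
  set M : ℝ≥0∞ := wNorm s (coeff u₀) + (wNorm s (coeff (η - z : L2 d)) + 1) with hMdef
  have hM : M < ⊤ := ENNReal.add_lt_top.2 ⟨(wNorm_mono (by linarith) _).trans_lt hu₀,
    ENNReal.add_lt_top.2 ⟨(wNorm_mono (by linarith) _).trans_lt hq, ENNReal.one_lt_top⟩⟩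
  obtain ⟨ρ, hρ0, hρ⟩ := exists_ae_abs_add_le hs hM hζ0
  obtain ⟨C₁, hC₁⟩ := exists_lipschitzWith_truncate (by omega) hPdeg hgB hρ0
  obtain ⟨C₂, hC₂, hrem⟩ := exists_wNorm_remainder_le (η := η) hs hν hp hPdeg hPmonic hgB hcond
    hM hζ0 hD hz
  -- In terms of `κ = δ^{1/p}` the controls are `κ⁻ᵖ • η` and `κ⁻¹ • ζ`.
  set κ : ℝ → ℝ := fun δ => δ ^ (1 / (p : ℝ)) with hκdef
  have hp0 : (0 : ℝ) < 1 / p := by positivity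
  have hκ : Tendsto κ (𝓝[>] 0) (𝓝 0) := by
    have h1 := (Real.continuousAt_rpow_const 0 (1 / (p : ℝ)) (Or.inr hp0.le)).tendsto
    rw [Real.zero_rpow hp0.ne'] at h1
    exact h1.mono_left nhdsWithin_le_nhds
  have hκe : Tendsto (fun δ => C₂ * ENNReal.ofReal (κ δ)) (𝓝[>] 0) (𝓝 0) := by
    have h1 := ENNReal.Tendsto.const_mul (ENNReal.tendsto_ofReal hκ) (Or.inr hC₂.ne)
    simpa using h1
  have hH : Tendsto (heatResponse ν s h) (𝓝[>] 0) (𝓝 0) := tendsto_heatResponse hT hh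
  set β : ℝ → ℝ≥0∞ := fun δ => ENNReal.ofReal √(ν * δ) * wNorm ((s : ℝ) + 1) (coeff u₀) +
    (ENNReal.ofReal √(ν * δ) * wNorm ((s : ℝ) + 1) (coeff (η - z : L2 d)) +
      C₂ * ENNReal.ofReal (κ δ) + heatResponse ν s h δ) with hβdef
  have hβ : Tendsto β (𝓝[>] 0) (𝓝 0) := by
    have h1 : Tendsto (fun δ => ENNReal.ofReal √(ν * δ)) (𝓝[>] 0) (𝓝 0) := by
      have h2 : Continuous fun δ : ℝ => ENNReal.ofReal √(ν * δ) :=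
        ENNReal.continuous_ofReal.comp (by fun_prop)
      have h3 := (h2.tendsto 0).mono_left (nhdsWithin_le_nhds (s := Ioi 0))
      simpa using h3
    have h4 := (ENNReal.Tendsto.mul_const h1 (Or.inr hu₀.ne)).add
      (((ENNReal.Tendsto.mul_const h1 (Or.inr hq.ne)).add hκe).add hH)
    simpa only [zero_mul, add_zero] using h4
  have hev : ∀ᶠ δ in 𝓝[>] (0 : ℝ), δ < T ∧ δ ≤ 1 ∧ C₁ * κ δ < 1 ∧
      C₂ * ENNReal.ofReal (κ δ) + heatResponse ν s h δ ≤ 1 := by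
    have h1 : Tendsto (fun δ => C₁ * κ δ) (𝓝[>] 0) (𝓝 0) := by simpa using hκ.const_mul (C₁ : ℝ)
    have h2 := hκe.add hH
    rw [add_zero] at h2
    filter_upwards [Ioo_mem_nhdsGT hT, Ioo_mem_nhdsGT one_pos, h1.eventually_lt_const one_pos,
      h2.eventually_lt_const one_pos] with δ ha hb hc hd
    exact ⟨ha.2, hb.2.le, hc, hd.le⟩
  obtain ⟨δ₀, hδ₀, hδ₀'⟩ := mem_nhdsGT_iff_exists_Ioo_subset.1 hev
  have hκpos : ∀ δ, 0 < δ → 0 < κ δ := fun δ hδ => Real.rpow_pos_of_pos hδ _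
  have hκpow : ∀ δ, 0 < δ → κ δ ^ p = δ := fun δ hδ => by
    rw [hκdef, one_div]
    exact Real.rpow_inv_natCast_pow hδ.le (by omega)
  have hκinv : ∀ δ, 0 < δ → δ ^ (-(1 / (p : ℝ))) = (κ δ)⁻¹ := fun δ hδ => Real.rpow_neg hδ.le _
  have hA : ∀ δ, ∀ k, coeff (δ⁻¹ • η - (ν * (κ δ)⁻¹) • D : L2 d) k =
      -((ν * freqSq k : ℝ) : ℂ) * coeff ((κ δ)⁻¹ • ζ : L2 d) k + coeff (δ⁻¹ • η : L2 d) k := by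
    intro δ k
    rw [coeff_Lp_sub, coeff_Lp_smul (ν * (κ δ)⁻¹), coeff_Lp_smul (κ δ)⁻¹, hDk]
    push_cast
    ring
  have hsmul : ∀ {σ : ℝ} {v : L2 d} (a : ℝ), wNorm σ (coeff v) < ⊤ →
      wNorm σ (coeff (a • v : L2 d)) < ⊤ := fun a hv => by
    rw [wNorm_coeff_smul]; exact ENNReal.mul_lt_top (by simp) hv
  have hsmulx : ∀ (a : ℝ) (v : L2 d), ∀ᵐ x, v x + (a • ζ : L2 d) x = v x + a * ζ x := by
    intro a v
    filter_upwards [Lp.coeFn_smul a ζ] with x hx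
    rw [hx]; rfl
  have hex : ∀ δ ∈ Ioo 0 δ₀, ∃ u : ℝ → L2 d,
      IsSolution ν (fun y => P.eval y + g y) s δ u₀ (fun _ => (κ δ)⁻¹ • ζ)
        (fun t => h t + δ⁻¹ • η) u ∧
      wNorm s (coeff (u δ - (u₀ + (η - z)) : L2 d)) ≤ β δ := by
    intro δ hδ
    obtain ⟨hδT, hδ1, hδC₁, hδC₂⟩ := hδ₀' hδ
    have hκ0 := hκpos δ hδ.1
    have hκ1 : κ δ ≤ 1 := Real.rpow_le_one hδ.1.le hδ1 hp0.le
    obtain ⟨K, hKκ, -, hK⟩ := hC₁ (κ δ) hκ0 hκ1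
    have hρ' : ∀ v : L2 d, wNorm s (coeff v) ≤ M →
        ∀ᵐ x, |v x + ((κ δ)⁻¹ • ζ : L2 d) x| ≤ (κ δ)⁻¹ * ρ := by
      intro v hv
      filter_upwards [hρ v hv (κ δ) hκ0 hκ1, hsmulx (κ δ)⁻¹ v] with x h1 h2
      rwa [h2]
    refine exists_isSolution hν hs1 hδ.1 hδ1 (hA δ) hK ?_ (hh.mono_time hδT.le) hu₀ hq
      (M := M) (ENNReal.mul_lt_top hC₂ ENNReal.ofReal_lt_top) hρ' (fun v hv => ?_) ?_
    · rw [← hκpow δ hδ.1, hKκ]; exact hδC₁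
    · have h1 := hrem (κ δ) hκ0 hκ1 _ K hK v hv (hρ v hv (κ δ) hκ0 hκ1)
      rwa [hκpow δ hδ.1] at h1
    · rw [hMdef, add_assoc (wNorm s (coeff (η - z : L2 d)))]
      gcongr
  have huniq : ∀ δ ∈ Ioo 0 δ₀, ∀ u v : ℝ → L2 d,
      IsSolution ν (fun y => P.eval y + g y) s δ u₀ (fun _ => (κ δ)⁻¹ • ζ)
        (fun t => h t + δ⁻¹ • η) u →
      IsSolution ν (fun y => P.eval y + g y) s δ u₀ (fun _ => (κ δ)⁻¹ • ζ)
        (fun t => h t + δ⁻¹ • η) v → ∀ t ∈ Icc 0 δ, v t = u t := by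
    intro δ hδ u v hu hv
    obtain ⟨hδT, hδ1, -, -⟩ := hδ₀' hδ
    refine IsSolution.unique hs hν hδ1 (hA δ) (hsmul _ hζ0) (fun r hr => ?_)
      ((hh.mono_time hδT.le).mono_exponent (by linarith)) hu hv
    obtain ⟨C, hC⟩ := exists_lipschitzWith_truncate (by omega) hPdeg hgB hr
    obtain ⟨K, -, hK, -⟩ := hC 1 one_pos le_rfl
    exact ⟨K, by simpa using hK⟩
  have hex' : ∀ δ, ∃ u : ℝ → L2 d, δ ∈ Ioo 0 δ₀ →
      IsSolution ν (fun y => P.eval y + g y) s δ u₀ (fun _ => (κ δ)⁻¹ • ζ)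
        (fun t => h t + δ⁻¹ • η) u ∧
      wNorm s (coeff (u δ - (u₀ + (η - z)) : L2 d)) ≤ β δ := by
    intro δ
    by_cases hδ : δ ∈ Ioo 0 δ₀
    · obtain ⟨u, hu⟩ := hex δ hδ
      exact ⟨u, fun _ => hu⟩
    · exact ⟨0, fun h' => absurd h' hδ⟩
  choose u hu using hex'
  refine ⟨min δ₀ T, lt_min hδ₀ hT, min_le_right _ _, u, fun δ hδ => ?_, z, hz, ?_, ?_⟩
  · have hδ' : δ ∈ Ioo 0 δ₀ := ⟨hδ.1, hδ.2.trans_le (min_le_left _ _)⟩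
    rw [hκinv δ hδ.1]
    exact ⟨⟨memL2H_const (hsmul _ ((wNorm_mono (by linarith) _).trans_lt hη)),
      memCH_const (hsmul _ hζ1), u δ, (hu δ hδ').1⟩, (hu δ hδ').1,
      fun v hv => huniq δ hδ' _ _ (hu δ hδ').1 hv⟩
  · rw [MemH, sobNorm_eq_wNorm]
    exact (wNorm_mono (by linarith) _).trans_lt hz1
  · refine tendsto_of_tendsto_of_tendsto_of_le_of_le' tendsto_const_nhds hβ
      (.of_forall fun _ => zero_le) ?_
    filter_upwards [Ioo_mem_nhdsGT hδ₀] with δ hδ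
    rw [sobNorm_eq_wNorm, add_sub_assoc u₀]
    exact (hu δ hδ).2
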